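/- Let $\mathbb{B}^2=\{z\in\mathbb{C}^2 : |z_1|^2+|z_2|^2<1\}$, let $\mathrm{SU}((2,1),\mathbb{C})=\{A\in \mathrm{SL}(3,\mathbb{C}) : A^*HA=H\}$ with $H=\mathrm{diag}(1,1,-1)$, acting on $\mathbb{B}^2$ by fractional linear transformations, and let $\Gamma\subset\mathrm{SU}((2,1),\mathbb{C})$ be a discrete, torsion-free, cocompact subgroup, with compact quotient surface $X_\Gamma=\Gamma\backslash\mathbb{B}^2$. Let $\mu_{\mathrm{hyp}}(z)=-\frac{i}{2}\partial\overline{\partial}\log(1-|z|^2)$ be the hyperbolic metric, and for a metric $\mu$ (a real $(1,1)$-form) let $\mu^{\mathrm{vol}}=\frac{1}{2!}\,\mu\wedge\mu$ be its volume form, so that $\mu^{\mathrm{vol}}_{\mathrm{hyp}}=(i/2)^2(1-|z|^2)^{-3}dz_1\wedge d\overline{z_1}\wedge dz_2\wedge d\overline{z_2}$. Let $\Lambda=\Omega^2_{X_\Gamma}$ be the bundle of holomorphic $(2,0)$-forms. For $k\ge 1$, give $\Lambda^{\otimes k}$ the pointwise metric with $|f(z)(dz_1\wedge dz_2)^{\otimes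 k}|^2_{\mathrm{hyp}}=(1-|z|^2)^{3k}|f(z)|^2$, and $H^0(X_\Gamma,\Lambda^{\otimes k})$ the inner product $\langle\omega,\eta\rangle_{\mathrm{hyp}}=\int_{X_\Gamma}\langle\omega(z),\eta(z)\rangle_{\mathrm{hyp}}\,\mu^{\mathrm{vol}}_{\mathrm{hyp}}(z)$. Let $\mathcal{B}^k_\Lambda(z,w)=\sum_{j}\omega_j(z)\overline{\omega_j(w)}$ be the Bergman kernel, where $(\omega_j)_j$ is any finite orthonormal basis of $H^0(X_\Gamma,\Lambda^{\otimes k})$; thus $|\mathcal{B}^k_\Lambda(z,z)|_{\mathrm{hyp}}=\sum_j|\omega_j(z)|^2_{\mathrm{hyp}}$. Let $$\mu_{\mathrm{ber}}(z)=-\frac{i}{2\pi}\,\partial\overline{\partial}\log|\mathcal{B}^k_\Lambda(z,z)|_{\mathrm{hyp}}$$ be the Bergman metric of $\Lambda^{\otimes k}$. Then there is an integer $k_0$, depending only on $\Gamma$, such that for all $k\ge k_0$ a finite orthonormal basis exists and $|\mathcal{B}^k_\Lambda(z,z)|_{\mathrm{hyp}}>0$ for all $z\in X_\Gamma$ (so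 that $\mu_{\mathrm{ber}}$ is defined everywhere), and for every $\epsilon>0$ there is a constant $C$, depending only on $\Gamma$ and $\epsilon$, such that for all $k\geq k_0$ $$\sup_{z\in X_\Gamma}\left|\frac{\mu^{\mathrm{vol}}_{\mathrm{ber}}(z)}{\mu^{\mathrm{vol}}_{\mathrm{hyp}}(z)}\right|\le C\,k^{4+\epsilon}.$$ -/

import Mathlib

open scoped TensorProduct ComplexConjugate

noncomputable section

namespace PicardBergman

/-! ### The ball and the group `SU((2,1), ℂ)` -/

/-- The open unit ball `𝔹² = {z : |z₁|² + |z₂|² < 1}` in `ℂ²`. -/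
def Ball : Set (Fin 2 → ℂ) := {z | ‖z 0‖ ^ 2 + ‖z 1‖ ^ 2 < 1}

/-- The Hermitian matrix `H = diag(1, 1, -1)`. -/
def hermH : Matrix (Fin 3) (Fin 3) ℂ := Matrix.diagonal ![1, 1, -1]

/-- `SU((2,1), ℂ) = {A ∈ SL(3, ℂ) : A* H A = H}`. -/
def SU21 : Subgroup (Matrix.SpecialLinearGroup (Fin 3) ℂ) where
  carrier := {A | A.1.conjTranspose * hermH * A.1 = hermH}
  one_mem' := by simp
  mul_mem' := by
    intro A B hA hB
    simp only [Set.mem_ofPred_eq] at hA hB ⊢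
    rw [Matrix.SpecialLinearGroup.coe_mul, Matrix.conjTranspose_mul]
    calc _ = B.1.conjTranspose * (A.1.conjTranspose * hermH * A.1) * B.1 := by
          simp only [Matrix.mul_assoc]
      _ = hermH := by rw [hA, hB]
  inv_mem' := by
    intro A hA
    simp only [Set.mem_ofPred_eq] at hA ⊢
    have h1 : A.1 * (A⁻¹).1 = 1 := by
      rw [← Matrix.SpecialLinearGroup.coe_mul, mul_inv_cancel]; rfl
    have h2 : (A⁻¹).1.conjTranspose * A.1.conjTranspose = 1 := by
      rw [← Matrix.conjTranspose_mul, h1, Matrix.conjTranspose_one]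
    calc _ = (A⁻¹).1.conjTranspose * (A.1.conjTranspose * hermH * A.1) * (A⁻¹).1 := by rw [hA]
      _ = ((A⁻¹).1.conjTranspose * A.1.conjTranspose) * hermH * (A.1 * (A⁻¹).1) := by
          simp only [Matrix.mul_assoc]
      _ = hermH := by rw [h1, h2]; simp

/-- The lift `z̃ = (z₁, z₂, 1)` of a point of `ℂ²`. -/
def lift (z : Fin 2 → ℂ) : Fin 3 → ℂ := ![z 0, z 1, 1]

/-- The fractional linear map `z ↦ (Az + B) / (Cz + D)` of a matrix in block form `(A B; C D)`. -/
def moebius (g : Matrix (Fin 3) (Fin 3) ℂ) (z : Fin 2 → ℂ) : Fin 2 → ℂ :=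
  ![(g.mulVec (lift z)) 0 / (g.mulVec (lift z)) 2, (g.mulVec (lift z)) 1 / (g.mulVec (lift z)) 2]

/-- The underlying matrix of an element of `SU((2,1), ℂ)`. -/
def mat (g : SU21) : Matrix (Fin 3) (Fin 3) ℂ := (g : Matrix.SpecialLinearGroup (Fin 3) ℂ)

lemma mat_mul (g h : SU21) : mat (g * h) = mat g * mat h := by
  simp [mat]

lemma mat_one : mat 1 = 1 := by
  simp [mat]

lemma mat_mem (g : SU21) : (mat g).conjTranspose * hermH * mat g = hermH := g.2

lemma form_preserved (g : SU21) (v : Fin 3 → ℂ) :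
    ‖((mat g).mulVec v) 0‖ ^ 2 + ‖((mat g).mulVec v) 1‖ ^ 2 - ‖((mat g).mulVec v) 2‖ ^ 2
      = ‖v 0‖ ^ 2 + ‖v 1‖ ^ 2 - ‖v 2‖ ^ 2 := by
  have key : ∀ u : Fin 3 → ℂ, dotProduct (star u) (hermH.mulVec u)
      = ((‖u 0‖ ^ 2 + ‖u 1‖ ^ 2 - ‖u 2‖ ^ 2 : ℝ) : ℂ) := by
    intro u
    simp only [hermH, dotProduct, Fin.sum_univ_three, Matrix.mulVec_diagonal, Pi.star_apply]
    push_cast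
    simp only [← Complex.conj_mul']
    simp
    ring
  have h : dotProduct (star ((mat g).mulVec v)) (hermH.mulVec ((mat g).mulVec v))
      = dotProduct (star v) (hermH.mulVec v) := by
    rw [Matrix.star_mulVec, ← Matrix.dotProduct_mulVec, Matrix.mulVec_mulVec, Matrix.mulVec_mulVec,
      mat_mem]
  rw [key, key] at h
  exact_mod_cast h

lemma denom_ne_zero (g : SU21) {z : Fin 2 → ℂ} (hz : z ∈ Ball) :
    ((mat g).mulVec (lift z)) 2 ≠ 0 := by
  intro h0
  have h := form_preserved g (lift z)
  have hz' : ‖z 0‖ ^ 2 + ‖z 1‖ ^ 2 < 1 := hz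
  have h2 : ‖lift z 0‖ ^ 2 + ‖lift z 1‖ ^ 2 - ‖lift z 2‖ ^ 2 = ‖z 0‖ ^ 2 + ‖z 1‖ ^ 2 - 1 := by
    simp [lift]
  rw [h2, h0, norm_zero] at h
  nlinarith [sq_nonneg ‖((mat g).mulVec (lift z)) 0‖, sq_nonneg ‖((mat g).mulVec (lift z)) 1‖]

lemma moebius_mem (g : SU21) {z : Fin 2 → ℂ} (hz : z ∈ Ball) : moebius (mat g) z ∈ Ball := by
  have h := form_preserved g (lift z)
  have hz' : ‖z 0‖ ^ 2 + ‖z 1‖ ^ 2 < 1 := hz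
  have hd : 0 < ‖((mat g).mulVec (lift z)) 2‖ ^ 2 :=
    pow_pos (norm_pos_iff.mpr (denom_ne_zero g hz)) 2
  have h2 : ‖lift z 0‖ ^ 2 + ‖lift z 1‖ ^ 2 - ‖lift z 2‖ ^ 2 = ‖z 0‖ ^ 2 + ‖z 1‖ ^ 2 - 1 := by
    simp [lift]
  rw [h2] at h
  change ‖moebius (mat g) z 0‖ ^ 2 + ‖moebius (mat g) z 1‖ ^ 2 < 1
  simp only [moebius, Matrix.cons_val_zero, Matrix.cons_val_one, norm_div, div_pow]
  rw [← add_div, div_lt_one hd]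
  linarith

lemma lift_moebius (g : SU21) {z : Fin 2 → ℂ} (hz : z ∈ Ball) :
    lift (moebius (mat g) z) = (((mat g).mulVec (lift z)) 2)⁻¹ • (mat g).mulVec (lift z) := by
  have hd := denom_ne_zero g hz
  ext i
  fin_cases i
  · simp [lift, moebius, div_eq_inv_mul]
  · simp [lift, moebius, div_eq_inv_mul]
  · change (1 : ℂ) = (((mat g).mulVec (lift z)) 2)⁻¹ * ((mat g).mulVec (lift z)) 2
    rw [inv_mul_cancel₀ hd]

/-- `SU((2,1), ℂ)` acts on the ball by fractional linear transformations. -/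
instance : MulAction SU21 Ball where
  smul g z := ⟨moebius (mat g) z.1, moebius_mem g z.2⟩
  one_smul z := by
    apply Subtype.ext
    change moebius (mat 1) z.1 = z.1
    rw [mat_one]
    ext i
    fin_cases i <;> simp [moebius, lift]
  mul_smul g h z := by
    apply Subtype.ext
    change moebius (mat (g * h)) z.1 = moebius (mat g) (moebius (mat h) z.1)
    have hd := inv_ne_zero (denom_ne_zero h z.2)
    unfold moebius
    have e := lift_moebius h z.2
    unfold moebius at e
    rw [e, mat_mul, Matrix.mulVec_smul, Matrix.mulVec_mulVec]
    simp only [Pi.smul_apply, smul_eq_mul, mul_div_mul_left _ _ hd]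

/-- The quotient surface `X_Γ = Γ \ 𝔹²`, with the quotient topology. -/
abbrev Surface (Γ : Subgroup SU21) : Type := Quotient (MulAction.orbitRel Γ Ball)

/-- `Γ` is a discrete, torsion-free subgroup of `SU((2,1), ℂ)` with compact quotient `Γ \ 𝔹²`. -/
structure IsPicardGroup (Γ : Subgroup SU21) : Prop where
  discrete : DiscreteTopology Γ
  torsionFree : ∀ g ∈ Γ, IsOfFinOrder g → g = 1
  cocompact : CompactSpace (Surface Γ)

/-! ### Sections of `Λ^{⊗ k}`, where `Λ` is the bundle of holomorphic `(2,0)`-forms -/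

/-- The fibre of `Λ`: complex-bilinear alternating forms on the tangent space `ℂ²`. -/
abbrev CanFiber : Type := (Fin 2 → ℂ) [⋀^Fin 2]→ₗ[ℂ] ℂ

/-- The fibre of `Λ^{⊗ k}`. -/
abbrev CanPow (k : ℕ) : Type := ⨂[ℂ]^k CanFiber

/-- The value of a `(2,0)`-form on the frame `(∂/∂z₁, ∂/∂z₂)`. -/
def frameEval : CanFiber →ₗ[ℂ] ℂ where
  toFun η := η ![Pi.single 0 1, Pi.single 1 1]
  map_add' _ _ := rfl
  map_smul' _ _ := rfl

/-- The coefficient `f` of `η = f (dz₁ ∧ dz₂)^{⊗ k}`. -/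
def coeff (k : ℕ) : CanPow k →ₗ[ℂ] ℂ :=
  PiTensorProduct.lift ((MultilinearMap.mkPiAlgebra ℂ (Fin k) ℂ).compLinearMap fun _ => frameEval)

/-- Pull-back of `(2,0)`-forms along a complex-linear map `L` of tangent spaces. -/
def pullForm (L : (Fin 2 → ℂ) →ₗ[ℂ] (Fin 2 → ℂ)) : CanFiber →ₗ[ℂ] CanFiber where
  toFun η := η.compLinearMap L
  map_add' _ _ := rfl
  map_smul' _ _ := rfl

/-- Pull-back of elements of the fibre of `Λ^{⊗ k}` along `L`. -/
def pullPow (k : ℕ) (L : (Fin 2 → ℂ) →ₗ[ℂ] (Fin 2 → ℂ)) : CanPow k →ₗ[ℂ] CanPow k :=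
  PiTensorProduct.map fun _ => pullForm L

/-- Extension by zero of a function on the ball to `ℂ²`. It only serves to differentiate at points
of the ball, which is open, so that the values outside the ball play no role. -/
def ext0 (f : Ball → ℂ) : (Fin 2 → ℂ) → ℂ := Function.extend Subtype.val f 0

lemma ext0_apply (f : Ball → ℂ) {z : Fin 2 → ℂ} (hz : z ∈ Ball) : ext0 f z = f ⟨z, hz⟩ :=
  Subtype.val_injective.extend_apply f 0 ⟨z, hz⟩

/-- `H⁰(X_Γ, Λ^{⊗ k})`. A global section of `Λ^{⊗ k}` over `X_Γ = Γ \ 𝔹²` is given by a holomorphic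
section `ω` of `Λ^{⊗ k}` over the ball with `γ^* ω = ω` for all `γ ∈ Γ`, where `(γ^* ω)(z)` is the
pull-back of `ω(γ z)` along the complex derivative of `γ` at `z`. -/
def globalSections (Γ : Subgroup SU21) (k : ℕ) : Submodule ℂ (Ball → CanPow k) where
  carrier := {ω | DifferentiableOn ℂ (ext0 fun z => coeff k (ω z)) Ball ∧
    ∀ γ : Γ, ∀ z : Ball,
      pullPow k (fderiv ℂ (moebius (mat γ)) z.1 : (Fin 2 → ℂ) →ₗ[ℂ] (Fin 2 → ℂ)) (ω (γ • z)) = ω z}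
  zero_mem' := by
    refine ⟨(differentiableOn_const (0 : ℂ)).congr fun z hz => ?_, fun γ z => ?_⟩
    · rw [ext0_apply _ hz]; simp
    · simp
  add_mem' := by
    rintro ω η ⟨h1, h2⟩ ⟨h3, h4⟩
    refine ⟨(h1.add h3).congr fun z hz => ?_, fun γ z => ?_⟩
    · simp [ext0_apply _ hz]
    · simp only [Pi.add_apply, map_add, h2, h4]
  smul_mem' := by
    rintro c ω ⟨h1, h2⟩
    refine ⟨(h1.const_smul c).congr fun z hz => ?_, fun γ z => ?_⟩
    · simp [ext0_apply _ hz]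
    · simp only [Pi.smul_apply, map_smul, h2]

/-! ### The metrics induced by the hyperbolic metric -/

/-- `1 - |z|²`. -/
def defect (z : Fin 2 → ℂ) : ℝ := 1 - (‖z 0‖ ^ 2 + ‖z 1‖ ^ 2)

/-- The volume measure of the hyperbolic metric on the ball: `(1 - |z|²)⁻³` times the
Lebesgue measure. -/
def hypMeasure : MeasureTheory.Measure Ball :=
  (MeasureTheory.Measure.comap Subtype.val MeasureTheory.volume).withDensity fun z : Ball =>
    ENNReal.ofReal ((defect z.1 ^ 3)⁻¹)

open Classical in
/-- A fixed fundamental domain of `Γ` (the integral below does not depend on the choice). -/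
def fundDomain (Γ : Subgroup SU21) : Set Ball :=
  if h : ∃ F : Set Ball, MeasureTheory.IsFundamentalDomain Γ F hypMeasure then h.choose else ∅

/-- The hermitian inner product on the fibre of `Λ^{⊗ k}` at `z` that is induced by the hyperbolic
metric: `|dz₁ ∧ dz₂|²_hyp = (1 - |z|²)³`. -/
def fiberInner (k : ℕ) (z : Fin 2 → ℂ) (η θ : CanPow k) : ℂ :=
  (defect z : ℂ) ^ (3 * k) * (coeff k η * conj (coeff k θ))

/-- The `L²` inner product `⟨ω, η⟩_hyp = ∫_{X_Γ} ⟨ω(z), η(z)⟩ dμ_hyp^vol(z)`. -/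
def hypInner (Γ : Subgroup SU21) (k : ℕ) (ω η : Ball → CanPow k) : ℂ :=
  ∫ z in fundDomain Γ, fiberInner k z.1 (ω z) (η z) ∂hypMeasure

/-- `ω₁, …, ω_d` is an orthonormal basis of `H⁰(X_Γ, Λ^{⊗ k})`. -/
structure IsOrthonormalBasis (Γ : Subgroup SU21) (k : ℕ) {d : ℕ} (ω : Fin d → Ball → CanPow k) :
    Prop where
  span_eq : Submodule.span ℂ (Set.range ω) = globalSections Γ k
  orthonormal : ∀ i j, hypInner Γ k (ω i) (ω j) = if i = j then 1 else 0

/-- The Bergman kernel `B(z, w) = ∑ ωⱼ(z) ⊗ conj ωⱼ(w)`, written in the frame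
`(dz₁ ∧ dz₂)^{⊗ k} ⊗ conj (dw₁ ∧ dw₂)^{⊗ k}`. -/
def bergmanKernel (k : ℕ) {d : ℕ} (ω : Fin d → Ball → CanPow k) (z w : Ball) : ℂ :=
  ∑ j, coeff k (ω j z) * conj (coeff k (ω j w))

/-- The pointwise norm `|B(z, z)|_hyp = (1 - |z|²)^{3k} |∑ⱼ fⱼ(z) conj fⱼ(z)|` on the diagonal, where
`ωⱼ = fⱼ (dz₁ ∧ dz₂)^{⊗ k}`. -/
def bergmanNorm (k : ℕ) {d : ℕ} (ω : Fin d → Ball → CanPow k) (z : Ball) : ℝ :=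
  defect z.1 ^ (3 * k) * ‖bergmanKernel k ω z z‖

/-! ### Differential forms and volume forms -/

/-- Complex-valued real-alternating `n`-forms at a point of `ℂ² = ℝ⁴`. -/
abbrev Form (n : ℕ) : Type := (Fin 2 → ℂ) [⋀^Fin n]→ₗ[ℝ] ℂ

/-- The wedge product of forms. -/
def wedge {m n : ℕ} (α : Form m) (β : Form n) : Form (m + n) :=
  ((LinearMap.mul' ℝ ℂ).compAlternatingMap (α.domCoprod β)).domDomCongr finSumFinEquiv

/-- The one-form `dz_i`. -/
def dz (i : Fin 2) : Form 1 :=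
  AlternatingMap.ofSubsingleton ℝ (Fin 2 → ℂ) ℂ 0 (LinearMap.proj i)

/-- The one-form `d\bar z_i`. -/
def dzbar (i : Fin 2) : Form 1 :=
  AlternatingMap.ofSubsingleton ℝ (Fin 2 → ℂ) ℂ 0 (Complex.conjLIE.toLinearMap ∘ₗ LinearMap.proj i)

/-- The Wirtinger derivative `∂φ/∂z_i = (∂φ/∂x_i - √-1 ∂φ/∂y_i) / 2`. -/
def wirt (i : Fin 2) (φ : (Fin 2 → ℂ) → ℂ) (z : Fin 2 → ℂ) : ℂ :=
  (fderiv ℝ φ z (Pi.single i 1) - Complex.I * fderiv ℝ φ z (Pi.single i Complex.I)) / 2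

/-- The Wirtinger derivative `∂φ/∂\bar z_i = (∂φ/∂x_i + √-1 ∂φ/∂y_i) / 2`. -/
def wirtBar (i : Fin 2) (φ : (Fin 2 → ℂ) → ℂ) (z : Fin 2 → ℂ) : ℂ :=
  (fderiv ℝ φ z (Pi.single i 1) + Complex.I * fderiv ℝ φ z (Pi.single i Complex.I)) / 2

/-- `∂\bar∂ φ = ∑ᵢⱼ ∂²φ/∂z_i∂\bar z_j dz_i ∧ d\bar z_j` at `z`. -/
def ddbar (φ : (Fin 2 → ℂ) → ℂ) (z : Fin 2 → ℂ) : Form 2 :=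
  ∑ i, ∑ j, wirt i (wirtBar j φ) z • wedge (dz i) (dzbar j)

/-- The volume form `(1/2!) μ ∧ μ` of a `(1,1)`-form `μ`. -/
def volForm (μ : Form 2) : Form 4 := (1 / 2 : ℂ) • wedge μ μ

/-- The hyperbolic metric `μ_hyp = -(i/2) ∂\bar∂ log(1 - |z|²)`. -/
def hypMetric (z : Ball) : Form 2 :=
  (-(Complex.I / 2)) • ddbar (fun w => ((Real.log (defect w) : ℝ) : ℂ)) z.1

/-- The Bergman metric `μ_ber = -(i/2π) ∂\bar∂ log |B(z, z)|_hyp`. -/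
def bergmanMetric (k : ℕ) {d : ℕ} (ω : Fin d → Ball → CanPow k) (z : Ball) : Form 2 :=
  (-(Complex.I / (2 * Real.pi))) •
    ddbar (ext0 fun w => ((Real.log (bergmanNorm k ω w) : ℝ) : ℂ)) z.1

end PicardBergman

end

noncomputable section

namespace PicardBergman

/-! ### The Hermitian form and the invariant proximity function -/

/-! The Bergman kernel on the diagonal is, up to constants depending only on `Γ`, of size `k ^ 2` at
every point (`IsPicardGroup.exists_bergmanNorm_le`, `IsPicardGroup.exists_le_bergmanNorm`). Cauchy
estimates then control the Bergman metric, and the ratio of volume forms comes out as `O(k ^ 2)`,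
stronger than the required `k ^ (4 + ε)`. Neither an asymptotic expansion nor positivity of the
Bergman metric enters.

Upper bound: a hyperbolic ball whose squared radius is about `1 / k` injects into the quotient, and
the weight `(1 - |z|²) ^ (3 * k)` is comparable to a constant on it once its centre is moved to the
origin. The mean value inequality gives `|ω(z)|² ≤ C k² ‖ω‖²` for every section, and it is applied
to the section representing evaluation at `z`.

Lower bound: the kernel at `w` dominates `|η(w)|² / ‖η‖²` for every nonzero section `η`. The test
section is the Poincaré series `∑ ⟨γ z, w⟩ ^ (-3k)`, which up to a constant averages the weighted
Bergman kernel of the ball over `Γ`. At `z = w` the identity term dominates for large `k`, because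
nontrivial elements have displacement bounded below. The `L²` norm unfolds to an integral over the
ball, bounded by a Gaussian of width `k ^ (-1/2)`, hence of order `1 / k²`. All series are compared
with `∑ prox (γ • z) w ^ 6`, where `prox` is the inverse hyperbolic cosine of distance, `1 / cosh
d`; these sums are uniformly bounded (`IsPicardGroup.exists_orbit_sum_le`).

Volume: by homogeneity a point is moved to the origin, where the Hessian of `log (1 - |z|²)` is
`-1`. By `volForm_bergmanMetric` the ratio is, up to `π⁻²`, the determinant of the Hessian of `log ∑
|F_j|²` minus `3k` times the identity, with `F_j` the transported orthonormal basis. As one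
Hilbert-space-valued holomorphic map, `F` has squared norm `O(k²)` on the discs of radius `(2k) ^
(-1/2)` in the coordinate directions, so its first derivatives there have squared norm `O(k³)`.
Dividing by `|F|²`, which is at least of order `k²`, bounds the entries of the Hessian by `O(k)` and
the determinant by `O(k²)`. -/

/-- The Hermitian form of signature `(1, 2)` on `ℂ³` given by `-H`. -/
def herm (u v : Fin 3 → ℂ) : ℂ := u 2 * conj (v 2) - u 0 * conj (v 0) - u 1 * conj (v 1)

lemma herm_mulVec (g : SU21) (u v : Fin 3 → ℂ) :
    herm ((mat g).mulVec u) ((mat g).mulVec v) = herm u v := by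
  have key : ∀ u v : Fin 3 → ℂ, herm u v = - dotProduct (star v) (hermH.mulVec u) := by
    intro u v
    simp [herm, hermH, dotProduct, Fin.sum_univ_three, Matrix.mulVec_diagonal]
    ring
  rw [key, key, Matrix.star_mulVec, ← Matrix.dotProduct_mulVec, Matrix.mulVec_mulVec,
    Matrix.mulVec_mulVec, mat_mem]

lemma herm_smul (a b : ℂ) (u v : Fin 3 → ℂ) : herm (a • u) (b • v) = a * conj b * herm u v := by
  simp [herm]; ring

lemma herm_conj (u v : Fin 3 → ℂ) : conj (herm u v) = herm v u := by
  simp [herm]; ring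

lemma herm_lift_self (z : Fin 2 → ℂ) : herm (lift z) (lift z) = (defect z : ℂ) := by
  simp [herm, lift, defect, Complex.mul_conj']; ring

lemma defect_pos (z : Ball) : 0 < defect z.1 := by
  have h : ‖z.1 0‖ ^ 2 + ‖z.1 1‖ ^ 2 < 1 := z.2
  unfold defect; linarith

lemma defect_le_one (z : Fin 2 → ℂ) : defect z ≤ 1 := by
  unfold defect; nlinarith [sq_nonneg ‖z 0‖, sq_nonneg ‖z 1‖]

lemma mem_Ball_iff {z : Fin 2 → ℂ} : z ∈ Ball ↔ 0 < defect z := by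
  unfold defect Ball; simp

lemma coe_smul (g : SU21) (z : Ball) : (g • z).1 = moebius (mat g) z.1 := rfl

/-- The automorphy factor `Cz + D`. -/
def autFactor (g : SU21) (z : Fin 2 → ℂ) : ℂ := ((mat g).mulVec (lift z)) 2

lemma autFactor_ne_zero (g : SU21) (z : Ball) : autFactor g z.1 ≠ 0 := denom_ne_zero g z.2

lemma mulVec_lift (g : SU21) (z : Ball) :
    (mat g).mulVec (lift z.1) = autFactor g z.1 • lift (g • z).1 := by
  rw [coe_smul, lift_moebius g z.2, smul_smul, autFactor, mul_inv_cancel₀ (denom_ne_zero g z.2),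
    one_smul]

lemma autFactor_mul (g h : SU21) (z : Ball) :
    autFactor (g * h) z.1 = autFactor g (h • z).1 * autFactor h z.1 := by
  have := congrFun (congrArg (mat g).mulVec (mulVec_lift h z)) 2
  rw [Matrix.mulVec_mulVec, ← mat_mul, Matrix.mulVec_smul] at this
  rw [autFactor, this, autFactor, Pi.smul_apply, smul_eq_mul, mul_comm]; rfl

/-- The form is invariant on `ℂ³`, and returning to affine coordinates costs one automorphy factor
per vector. The case `z = w` is the transformation law `defect_smul`. -/
lemma herm_smul_smul (g : SU21) (z w : Ball) :
    autFactor g z.1 * conj (autFactor g w.1) * herm (lift (g • z).1) (lift (g • w).1)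
      = herm (lift z.1) (lift w.1) := by
  rw [← herm_smul, ← mulVec_lift, ← mulVec_lift, herm_mulVec]

lemma defect_smul (g : SU21) (z : Ball) :
    ‖autFactor g z.1‖ ^ 2 * defect (g • z).1 = defect z.1 := by
  have h := herm_smul_smul g z z
  rw [herm_lift_self, herm_lift_self, Complex.mul_conj'] at h
  exact_mod_cast h

/-- The origin of the ball. -/
def origin : Ball := ⟨0, by simp [Ball]⟩

lemma lift_origin : lift origin.1 = ![0, 0, 1] := by simp [lift, origin]

lemma defect_origin : defect origin.1 = 1 := by simp [defect, origin]

lemma herm_lift_origin (z : Fin 2 → ℂ) : herm (lift z) (lift origin.1) = 1 := by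
  simp [herm, lift, origin]

/-- The boost carrying the origin to a given point of the ball. -/
lemma exists_smul_origin (w : Ball) : ∃ g : SU21, g • origin = w := by
  have hs := Real.sqrt_pos.2 (defect_pos w)
  set s := Real.sqrt (defect w.1) with hsdef
  have hs2 : s ^ 2 = defect w.1 := Real.sq_sqrt (defect_pos w).le
  have hsC : (s : ℂ) ≠ 0 := by exact_mod_cast hs.ne'
  have hs1 : (1 + s : ℂ) ≠ 0 := by
    have : (0 : ℝ) < 1 + s := by positivity
    exact_mod_cast this.ne'
  set a := w.1 0
  set b := w.1 1
  have hs2C : (s : ℂ) ^ 2 = 1 - (a * conj a + b * conj b) := by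
    have : ((s ^ 2 : ℝ) : ℂ) = (defect w.1 : ℂ) := by rw [hs2]
    push_cast at this
    rw [this, defect, Complex.mul_conj', Complex.mul_conj']; push_cast; rfl
  -- The entries of the standard boost: `u = cosh d(0, w)` and `t = (u - 1) / |w|²`, the latter
  -- written without dividing by `|w|²` so that `w = 0` is not a special case.
  obtain ⟨u, hu⟩ : ∃ u : ℂ, u = 1 / s := ⟨_, rfl⟩
  obtain ⟨t, ht⟩ : ∃ t : ℂ, t = 1 / (s * (1 + s)) := ⟨_, rfl⟩
  have h1 : u ^ 2 * (1 - (a * conj a + b * conj b)) = 1 := by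
    rw [← hs2C, hu]; field_simp
  have h3 : t * (1 + u) = u ^ 2 := by
    rw [hu, ht]; field_simp; ring
  have h2 : t * (a * conj a + b * conj b) = u - 1 := by
    have : a * conj a + b * conj b = 1 - (s : ℂ) ^ 2 := by rw [hs2C]; ring
    rw [this, hu, ht]; field_simp; ring
  have hcu : conj u = u := by rw [hu]; simp
  have hct : conj t = t := by rw [ht]; simp
  have hus : u ≠ 0 := by rw [hu]; exact one_div_ne_zero hsC
  let A : Matrix (Fin 3) (Fin 3) ℂ :=
    !![1 + t * (a * conj a), t * (a * conj b), a * u;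
       t * (b * conj a), 1 + t * (b * conj b), b * u;
       conj a * u, conj b * u, u]
  have hdet : A.det = 1 := by
    rw [Matrix.det_fin_three]
    simp only [A, Matrix.of_apply, Matrix.cons_val]
    linear_combination u * h2 + h1
  have hA : A.conjTranspose * hermH * A = hermH := by
    ext i j
    fin_cases i <;> fin_cases j <;>
      simp [A, hermH, Matrix.mul_apply, Fin.sum_univ_three, hcu, hct]
    · linear_combination (a * conj a) * (t * h2 + h3)
    · linear_combination (a * conj b) * (t * h2 + h3)
    · linear_combination a * u * h2
    · linear_combination (b * conj a) * (t * h2 + h3)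
    · linear_combination (b * conj b) * (t * h2 + h3)
    · linear_combination b * u * h2
    · linear_combination conj a * u * h2
    · linear_combination conj b * u * h2
    · linear_combination -h1
  refine ⟨⟨⟨A, hdet⟩, hA⟩, Subtype.ext ?_⟩
  change moebius A origin.1 = w.1
  rw [moebius, lift_origin]
  ext i
  fin_cases i
  · simp [A, Matrix.mulVec, dotProduct, Fin.sum_univ_three, hus, a]
  · simp [A, Matrix.mulVec, dotProduct, Fin.sum_univ_three, hus, b]

lemma exists_smul_eq (z w : Ball) : ∃ g : SU21, g • z = w := by
  obtain ⟨g, hg⟩ := exists_smul_origin z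
  obtain ⟨h, hh⟩ := exists_smul_origin w
  exact ⟨h * g⁻¹, by rw [mul_smul, ← hg, inv_smul_smul, hh]⟩

/-- The invariant `1 / cosh d(z, w)` of a pair of points of the ball. -/
def prox (z w : Ball) : ℝ :=
  Real.sqrt (defect z.1) * Real.sqrt (defect w.1) / ‖herm (lift z.1) (lift w.1)‖

lemma prox_comm (z w : Ball) : prox z w = prox w z := by
  rw [prox, prox, mul_comm, ← herm_conj, Complex.norm_conj]

lemma sqrt_defect_smul (g : SU21) (z : Ball) :
    ‖autFactor g z.1‖ * Real.sqrt (defect (g • z).1) = Real.sqrt (defect z.1) := by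
  rw [← defect_smul g z, Real.sqrt_mul (sq_nonneg _), Real.sqrt_sq (norm_nonneg _)]

@[simp] lemma prox_smul (g : SU21) (z w : Ball) : prox (g • z) (g • w) = prox z w := by
  have h := congrArg norm (herm_smul_smul g z w)
  rw [norm_mul, norm_mul, Complex.norm_conj] at h
  have hz := norm_pos_iff.2 (autFactor_ne_zero g z)
  have hw := norm_pos_iff.2 (autFactor_ne_zero g w)
  rw [prox, prox, ← h, ← sqrt_defect_smul g z, ← sqrt_defect_smul g w]
  rw [show ‖autFactor g z.1‖ * √(defect (g • z).1) * (‖autFactor g w.1‖ * √(defect (g • w).1))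
    = (‖autFactor g z.1‖ * ‖autFactor g w.1‖) * (√(defect (g • z).1) * √(defect (g • w).1)) by ring,
    mul_div_mul_left _ _ (by positivity)]

lemma prox_origin (z : Ball) : prox z origin = Real.sqrt (defect z.1) := by
  rw [prox, herm_lift_origin, defect_origin]; simp

/-- By transitivity and invariance `w` may be moved to the origin, where `prox` is `√(defect z)`.
The next lemmas use the same reduction. -/
lemma prox_pos (z w : Ball) : 0 < prox z w := by
  obtain ⟨g, hg⟩ := exists_smul_eq w origin
  rw [← prox_smul g, hg, prox_origin]
  exact Real.sqrt_pos.2 (defect_pos _)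

lemma prox_le_one (z w : Ball) : prox z w ≤ 1 := by
  obtain ⟨g, hg⟩ := exists_smul_eq w origin
  rw [← prox_smul g, hg, prox_origin]
  exact Real.sqrt_le_one.2 (defect_le_one _)

lemma prox_eq_one_iff {z w : Ball} : prox z w = 1 ↔ z = w := by
  obtain ⟨g, hg⟩ := exists_smul_eq w origin
  rw [← prox_smul g, hg, prox_origin, Real.sqrt_eq_one, ← smul_left_cancel_iff g (x := z), hg]
  constructor
  · intro h
    have h0 : ‖(g • z).1 0‖ ^ 2 + ‖(g • z).1 1‖ ^ 2 = 0 := by unfold defect at h; linarith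
    have h1 : ‖(g • z).1 0‖ = 0 := by
      nlinarith [sq_nonneg ‖(g • z).1 0‖, sq_nonneg ‖(g • z).1 1‖]
    have h2 : ‖(g • z).1 1‖ = 0 := by
      nlinarith [sq_nonneg ‖(g • z).1 0‖, sq_nonneg ‖(g • z).1 1‖]
    apply Subtype.ext
    ext i
    fin_cases i
    · simpa [origin] using h1
    · simpa [origin] using h2
  · intro h; rw [h, defect_origin]

/-- A zero denominator would make `prox` vanish by the convention `x / 0 = 0`, against `prox_pos`.
-/
lemma herm_ne_zero (z w : Ball) : herm (lift z.1) (lift w.1) ≠ 0 := by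
  intro h
  have := prox_pos z w
  rw [prox, h] at this
  simp at this

/-- Cauchy–Schwarz in `ℂ²`: the difference is the Euclidean inner product of `z` and `w`. -/
lemma norm_herm_sub_one_le (z w : Fin 2 → ℂ) :
    ‖1 - herm (lift z) (lift w)‖ ^ 2 ≤ (1 - defect z) * (1 - defect w) := by
  have e : 1 - herm (lift z) (lift w) = z 0 * conj (w 0) + z 1 * conj (w 1) := by
    simp [herm, lift]; ring
  have h1 : ‖1 - herm (lift z) (lift w)‖ ≤ ‖z 0‖ * ‖w 0‖ + ‖z 1‖ * ‖w 1‖ := by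
    rw [e]
    refine (norm_add_le _ _).trans ?_
    simp
  have h2 : (‖z 0‖ * ‖w 0‖ + ‖z 1‖ * ‖w 1‖) ^ 2 ≤ (1 - defect z) * (1 - defect w) := by
    unfold defect
    nlinarith [sq_nonneg (‖z 0‖ * ‖w 1‖ - ‖z 1‖ * ‖w 0‖)]
  exact (pow_le_pow_left₀ (norm_nonneg _) h1 2).trans h2

lemma norm_herm_le_two (z w : Ball) : ‖herm (lift z.1) (lift w.1)‖ ≤ 2 := by
  have h := norm_herm_sub_one_le z.1 w.1
  have h1 : ‖1 - herm (lift z.1) (lift w.1)‖ ≤ 1 := by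
    have := defect_pos z
    have := defect_pos w
    have := defect_le_one z.1
    have := defect_le_one w.1
    have : ‖1 - herm (lift z.1) (lift w.1)‖ ^ 2 ≤ 1 := by nlinarith
    nlinarith [norm_nonneg (1 - herm (lift z.1) (lift w.1))]
  calc ‖herm (lift z.1) (lift w.1)‖ = ‖1 - (1 - herm (lift z.1) (lift w.1))‖ := by ring_nf
    _ ≤ ‖(1 : ℂ)‖ + ‖1 - herm (lift z.1) (lift w.1)‖ := norm_sub_le _ _
    _ ≤ 2 := by rw [norm_one]; linarith

/-- A Harnack inequality for `prox`. -/
lemma prox_harnack (z w ζ : Ball) : prox ζ z * prox z w ≤ 2 * prox ζ w := by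
  -- With the middle point at the origin the left side is exactly the numerator of `prox ζ w`, whose
  -- denominator is at most 2.
  obtain ⟨g, hg⟩ := exists_smul_eq z origin
  rw [← prox_smul g ζ z, ← prox_smul g z w, ← prox_smul g ζ w, hg, prox_origin, prox_comm origin,
    prox_origin, prox, mul_div_assoc', le_div_iff₀ (norm_pos_iff.2 (herm_ne_zero _ _))]
  have := norm_herm_le_two (g • ζ) (g • w)
  have h : 0 ≤ √(defect (g • ζ).1) * √(defect (g • w).1) := by positivity
  nlinarith

/-- A substitute for the triangle inequality. -/
lemma prox_triangle {δ : ℝ} (hδ : δ ≤ 1) {z w ζ : Ball} (hz : 1 - δ ≤ prox ζ z ^ 2)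
    (hw : 1 - δ ≤ prox ζ w ^ 2) : (1 - δ) ≤ (1 + δ) * prox z w := by
  -- With `ζ` at the origin both points lie in the Euclidean ball of squared radius `δ`, so the form
  -- differs from 1 by at most `δ`.
  obtain ⟨g, hg⟩ := exists_smul_eq ζ origin
  rw [← prox_smul g, hg, prox_comm, prox_origin, Real.sq_sqrt (defect_pos _).le] at hz hw
  rw [← prox_smul g z w]
  generalize g • z = z' at *
  generalize g • w = w' at *
  have hδ0 : 0 ≤ δ := by have := defect_le_one z'.1; linarith
  have h := norm_herm_sub_one_le z'.1 w'.1
  have h1 : ‖1 - herm (lift z'.1) (lift w'.1)‖ ≤ δ := by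
    have : ‖1 - herm (lift z'.1) (lift w'.1)‖ ^ 2 ≤ δ ^ 2 := by
      have := defect_le_one z'.1
      have := defect_le_one w'.1
      nlinarith
    exact abs_le_of_sq_le_sq' this hδ0 |>.2
  have h2 : ‖herm (lift z'.1) (lift w'.1)‖ ≤ 1 + δ := by
    calc ‖herm (lift z'.1) (lift w'.1)‖ = ‖1 - (1 - herm (lift z'.1) (lift w'.1))‖ := by ring_nf
      _ ≤ ‖(1 : ℂ)‖ + ‖1 - herm (lift z'.1) (lift w'.1)‖ := norm_sub_le _ _
      _ ≤ 1 + δ := by rw [norm_one]; linarith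
  have h3 : 1 - δ ≤ √(defect z'.1) * √(defect w'.1) := by
    rw [← Real.sqrt_mul (defect_pos _).le]
    apply Real.le_sqrt_of_sq_le
    nlinarith [defect_pos z', defect_pos w']
  rw [prox, mul_div_assoc', le_div_iff₀ (norm_pos_iff.2 (herm_ne_zero _ _))]
  have h4 : 0 ≤ 1 - δ := by linarith
  nlinarith [mul_le_mul_of_nonneg_left h2 h4]

/-! ### The complex derivative of the action -/

/-- The derivative of the `i`-th homogeneous coordinate of `g • z`. -/
def rowForm (g : SU21) (i : Fin 3) : (Fin 2 → ℂ) →L[ℂ] ℂ :=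
  mat g i 0 • ContinuousLinearMap.proj 0 + mat g i 1 • ContinuousLinearMap.proj 1

lemma mulVec_lift_apply (g : SU21) (i : Fin 3) (z : Fin 2 → ℂ) :
    ((mat g).mulVec (lift z)) i = rowForm g i z + mat g i 2 := by
  simp [Matrix.mulVec, dotProduct, Fin.sum_univ_three, lift, rowForm]

lemma hasFDerivAt_row (g : SU21) (i : Fin 3) (z : Fin 2 → ℂ) :
    HasFDerivAt (fun z => ((mat g).mulVec (lift z)) i) (rowForm g i) z := by
  simp_rw [mulVec_lift_apply]
  exact (rowForm g i).hasFDerivAt.add_const _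

/-- The derivative of `moebius (mat g)`. -/
def moebiusDeriv (g : SU21) (z : Fin 2 → ℂ) : (Fin 2 → ℂ) →L[ℂ] (Fin 2 → ℂ) :=
  ContinuousLinearMap.pi ![
    (autFactor g z)⁻¹ • rowForm g 0
      - (((mat g).mulVec (lift z)) 0 * ((autFactor g z) ^ 2)⁻¹) • rowForm g 2,
    (autFactor g z)⁻¹ • rowForm g 1
      - (((mat g).mulVec (lift z)) 1 * ((autFactor g z) ^ 2)⁻¹) • rowForm g 2]

lemma hasFDerivAt_moebius (g : SU21) {z : Fin 2 → ℂ} (hz : z ∈ Ball) :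
    HasFDerivAt (moebius (mat g)) (moebiusDeriv g z) z := by
  have hd : ((mat g).mulVec (lift z)) 2 ≠ 0 := denom_ne_zero g hz
  have key : ∀ i, HasFDerivAt
      (fun z => ((mat g).mulVec (lift z)) i / ((mat g).mulVec (lift z)) 2)
      ((autFactor g z)⁻¹ • rowForm g i
        - (((mat g).mulVec (lift z)) i * ((autFactor g z) ^ 2)⁻¹) • rowForm g 2) z := by
    intro i
    have h := (hasFDerivAt_row g i z).mul
      ((hasDerivAt_inv hd).comp_hasFDerivAt z (hasFDerivAt_row g 2 z))
    refine HasFDerivAt.congr_fderiv (f := fun z => _) (h.congr_of_eventuallyEq ?_) ?_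
    · filter_upwards with w
      simp [div_eq_mul_inv]
    · ext v
      simp [autFactor]
      ring
  rw [hasFDerivAt_pi']
  intro i
  fin_cases i
  · exact key 0
  · exact key 1

lemma det_mat (g : SU21) : (mat g).det = 1 := (g : Matrix.SpecialLinearGroup (Fin 3) ℂ).2

/-- A projective map has Jacobian `det g / D ^ 3` in the affine chart, with `D` the automorphy
factor, and `det g = 1`. The cube is why sections of `Λ^{⊗ k}` have weight `3 * k`. -/
lemma det_moebiusDeriv (g : SU21) {z : Fin 2 → ℂ} (hz : z ∈ Ball) :
    LinearMap.det (moebiusDeriv g z : (Fin 2 → ℂ) →ₗ[ℂ] (Fin 2 → ℂ)) = (autFactor g z ^ 3)⁻¹ := by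
  have hd : autFactor g z ≠ 0 := denom_ne_zero g hz
  have h := det_mat g
  rw [Matrix.det_fin_three] at h
  rw [← LinearMap.det_toMatrix', Matrix.det_fin_two]
  have e : autFactor g z = mat g 2 0 * z 0 + mat g 2 1 * z 1 + mat g 2 2 := by
    rw [autFactor, mulVec_lift_apply]; simp [rowForm]
  simp [LinearMap.toMatrix'_apply, moebiusDeriv, rowForm, mulVec_lift_apply]
  generalize autFactor g z = D at *
  field_simp
  have e2 : mat g 2 2 = D - (mat g 2 0 * z 0 + mat g 2 1 * z 1) := by rw [e]; ring
  rw [e2] at h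
  linear_combination D * h

lemma moebius_det_fderiv (g : SU21) {z : Fin 2 → ℂ} (hz : z ∈ Ball) :
    LinearMap.det (fderiv ℂ (moebius (mat g)) z : (Fin 2 → ℂ) →ₗ[ℂ] (Fin 2 → ℂ))
      = (autFactor g z ^ 3)⁻¹ := by
  rw [(hasFDerivAt_moebius g hz).fderiv, det_moebiusDeriv g hz]

/-! ### The fibres of the powers of the canonical bundle -/

/-- The standard generator `dz₁ ∧ dz₂` of the fibre of the canonical bundle. -/
def stdForm : CanFiber := (Pi.basisFun ℂ (Fin 2)).det

lemma eq_frameEval_smul (η : CanFiber) : η = frameEval η • stdForm := by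
  have h := AlternatingMap.eq_smul_basis_det (Pi.basisFun ℂ (Fin 2)) η
  have e : (⇑(Pi.basisFun ℂ (Fin 2)) : Fin 2 → Fin 2 → ℂ) = ![Pi.single 0 1, Pi.single 1 1] := by
    ext i j
    fin_cases i <;> simp [Pi.basisFun_apply]
  rw [e] at h
  exact h

lemma frameEval_stdForm : frameEval stdForm = 1 := by
  have e : (![Pi.single 0 1, Pi.single 1 1] : Fin 2 → Fin 2 → ℂ) = ⇑(Pi.basisFun ℂ (Fin 2)) := by
    ext i j
    fin_cases i <;> simp [Pi.basisFun_apply]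
  change stdForm ![Pi.single 0 1, Pi.single 1 1] = 1
  rw [e, stdForm, Module.Basis.det_self]

/-- Top-degree forms are multiples of the determinant form, on which pull-back acts through
`LinearMap.det L`. -/
lemma pullForm_eq (L : (Fin 2 → ℂ) →ₗ[ℂ] (Fin 2 → ℂ)) (η : CanFiber) :
    pullForm L η = LinearMap.det L • η := by
  conv_lhs => rw [eq_frameEval_smul η]
  conv_rhs => rw [eq_frameEval_smul η]
  rw [map_smul, smul_comm]
  congr 1
  refine AlternatingMap.ext fun v => ?_
  change stdForm (L ∘ v) = LinearMap.det L * stdForm v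
  rw [stdForm]
  exact (Pi.basisFun ℂ (Fin 2)).det_comp L v

lemma pullPow_tprod (k : ℕ) (L : (Fin 2 → ℂ) →ₗ[ℂ] (Fin 2 → ℂ)) (f : Fin k → CanFiber) :
    pullPow k L (PiTensorProduct.tprod ℂ f)
      = LinearMap.det L ^ k • PiTensorProduct.tprod ℂ f := by
  have e : (fun i => pullForm L (f i)) = fun i => LinearMap.det L • f i :=
    funext fun i => pullForm_eq L (f i)
  have h := (PiTensorProduct.tprod ℂ (s := fun _ : Fin k => CanFiber)).map_smul_univ
    (fun _ => LinearMap.det L) f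
  rw [Finset.prod_const, Finset.card_univ, Fintype.card_fin] at h
  rw [← h, ← e]
  exact PiTensorProduct.map_tprod _ _

lemma pullPow_eq (k : ℕ) (L : (Fin 2 → ℂ) →ₗ[ℂ] (Fin 2 → ℂ)) (η : CanPow k) :
    pullPow k L η = LinearMap.det L ^ k • η := by
  have h : pullPow k L = LinearMap.det L ^ k • LinearMap.id :=
    PiTensorProduct.ext (MultilinearMap.ext fun f => pullPow_tprod k L f)
  rw [h]
  rfl

/-- The generator `(dz₁ ∧ dz₂)^{⊗ k}`. -/
def stdPow (k : ℕ) : CanPow k := PiTensorProduct.tprod ℂ fun _ => stdForm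

lemma coeff_stdPow (k : ℕ) : coeff k (stdPow k) = 1 := by
  simp [coeff, stdPow, frameEval_stdForm]

/-- Each factor of a pure tensor is a multiple of `stdForm`, and multilinearity pulls the scalars
out. So `coeff` loses nothing, and sections can be replaced by functions on the ball. -/
lemma eq_coeff_smul (k : ℕ) (η : CanPow k) : η = coeff k η • stdPow k := by
  induction η using PiTensorProduct.induction_on with
  | smul_tprod r f =>
    rw [map_smul, smul_assoc]
    congr 1
    have : f = fun i => frameEval (f i) • stdForm := funext fun i => eq_frameEval_smul (f i)
    conv_lhs => rw [this]
    rw [MultilinearMap.map_smul_univ]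
    simp [coeff, stdPow]
  | add x y hx hy => rw [map_add, add_smul, ← hx, ← hy]

lemma coeff_injective (k : ℕ) : Function.Injective (coeff k) := fun η θ h => by
  rw [eq_coeff_smul k η, eq_coeff_smul k θ, h]

/-- The coefficient function of a section of `Λ^{⊗ k}` over the ball. -/
def coefFun (k : ℕ) (ω : Ball → CanPow k) (z : Ball) : ℂ := coeff k (ω z)

/-- Pull-back by `γ` multiplies coefficients by the `k`-th power of its Jacobian, so invariance
becomes classical automorphy of weight `3 * k`. -/
lemma mem_globalSections {Γ : Subgroup SU21} {k : ℕ} {ω : Ball → CanPow k} :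
    ω ∈ globalSections Γ k ↔ DifferentiableOn ℂ (ext0 (coefFun k ω)) Ball ∧
      ∀ γ : Γ, ∀ z : Ball, coefFun k ω (γ • z) = autFactor γ z.1 ^ (3 * k) * coefFun k ω z := by
  refine and_congr Iff.rfl (forall_congr' fun γ => forall_congr' fun z => ?_)
  rw [pullPow_eq, moebius_det_fderiv γ z.2, ← (coeff_injective k).eq_iff, map_smul, smul_eq_mul,
    inv_pow, ← pow_mul, inv_mul_eq_iff_eq_mul₀ (pow_ne_zero _ (autFactor_ne_zero γ.1 z))]
  rfl

/-! ### Continuity, measurability and invariance of the hyperbolic measure -/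

lemma isOpen_Ball : IsOpen Ball := by
  have : Ball = {z : Fin 2 → ℂ | ‖z 0‖ ^ 2 + ‖z 1‖ ^ 2 < 1} := rfl
  rw [this]
  exact isOpen_lt (by fun_prop) (by fun_prop)

lemma measurableSet_Ball : MeasurableSet Ball := isOpen_Ball.measurableSet

@[fun_prop]
lemma continuous_defect : Continuous defect := by
  unfold defect; fun_prop

@[fun_prop]
lemma continuous_lift : Continuous lift := by
  unfold lift
  refine continuous_pi fun i => ?_
  fin_cases i <;> simp <;> fun_prop

lemma continuous_herm : Continuous fun p : (Fin 3 → ℂ) × (Fin 3 → ℂ) => herm p.1 p.2 := by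
  unfold herm
  fun_prop

lemma continuous_prox : Continuous fun p : Ball × Ball => prox p.1 p.2 := by
  unfold prox
  have h : Continuous fun p : Ball × Ball => herm (lift p.1.1) (lift p.2.1) :=
    continuous_herm.comp (by fun_prop : Continuous fun p : Ball × Ball => (lift p.1.1, lift p.2.1))
  refine Continuous.div (by fun_prop) h.norm fun p => norm_ne_zero_iff.2 (herm_ne_zero _ _)

lemma continuous_prox_comp {X : Type*} [TopologicalSpace X] {f g : X → Ball} (hf : Continuous f)
    (hg : Continuous g) : Continuous fun x => prox (f x) (g x) :=
  Continuous.comp (g := fun p : Ball × Ball => prox p.1 p.2) (f := fun x => (f x, g x))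
    continuous_prox (hf.prodMk hg)

instance : ContinuousConstSMul SU21 Ball where
  continuous_const_smul g := by
    rw [Topology.IsInducing.subtypeVal.continuous_iff, continuous_iff_continuousAt]
    intro z
    exact (hasFDerivAt_moebius g z.2).continuousAt.comp continuous_subtype_val.continuousAt

instance (Γ : Subgroup SU21) : ContinuousConstSMul Γ Ball where
  continuous_const_smul g := continuous_const_smul (g : SU21)

instance : MeasurableConstSMul SU21 Ball where
  measurable_const_smul g := (continuous_const_smul g).measurable

lemma hypMeasure_apply {s : Set Ball} (hs : MeasurableSet s) :
    hypMeasure s = ∫⁻ z in Subtype.val '' s, ENNReal.ofReal ((defect z ^ 3)⁻¹) := by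
  rw [hypMeasure, MeasureTheory.withDensity_apply _ hs,
    (MeasurableEmbedding.subtype_coe measurableSet_Ball).restrict_comap,
    MeasureTheory.lintegral_subtype_comap measurableSet_Ball
      (fun z => ENNReal.ofReal ((defect z ^ 3)⁻¹)),
    MeasureTheory.Measure.restrict_restrict measurableSet_Ball,
    Set.inter_eq_self_of_subset_right (Subtype.coe_image_subset _ _)]

lemma lintegral_hypMeasure (f : (Fin 2 → ℂ) → ENNReal) :
    ∫⁻ z : Ball, f z.1 ∂hypMeasure
      = ∫⁻ z in Ball, ENNReal.ofReal ((defect z ^ 3)⁻¹) * f z := by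
  rw [hypMeasure, MeasureTheory.lintegral_withDensity_eq_lintegral_mul_non_measurable]
  · exact MeasureTheory.lintegral_subtype_comap measurableSet_Ball
      (fun z => ENNReal.ofReal ((defect z ^ 3)⁻¹) * f z)
  · fun_prop
  · filter_upwards with z using ENNReal.ofReal_lt_top

lemma abs_det_restrictScalars (L : (Fin 2 → ℂ) →L[ℂ] (Fin 2 → ℂ)) :
    |(L.restrictScalars ℝ).det| = ‖LinearMap.det (L : (Fin 2 → ℂ) →ₗ[ℂ] (Fin 2 → ℂ))‖ ^ 2 := by
  rw [ContinuousLinearMap.det]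
  have : (((L.restrictScalars ℝ) : (Fin 2 → ℂ) →L[ℝ] (Fin 2 → ℂ)) : (Fin 2 → ℂ) →ₗ[ℝ] (Fin 2 → ℂ))
    = (L : (Fin 2 → ℂ) →ₗ[ℂ] (Fin 2 → ℂ)).restrictScalars ℝ := rfl
  rw [this, LinearMap.det_restrictScalars, Algebra.norm_complex_apply, Complex.normSq_eq_norm_sq,
    abs_of_nonneg (by positivity)]

/-- The real Jacobian is `‖autFactor‖⁻⁶`, which is exactly what the density `defect⁻³` compensates.
-/
lemma hypMeasure_smul (g : SU21) {s : Set Ball} (hs : MeasurableSet s) :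
    hypMeasure ((fun z => g • z) '' s) = hypMeasure s := by
  have hs' : MeasurableSet ((fun z => g • z) '' s) :=
    (Homeomorph.smul g : Ball ≃ₜ Ball).measurableEmbedding.measurableSet_image.2 hs
  rw [hypMeasure_apply hs, hypMeasure_apply hs']
  have e : Subtype.val '' ((fun z : Ball => g • z) '' s)
      = moebius (mat g) '' (Subtype.val '' s) := by
    simp_rw [Set.image_image, coe_smul]
  have hm : MeasurableSet (Subtype.val '' s) :=
    (MeasurableEmbedding.subtype_coe measurableSet_Ball).measurableSet_image.2 hs
  rw [e, MeasureTheory.lintegral_image_eq_lintegral_abs_det_fderiv_mul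
    (f' := fun z => (moebiusDeriv g z).restrictScalars ℝ) _ hm]
  · refine MeasureTheory.setLIntegral_congr_fun hm ?_
    rintro _ ⟨z, -, rfl⟩
    simp only
    rw [abs_det_restrictScalars, det_moebiusDeriv g z.2, ← ENNReal.ofReal_mul (by positivity)]
    congr 1
    rw [← coe_smul, ← defect_smul g z]
    have := norm_pos_iff.2 (autFactor_ne_zero g z)
    have := defect_pos (g • z)
    rw [norm_inv, norm_pow]
    field_simp
  · rintro _ ⟨z, -, rfl⟩
    exact ((hasFDerivAt_moebius g z.2).restrictScalars ℝ).hasFDerivWithinAt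
  · rintro _ ⟨z, -, rfl⟩ _ ⟨w, -, rfl⟩ h
    rw [← coe_smul, ← coe_smul] at h
    exact congrArg Subtype.val (smul_left_cancel g (Subtype.ext h))

instance : MeasureTheory.SMulInvariantMeasure SU21 Ball hypMeasure where
  measure_preimage_smul g s hs := by
    have : (fun z : Ball => g • z) ⁻¹' s = (fun z => g⁻¹ • z) '' s := by
      rw [← Set.image_eq_preimage_of_inverse (f := fun z : Ball => g⁻¹ • z)]
      · intro z; simp
      · intro z; simp
    rw [this, hypMeasure_smul _ hs]

lemma lintegral_smul (g : SU21) (f : Ball → ENNReal) :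
    ∫⁻ z, f (g • z) ∂hypMeasure = ∫⁻ z, f z ∂hypMeasure :=
  (MeasureTheory.measurePreserving_smul g hypMeasure).lintegral_comp_emb
    (Homeomorph.smul g : Ball ≃ₜ Ball).measurableEmbedding f

/-! ### Discreteness, cells and fundamental domains -/

/-- `mat_mem` provides a left inverse, which for square matrices is a right inverse; this yields the
row relation used in `norm_entry_le`. -/
lemma mat_mul_adjoint (g : SU21) : mat g * (hermH * (mat g).conjTranspose * hermH) = 1 := by
  have hH : hermH * hermH = 1 := by
    ext i j
    fin_cases i <;> fin_cases j <;> simp [hermH]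
  rw [mul_eq_one_comm, Matrix.mul_assoc, Matrix.mul_assoc, ← Matrix.mul_assoc _ hermH,
    mat_mem, hH]

/-- The last row and column have fixed form-value, and every other column is controlled by its last
entry. Hence the corner entry, `cosh` of the displacement of the origin, bounds the whole matrix. -/
lemma norm_entry_le (g : SU21) (i j : Fin 3) : ‖mat g i j‖ ≤ ‖mat g 2 2‖ := by
  have hrow : ‖mat g 2 0‖ ^ 2 + ‖mat g 2 1‖ ^ 2 + 1 = ‖mat g 2 2‖ ^ 2 := by
    have h := congrFun (congrFun (mat_mul_adjoint g) 2) 2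
    simp [Matrix.mul_apply, Fin.sum_univ_three, hermH, Complex.mul_conj'] at h
    have h' : -‖mat g 2 0‖ ^ 2 + -‖mat g 2 1‖ ^ 2 + ‖mat g 2 2‖ ^ 2 = 1 := by exact_mod_cast h
    linarith
  have hcol : ∀ j : Fin 3, ‖mat g 0 j‖ ^ 2 + ‖mat g 1 j‖ ^ 2 ≤ ‖mat g 2 j‖ ^ 2 + 1 := by
    intro j
    have h := form_preserved g (Pi.single j 1)
    have : ‖(Pi.single j 1 : Fin 3 → ℂ) 0‖ ^ 2 + ‖(Pi.single j 1 : Fin 3 → ℂ) 1‖ ^ 2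
        - ‖(Pi.single j 1 : Fin 3 → ℂ) 2‖ ^ 2 ≤ 1 := by
      fin_cases j <;> simp
    simp only [Matrix.mulVec_single_one, Matrix.col_apply] at h
    linarith
  have hcol2 : ‖mat g 0 2‖ ^ 2 + ‖mat g 1 2‖ ^ 2 + 1 = ‖mat g 2 2‖ ^ 2 := by
    have h := form_preserved g (Pi.single 2 1)
    simp only [Matrix.mulVec_single_one, Matrix.col_apply] at h
    simp at h
    linarith
  have h0 := hcol 0
  have h1 := hcol 1
  rw [← pow_le_pow_iff_left₀ (norm_nonneg _) (norm_nonneg _) two_ne_zero]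
  have := sq_nonneg ‖mat g 0 0‖
  have := sq_nonneg ‖mat g 0 1‖
  have := sq_nonneg ‖mat g 0 2‖
  have := sq_nonneg ‖mat g 1 0‖
  have := sq_nonneg ‖mat g 1 1‖
  have := sq_nonneg ‖mat g 1 2‖
  have := sq_nonneg ‖mat g 2 0‖
  have := sq_nonneg ‖mat g 2 1‖
  fin_cases i <;> fin_cases j <;> simp only [Fin.mk_zero, Fin.mk_one, Fin.reduceFinMk, Fin.isValue] <;> linarith

/-- Entrywise bounded elements of a discrete subgroup form a finite set. -/
lemma finite_entries_le {Γ : Subgroup SU21} (h : DiscreteTopology Γ) (M : ℝ) :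
    {γ : Γ | ∀ i j, ‖mat γ i j‖ ≤ M}.Finite := by
  have hemb : Topology.IsClosedEmbedding mat := by
    have h1 : Topology.IsEmbedding mat :=
      Topology.IsEmbedding.subtypeVal.comp Topology.IsEmbedding.subtypeVal
    refine ⟨h1, ?_⟩
    have : Set.range mat = {A : Matrix (Fin 3) (Fin 3) ℂ | A.det = 1} ∩
        {A | A.conjTranspose * hermH * A = hermH} := by
      ext A
      constructor
      · rintro ⟨g, rfl⟩
        exact ⟨det_mat g, mat_mem g⟩
      · rintro ⟨h1, h2⟩
        exact ⟨⟨⟨A, h1⟩, h2⟩, rfl⟩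
    rw [this]
    refine (isClosed_eq ?_ continuous_const).inter (isClosed_eq ?_ continuous_const)
    · exact continuous_id.matrix_det
    · exact ((continuous_id.matrix_conjTranspose).mul continuous_const).mul continuous_id
  have hK : IsCompact {A : Matrix (Fin 3) (Fin 3) ℂ | ∀ i j, ‖A i j‖ ≤ M} := by
    have : {A : Matrix (Fin 3) (Fin 3) ℂ | ∀ i j, ‖A i j‖ ≤ M}
        = Set.univ.pi fun _ => Set.univ.pi fun _ => Metric.closedBall (0 : ℂ) M := by
      ext A
      change (∀ i j, ‖A i j‖ ≤ M) ↔ ∀ i, i ∈ Set.univ → ∀ j, j ∈ Set.univ →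
        A i j ∈ Metric.closedBall (0 : ℂ) M
      simp only [Set.mem_univ, true_imp_iff, mem_closedBall_zero_iff]
    rw [this]
    exact isCompact_univ_pi fun _ => isCompact_univ_pi fun _ => isCompact_closedBall _ _
  -- A discrete subgroup is closed, so its intersection with a compact set is compact and discrete,
  -- hence finite.
  have h2 := (hemb.isCompact_preimage hK).inter_right (Subgroup.isClosed_of_discrete (H := Γ))
  have h3 : (mat ⁻¹' {A | ∀ i j, ‖A i j‖ ≤ M} ∩ (Γ : Set SU21)).Finite := by
    refine h2.finite ?_
    have : IsDiscrete (Γ : Set SU21) := ⟨h⟩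
    exact this.mono Set.inter_subset_right
  refine Set.Finite.of_finite_image (f := Subtype.val) (h3.subset ?_) Subtype.val_injective.injOn
  rintro _ ⟨γ, hγ, rfl⟩
  exact ⟨hγ, γ.2⟩

lemma prox_smul_origin (g : SU21) : prox (g • origin) origin = ‖mat g 2 2‖⁻¹ := by
  have h := sqrt_defect_smul g origin
  have e : autFactor g origin.1 = mat g 2 2 := by
    rw [autFactor, mulVec_lift_apply]; simp [rowForm, origin]
  have h0 := norm_pos_iff.2 (autFactor_ne_zero g origin)
  rw [defect_origin, Real.sqrt_one, e] at h
  rw [e] at h0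
  rw [prox_origin]
  field_simp
  linarith

/-! ### Proper discontinuity and freeness of the action -/

section Separation

variable {Γ : Subgroup SU21}

lemma finite_prox_origin (h : DiscreteTopology Γ) {c : ℝ} (hc : 0 < c) :
    {γ : Γ | c ≤ prox (γ • origin) origin}.Finite := by
  refine (finite_entries_le h c⁻¹).subset fun γ hγ i j => ?_
  refine (norm_entry_le γ.1 i j).trans ?_
  have h1 : c ≤ ‖mat γ.1 2 2‖⁻¹ := by rw [← prox_smul_origin]; exact hγ
  have := inv_anti₀ hc h1
  rwa [inv_inv] at this

/-- Two uses of `prox_harnack` replace `z` and `w` by the origin at the cost of a constant: proper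
discontinuity on compact sets. -/
lemma finite_prox (h : DiscreteTopology Γ) {c r : ℝ} (hc : 0 < c) (hr : 0 < r) :
    {γ : Γ | ∃ z w, r ≤ prox z origin ∧ r ≤ prox w origin ∧ c ≤ prox (γ • z) w}.Finite := by
  refine (finite_prox_origin h (c := c * r * r / 4) (by positivity)).subset ?_
  rintro γ ⟨z, w, hz, hw, hγ⟩
  have h1 := prox_harnack w origin (γ • z)
  have h2 := prox_harnack (γ • z) origin (γ • origin)
  have h3 : prox (γ • origin) (γ • z) = prox z origin := by
    rw [prox_comm]; exact prox_smul γ.1 z origin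
  rw [h3] at h2
  have h4 : c * r ≤ prox (γ • z) w * prox w origin := mul_le_mul hγ hw hr.le (prox_pos _ _).le
  have h5 : r * (c * r / 2) ≤ prox z origin * prox (γ • z) origin :=
    mul_le_mul hz (by linarith) (by positivity) (prox_pos _ _).le
  change c * r * r / 4 ≤ prox (γ • origin) origin
  nlinarith

lemma countable_of_discrete (h : DiscreteTopology Γ) : Countable Γ := by
  have : (Set.univ : Set Γ) = ⋃ n : ℕ, {γ : Γ | 1 / ((n : ℝ) + 1) ≤ prox (γ • origin) origin} := by
    refine (Set.eq_univ_of_forall fun γ => ?_).symm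
    obtain ⟨n, hn⟩ := exists_nat_one_div_lt (prox_pos (γ • origin) origin)
    exact Set.mem_iUnion.2 ⟨n, hn.le⟩
  rw [← Set.countable_univ_iff, this]
  exact Set.countable_iUnion fun n => (finite_prox_origin h (by positivity)).countable

/-- All powers of `γ` fix `z`, so by proper discontinuity they form a finite set and `γ` has finite
order. -/
lemma IsPicardGroup.eq_one_of_smul_eq (hΓ : IsPicardGroup Γ) {γ : Γ} {z : Ball}
    (h : γ • z = z) : γ = 1 := by
  have hfin := finite_prox hΓ.discrete zero_lt_one (prox_pos z origin)
  have hpow : ∀ n : ℕ, γ ^ n • z = z := by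
    intro n
    induction n with
    | zero => simp
    | succ n ih => rw [pow_succ, mul_smul, h, ih]
  have hf : IsOfFinOrder γ := by
    rw [← finite_powers]
    refine hfin.subset ?_
    rintro _ ⟨n, rfl⟩
    refine ⟨z, z, le_rfl, le_rfl, ?_⟩
    simp only [hpow]
    exact (prox_eq_one_iff.2 rfl).ge
  have h1 : IsOfFinOrder (γ : SU21) := by
    have := Γ.subtype.isOfFinOrder hf
    exact this
  exact Subtype.ext (hΓ.torsionFree γ γ.2 h1)

lemma isCompact_prox_ge {r : ℝ} (hr : 0 < r) : IsCompact {z : Ball | r ≤ prox z origin} := by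
  rw [Topology.IsEmbedding.subtypeVal.isCompact_iff]
  have : Subtype.val '' {z : Ball | r ≤ prox z origin} = {z | r ^ 2 ≤ defect z} := by
    ext z
    constructor
    · rintro ⟨z, hz, rfl⟩
      rw [Set.mem_ofPred_eq, prox_origin] at hz
      exact (Real.le_sqrt hr.le (defect_pos z).le).1 hz |>.trans le_rfl
    · intro hz
      have hz' : 0 < defect z := lt_of_lt_of_le (by positivity) hz
      refine ⟨⟨z, mem_Ball_iff.2 hz'⟩, ?_, rfl⟩
      rw [Set.mem_ofPred_eq, prox_origin]
      exact (Real.le_sqrt hr.le hz'.le).2 hz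
  rw [this]
  refine Metric.isCompact_of_isClosed_isBounded (isClosed_le continuous_const continuous_defect) ?_
  refine (Metric.isBounded_closedBall (x := (0 : Fin 2 → ℂ)) (r := 1)).subset fun z hz => ?_
  rw [mem_closedBall_zero_iff, pi_norm_le_iff_of_nonneg zero_le_one]
  have hz : r ^ 2 ≤ 1 - (‖z 0‖ ^ 2 + ‖z 1‖ ^ 2) := hz
  intro i
  fin_cases i <;> simp <;> nlinarith [sq_nonneg ‖z 0‖, sq_nonneg ‖z 1‖, norm_nonneg (z 0), norm_nonneg (z 1), sq_nonneg r]

/-- A compact set meets every orbit. -/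
lemma IsPicardGroup.exists_compact (hΓ : IsPicardGroup Γ) :
    ∃ r : ℝ, 0 < r ∧ ∀ z : Ball, ∃ γ : Γ, r ≤ prox (γ • z) origin := by
  have := hΓ.cocompact
  -- The images of an open exhaustion of the ball form an increasing open cover of the compact
  -- quotient.
  let U : ℕ → Set (Surface Γ) := fun n =>
    (Quotient.mk _) '' {z : Ball | 1 / ((n : ℝ) + 1) < prox z origin}
  have hU : ∀ n, IsOpen (U n) := fun n =>
    isOpenMap_quotient_mk'_mul _ (isOpen_lt continuous_const
      (continuous_prox_comp continuous_id continuous_const))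
  have hmono : Monotone U := by
    intro m n hmn
    refine Set.image_mono fun z hz => ?_
    rw [Set.mem_ofPred_eq] at hz ⊢
    refine lt_of_le_of_lt ?_ hz
    exact one_div_le_one_div_of_le (by positivity) (by gcongr)
  obtain ⟨n, hn⟩ := isCompact_univ.elim_directed_cover U hU
    (fun x _ => by
      induction x using Quotient.inductionOn with
      | h z =>
        obtain ⟨n, hn⟩ := exists_nat_one_div_lt (prox_pos z origin)
        exact Set.mem_iUnion.2 ⟨n, z, hn, rfl⟩) (hmono.directed_le)
  refine ⟨1 / ((n : ℝ) + 1), by positivity, fun z => ?_⟩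
  obtain ⟨w, hw, h⟩ := hn (Set.mem_univ (Quotient.mk _ z))
  obtain ⟨γ, hγ⟩ := MulAction.orbitRel_apply.1 (Quotient.exact h)
  exact ⟨γ, by rw [show γ • z = w from hγ]; exact hw.le⟩

/-- The displacement of nontrivial elements is bounded from below. -/
lemma IsPicardGroup.exists_gap (hΓ : IsPicardGroup Γ) :
    ∃ δ : ℝ, 0 < δ ∧ δ < 1 ∧ ∀ γ : Γ, γ ≠ 1 → ∀ z : Ball, prox (γ • z) z ≤ 1 - δ := by
  obtain ⟨r, hr, hK⟩ := hΓ.exists_compact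
  -- Only finitely many elements have `prox (γ • z) z ≥ 1 / 2` somewhere on the compact set, and
  -- each attains a maximum below 1 there. For all others any `δ < 1 / 2` works.
  have hfin := finite_prox hΓ.discrete (c := 1 / 2) (by norm_num) hr
  have h1 : ∀ γ : Γ, γ ≠ 1 → ∀ᶠ δ in nhdsWithin (0 : ℝ) (Set.Ioi 0),
      ∀ z : Ball, r ≤ prox z origin → prox (γ • z) z ≤ 1 - δ := by
    intro γ hγ
    have hc : Continuous fun z : Ball => prox (γ • z) z :=
      continuous_prox_comp (continuous_const_smul γ) continuous_id
    rcases Set.eq_empty_or_nonempty {z : Ball | r ≤ prox z origin} with he | hne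
    · filter_upwards with δ z hz
      exact absurd (show z ∈ {z : Ball | r ≤ prox z origin} from hz) (by simp [he])
    · obtain ⟨z₀, -, hz₀⟩ := (isCompact_prox_ge hr).exists_isMaxOn hne hc.continuousOn
      have hlt : prox (γ • z₀) z₀ < 1 :=
        lt_of_le_of_ne (prox_le_one _ _) fun h => hγ (hΓ.eq_one_of_smul_eq (prox_eq_one_iff.1 h))
      filter_upwards [Ioo_mem_nhdsGT (sub_pos.2 hlt)] with δ hδ z hz
      have := hz₀ hz
      simp only [Set.mem_ofPred_eq] at this
      linarith [hδ.2]
  have h2 : ∀ᶠ δ in nhdsWithin (0 : ℝ) (Set.Ioi 0),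
      ∀ γ ∈ {γ : Γ | ∃ z w, r ≤ prox z origin ∧ r ≤ prox w origin ∧ 1 / 2 ≤ prox (γ • z) w},
        γ ≠ 1 → ∀ z : Ball, r ≤ prox z origin → prox (γ • z) z ≤ 1 - δ := by
    rw [Filter.eventually_all_finite hfin]
    intro γ _
    by_cases hγ : γ = 1
    · simp [hγ]
    · filter_upwards [h1 γ hγ] with δ hδ _ using hδ
  obtain ⟨δ, h3, h4⟩ := (h2.and (Ioo_mem_nhdsGT (show (0 : ℝ) < 1 / 2 by norm_num))).exists
  refine ⟨δ, h4.1, h4.2.trans (by norm_num), fun γ hγ z => ?_⟩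
  obtain ⟨β, hβ⟩ := hK z
  -- Conjugation by `β` moves the point into the compact set without changing the displacement.
  have e : prox (γ • z) z = prox ((β * γ * β⁻¹) • (β • z)) (β • z) := by
    rw [smul_smul, inv_mul_cancel_right, mul_smul]
    exact (prox_smul β.1 _ _).symm
  rw [e]
  by_cases hn : 1 / 2 ≤ prox ((β * γ * β⁻¹) • (β • z)) (β • z)
  · refine h3 _ ⟨_, _, hβ, hβ, hn⟩ (fun h => hγ ?_) _ hβ
    rwa [mul_inv_eq_one, mul_eq_left] at h
  · linarith [h4.2]

/-! ### Injective cells, fundamental domain, unfolding and finite volume -/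

/-- The hyperbolic ball `{ζ : 1 - δ < 1 / cosh² d(ζ, z)}`. -/
def cell (δ : ℝ) (z : Ball) : Set Ball := {ζ | 1 - δ < prox ζ z ^ 2}

lemma isOpen_cell (δ : ℝ) (z : Ball) : IsOpen (cell δ z) :=
  isOpen_lt continuous_const
    ((continuous_prox_comp continuous_id continuous_const).pow 2)

lemma smul_mem_cell_smul (g : SU21) {δ : ℝ} {z ζ : Ball} :
    g • ζ ∈ cell δ (g • z) ↔ ζ ∈ cell δ z := by
  simp [cell]

/-- Translates of small cells by the group are disjoint. -/
lemma IsPicardGroup.exists_cell (hΓ : IsPicardGroup Γ) :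
    ∃ δ : ℝ, 0 < δ ∧ δ < 1 ∧ ∀ γ : Γ, ∀ z ζ : Ball, ζ ∈ cell δ z → γ • ζ ∈ cell δ z → γ = 1 := by
  obtain ⟨δ, h0, h1, h⟩ := hΓ.exists_gap
  refine ⟨δ / 2, by linarith, by linarith, fun γ z ζ h2 h3 => by_contra fun hγ => ?_⟩
  have h4 : 1 - δ / 2 < prox ζ (γ⁻¹ • z) ^ 2 := by
    have : prox ζ (γ⁻¹ • z) = prox (γ • ζ) z := by
      have := prox_smul γ.1 ζ (γ⁻¹ • z)
      rw [← this]
      congr 1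
      exact smul_inv_smul γ z
    rw [this]; exact h3
  -- Both `z` and `γ⁻¹ • z` are close to `ζ`, hence to each other. The halved `δ` contradicts the
  -- gap, since `(1 + δ / 2) * (1 - δ) < 1 - δ / 2`.
  have h5 := prox_triangle (by linarith) (le_of_lt h2) h4.le
  have h6 := h γ⁻¹ (by simpa using hγ) z
  rw [prox_comm] at h6
  nlinarith

/-- Countably many cells cover the ball; from each one keep the points whose orbit misses all
earlier cells. The first cell met by an orbit gives a representative, and disjointness of translates
makes it unique. Without this existence `fundDomain` would be the default value `∅`. -/
lemma IsPicardGroup.exists_isFundamentalDomain (hΓ : IsPicardGroup Γ) :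
    ∃ F : Set Ball, MeasureTheory.IsFundamentalDomain Γ F hypMeasure := by
  have := countable_of_discrete hΓ.discrete
  obtain ⟨δ, h0, h1, h⟩ := hΓ.exists_cell
  have : Nonempty Ball := ⟨origin⟩
  let p := TopologicalSpace.denseSeq Ball
  have hcov : ∀ z : Ball, ∃ n, z ∈ cell δ (p n) := by
    intro z
    have ho : IsOpen {w : Ball | z ∈ cell δ w} :=
      isOpen_lt continuous_const
        ((continuous_prox_comp continuous_const continuous_id).pow 2)
    obtain ⟨_, hw, n, rfl⟩ := (TopologicalSpace.denseRange_denseSeq Ball).inter_open_nonempty _ ho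
      ⟨z, by simp [cell, prox_eq_one_iff.2 rfl, h0]⟩
    exact ⟨n, hw⟩
  let F : Set Ball := ⋃ n, (cell δ (p n) ∩ ⋂ m ∈ Set.Iio n, ⋂ γ : Γ, {z | γ • z ∉ cell δ (p m)})
  have hF : ∀ z, z ∈ F ↔ ∃ n, z ∈ cell δ (p n) ∧ ∀ m < n, ∀ γ : Γ, γ • z ∉ cell δ (p m) := by
    intro z; simp [F]
  refine ⟨F, MeasureTheory.IsFundamentalDomain.mk' ?_ fun z => ?_⟩
  · refine MeasurableSet.nullMeasurableSet (MeasurableSet.iUnion fun n => ?_)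
    refine (isOpen_cell _ _).measurableSet.inter ?_
    refine MeasurableSet.biInter (Set.to_countable _) fun m _ => MeasurableSet.iInter fun γ => ?_
    have hm : IsOpen ((fun z : Ball => γ • z) ⁻¹' cell δ (p m)) :=
      (isOpen_cell δ (p m)).preimage (continuous_const_smul γ)
    exact hm.measurableSet.compl
  · classical
    have hex : ∃ n, ∃ γ : Γ, γ • z ∈ cell δ (p n) := by
      obtain ⟨n, hn⟩ := hcov z
      exact ⟨n, 1, by simpa using hn⟩
    obtain ⟨γ, hγ⟩ := Nat.find_spec hex
    have hmin : ∀ m < Nat.find hex, ∀ β : Γ, β • z ∉ cell δ (p m) := fun m hm β hβ =>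
      Nat.find_min hex hm ⟨β, hβ⟩
    refine ⟨γ, (hF _).2 ⟨_, hγ, fun m hm β => ?_⟩, fun β hβ => ?_⟩
    · rw [smul_smul]; exact hmin m hm _
    · obtain ⟨n, hn, hn'⟩ := (hF _).1 hβ
      have hnf : n = Nat.find hex := by
        refine le_antisymm (not_lt.1 fun hlt => ?_) (Nat.find_min' hex ⟨β, hn⟩)
        refine hn' _ hlt (γ * β⁻¹) ?_
        rwa [smul_smul, inv_mul_cancel_right]
      rw [hnf] at hn
      have := h (β * γ⁻¹) _ _ hγ (by rwa [smul_smul, inv_mul_cancel_right])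
      rwa [mul_inv_eq_one] at this

lemma IsPicardGroup.isFundamentalDomain (hΓ : IsPicardGroup Γ) :
    MeasureTheory.IsFundamentalDomain Γ (fundDomain Γ) hypMeasure := by
  rw [fundDomain, dif_pos hΓ.exists_isFundamentalDomain]
  exact hΓ.exists_isFundamentalDomain.choose_spec

/-- The unfolding formula. -/
lemma IsPicardGroup.lintegral_unfold (hΓ : IsPicardGroup Γ) {f : Ball → ENNReal}
    (hf : Measurable f) :
    ∫⁻ z, f z ∂hypMeasure = ∫⁻ z in fundDomain Γ, ∑' γ : Γ, f (γ • z) ∂hypMeasure := by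
  have := countable_of_discrete hΓ.discrete
  rw [hΓ.isFundamentalDomain.lintegral_eq_tsum'', MeasureTheory.lintegral_tsum]
  exact fun γ => (hf.comp (continuous_const_smul γ).measurable).aemeasurable

/-- A compact set meeting every orbit has indicator with orbit sum at least 1, so unfolding bounds
the volume of the quotient by that of the compact set. -/
lemma IsPicardGroup.measure_fundDomain_lt_top (hΓ : IsPicardGroup Γ) :
    hypMeasure (fundDomain Γ) < ⊤ := by
  obtain ⟨r, hr, hK⟩ := hΓ.exists_compact
  set K := {z : Ball | r ≤ prox z origin} with hKdef
  have hKm : MeasurableSet K := (isCompact_prox_ge hr).isClosed.measurableSet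
  have h1 : hypMeasure (fundDomain Γ) ≤ hypMeasure K := by
    rw [← MeasureTheory.lintegral_indicator_one hKm,
      hΓ.lintegral_unfold (measurable_one.indicator hKm), ← MeasureTheory.setLIntegral_one]
    refine MeasureTheory.lintegral_mono fun z => ?_
    obtain ⟨γ, hγ⟩ := hK z
    refine le_trans ?_ (ENNReal.le_tsum γ)
    rw [Set.indicator_of_mem (show γ • z ∈ K from hγ)]
    exact le_rfl
  refine h1.trans_lt ?_
  rw [hypMeasure_apply hKm]
  have hc : IsCompact (Subtype.val '' K) := (isCompact_prox_ge hr).image continuous_subtype_val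
  have hb : ∀ z ∈ Subtype.val '' K, ENNReal.ofReal ((defect z ^ 3)⁻¹)
      ≤ ENNReal.ofReal (((r ^ 2) ^ 3)⁻¹) := by
    rintro _ ⟨z, hz, rfl⟩
    rw [hKdef, Set.mem_ofPred_eq, prox_origin, Real.le_sqrt hr.le (defect_pos z).le] at hz
    refine ENNReal.ofReal_le_ofReal (inv_anti₀ (by positivity) ?_)
    gcongr
  refine (MeasureTheory.setLIntegral_mono measurable_const hb).trans_lt ?_
  rw [MeasureTheory.setLIntegral_const]
  exact ENNReal.mul_lt_top ENNReal.ofReal_lt_top hc.measure_lt_top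

end Separation

/-! ### Orbit sums -/

section Cells

variable {Γ : Subgroup SU21}

/-- After moving `w` to the origin, six factors `√defect` cancel the density `defect⁻³`. This is why
6 is the exponent for the orbit sums. -/
lemma lintegral_prox_pow (p : ℕ) (w : Ball) :
    ∫⁻ ζ, ENNReal.ofReal (prox ζ w ^ (6 + p)) ∂hypMeasure
      = ∫⁻ ζ in Ball, ENNReal.ofReal (√(defect ζ) ^ p) := by
  obtain ⟨g, hg⟩ := exists_smul_eq origin w
  rw [← lintegral_smul g, ← hg]
  simp_rw [prox_smul, prox_origin]
  rw [lintegral_hypMeasure (fun ζ => ENNReal.ofReal (√(defect ζ) ^ (6 + p)))]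
  refine MeasureTheory.setLIntegral_congr_fun measurableSet_Ball fun ζ hζ => ?_
  have h := mem_Ball_iff.1 hζ
  rw [← ENNReal.ofReal_mul (by positivity), pow_add,
    show √(defect ζ) ^ 6 = defect ζ ^ 3 by
      rw [show 6 = 2 * 3 from rfl, pow_mul, Real.sq_sqrt h.le]]
  congr 1
  field_simp

lemma volume_Ball_lt_top : MeasureTheory.volume Ball < ⊤ := by
  refine lt_of_le_of_lt (MeasureTheory.measure_mono ?_)
    (isCompact_closedBall (0 : Fin 2 → ℂ) 1).measure_lt_top
  intro z hz
  rw [mem_closedBall_zero_iff, pi_norm_le_iff_of_nonneg zero_le_one]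
  have hz : ‖z 0‖ ^ 2 + ‖z 1‖ ^ 2 < 1 := hz
  intro i
  fin_cases i <;> simp <;>
    nlinarith [sq_nonneg ‖z 0‖, sq_nonneg ‖z 1‖, norm_nonneg (z 0), norm_nonneg (z 1)]

lemma zero_mem_Ball : (0 : Fin 2 → ℂ) ∈ Ball := origin.2

lemma volume_Ball_pos : 0 < MeasureTheory.volume Ball :=
  isOpen_Ball.measure_pos _ ⟨0, zero_mem_Ball⟩

lemma cell_mono {δ ε : ℝ} (h : δ ≤ ε) (z : Ball) : cell δ z ⊆ cell ε z := by
  intro ζ hζ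
  have hζ : 1 - δ < prox ζ z ^ 2 := hζ
  show 1 - ε < prox ζ z ^ 2
  linarith

lemma lintegral_cell_smul (g : SU21) (δ : ℝ) (z : Ball) (f : Ball → ENNReal) :
    ∫⁻ ζ in cell δ (g • z), f ζ ∂hypMeasure = ∫⁻ ζ in cell δ z, f (g • ζ) ∂hypMeasure := by
  rw [← MeasureTheory.lintegral_indicator (isOpen_cell _ _).measurableSet,
    ← MeasureTheory.lintegral_indicator (isOpen_cell _ _).measurableSet, ← lintegral_smul g]
  congr 1
  ext ζ
  by_cases h : ζ ∈ cell δ z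
  · rw [Set.indicator_of_mem h, Set.indicator_of_mem ((smul_mem_cell_smul g).2 h)]
  · rw [Set.indicator_of_notMem h, Set.indicator_of_notMem (mt (smul_mem_cell_smul g).1 h)]

/-- The integral of an invariant function over a small cell is at most its integral over a
fundamental domain. -/
lemma IsPicardGroup.lintegral_cell_le (hΓ : IsPicardGroup Γ) {δ : ℝ}
    (hδ : ∀ γ : Γ, ∀ z ζ : Ball, ζ ∈ cell δ z → γ • ζ ∈ cell δ z → γ = 1) (z : Ball)
    {h : Ball → ENNReal} (hm : Measurable h) (hinv : ∀ γ : Γ, ∀ ζ, h (γ • ζ) = h ζ) :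
    ∫⁻ ζ in cell δ z, h ζ ∂hypMeasure ≤ ∫⁻ ζ in fundDomain Γ, h ζ ∂hypMeasure := by
  have hc := (isOpen_cell δ z).measurableSet
  rw [← MeasureTheory.lintegral_indicator hc, hΓ.lintegral_unfold (hm.indicator hc)]
  refine MeasureTheory.lintegral_mono fun ζ => ?_
  by_cases hex : ∃ β : Γ, β • ζ ∈ cell δ z
  · obtain ⟨β, hβ⟩ := hex
    rw [tsum_eq_single β]
    · rw [Set.indicator_of_mem hβ, hinv]
    · intro γ hγ
      refine Set.indicator_of_notMem (fun hmem => hγ ?_) _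
      have := hδ (γ * β⁻¹) z (β • ζ) hβ (by rwa [smul_smul, inv_mul_cancel_right])
      rwa [mul_inv_eq_one] at this
  · push Not at hex
    have : ∀ γ : Γ, (cell δ z).indicator h (γ • ζ) = 0 := fun γ =>
      Set.indicator_of_notMem (hex γ) _
    simp [this]

lemma hypMeasure_cell (δ : ℝ) (z : Ball) : hypMeasure (cell δ z) = hypMeasure (cell δ origin) := by
  obtain ⟨g, hg⟩ := exists_smul_eq origin z
  have := lintegral_cell_smul g δ origin 1
  rw [hg] at this
  simpa using this

lemma hypMeasure_cell_pos {δ : ℝ} (hδ : 0 < δ) : 0 < hypMeasure (cell δ origin) := by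
  rw [hypMeasure_apply (isOpen_cell _ _).measurableSet]
  have hm : MeasurableSet (Subtype.val '' cell δ origin) :=
    (MeasurableEmbedding.subtype_coe measurableSet_Ball).measurableSet_image.2
      (isOpen_cell _ _).measurableSet
  rw [MeasureTheory.setLIntegral_pos_iff (by fun_prop)]
  have ho : IsOpen (Subtype.val '' cell δ origin) :=
    isOpen_Ball.isOpenMap_subtype_val _ (isOpen_cell _ _)
  refine lt_of_lt_of_le (ho.measure_pos _ ⟨0, origin, ?_, rfl⟩)
    (MeasureTheory.measure_mono (Set.subset_inter ?_ le_rfl))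
  · simp [cell, prox_eq_one_iff.2 rfl, hδ]
  · rintro _ ⟨ζ, -, rfl⟩
    have := defect_pos ζ
    simp only [Function.mem_support, ne_eq, ENNReal.ofReal_eq_zero, not_le]
    positivity

/-- The orbit sums `∑ (1 / cosh d(γ z, w))⁶` are uniformly bounded. -/
lemma IsPicardGroup.exists_orbit_sum_le (hΓ : IsPicardGroup Γ) :
    ∃ C : ℝ, 0 < C ∧ ∀ z w : Ball, Summable (fun γ : Γ => prox (γ • z) w ^ 6) ∧
      ∑' γ : Γ, prox (γ • z) w ^ 6 ≤ C := by
  have := countable_of_discrete hΓ.discrete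
  obtain ⟨δ, h0, h1, hδ⟩ := hΓ.exists_cell
  -- `64 = 2 ^ 6` is the Harnack constant, and `(1 - δ) ^ 3` bounds `prox ζ z ^ 6` from below on the
  -- cell.
  set c : ℝ := (1 - δ) ^ 3 / 64 with hc
  have hcpos : 0 < c := by have : 0 < 1 - δ := by linarith
                           positivity
  set m := hypMeasure (cell δ origin) with hm
  set A : ENNReal := MeasureTheory.volume Ball / (ENNReal.ofReal c * m) with hA
  have hmpos : m ≠ 0 := (hypMeasure_cell_pos h0).ne'
  have hAtop : A ≠ ⊤ := by
    refine ENNReal.div_ne_top volume_Ball_lt_top.ne ?_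
    exact mul_ne_zero (by simpa using hcpos) hmpos
  have key : ∀ z w : Ball, ∑' γ : Γ, ENNReal.ofReal (prox (γ • z) w ^ 6) ≤ A := by
    intro z w
    have hmeas : ∀ γ : Γ, Measurable fun ζ : Ball => ENNReal.ofReal (prox (γ • ζ) w ^ 6) :=
      fun γ => (ENNReal.measurable_ofReal.comp
        ((continuous_prox_comp (continuous_const_smul γ) continuous_const).pow 6).measurable)
    have hterm : ∀ γ : Γ, ENNReal.ofReal (prox (γ • z) w ^ 6) * (ENNReal.ofReal c * m)
        ≤ ∫⁻ ζ in cell δ z, ENNReal.ofReal (prox (γ • ζ) w ^ 6) ∂hypMeasure := by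
      intro γ
      rw [← mul_assoc, ← ENNReal.ofReal_mul (by have := prox_pos (γ • z) w; positivity), hm,
        ← hypMeasure_cell δ z, ← MeasureTheory.setLIntegral_const]
      refine MeasureTheory.setLIntegral_mono (hmeas γ) fun ζ hζ => ENNReal.ofReal_le_ofReal ?_
      have hζ : 1 - δ < prox ζ z ^ 2 := hζ
      have h2 := prox_harnack (γ • z) w (γ • ζ)
      rw [show prox (γ • ζ) (γ • z) = prox ζ z from prox_smul γ.1 ζ z] at h2
      have h3 : (prox ζ z * prox (γ • z) w) ^ 6 ≤ (2 * prox (γ • ζ) w) ^ 6 :=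
        pow_le_pow_left₀ (mul_pos (prox_pos _ _) (prox_pos _ _)).le h2 6
      have h4 : (1 - δ) ^ 3 ≤ (prox ζ z ^ 2) ^ 3 := pow_le_pow_left₀ (by linarith) hζ.le 3
      have h5 : 0 < prox (γ • z) w ^ 6 := pow_pos (prox_pos _ _) 6
      rw [mul_pow, mul_pow] at h3
      rw [hc]
      nlinarith [mul_le_mul_of_nonneg_right h4 h5.le]
    -- Each term is bounded by its integral over the cell of `z`. The cell injects into the
    -- quotient, so the sum of these integrals is at most an integral over a fundamental domain,
    -- which unfolds to the Euclidean volume of the ball.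
    have hsum : (∑' γ : Γ, ENNReal.ofReal (prox (γ • z) w ^ 6)) * (ENNReal.ofReal c * m)
        ≤ MeasureTheory.volume Ball := by
      rw [← ENNReal.tsum_mul_right]
      refine (ENNReal.tsum_le_tsum hterm).trans ?_
      rw [← MeasureTheory.lintegral_tsum fun γ => (hmeas γ).aemeasurable]
      refine (hΓ.lintegral_cell_le hδ z (Measurable.tsum hmeas) ?_).trans ?_
      · intro γ ζ
        rw [← (Equiv.mulRight γ).tsum_eq fun β : Γ => ENNReal.ofReal (prox (β • ζ) w ^ 6)]
        simp [mul_smul]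
      · have hm1 : Measurable fun ζ : Ball => ENNReal.ofReal (prox ζ w ^ 6) := by
          simpa using hmeas 1
        have := hΓ.lintegral_unfold hm1
        rw [← this]
        have h6 := lintegral_prox_pow 0 w
        simp only [add_zero, pow_zero, ENNReal.ofReal_one, MeasureTheory.setLIntegral_one] at h6
        rw [h6]
    rw [hA, ENNReal.le_div_iff_mul_le]
    · exact hsum
    · left; exact mul_ne_zero (by simpa using hcpos) hmpos
    · right; exact volume_Ball_lt_top.ne
  have hnn : ∀ z w : Ball, ∀ γ : Γ, 0 ≤ prox (γ • z) w ^ 6 := fun z w γ =>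
    (pow_pos (prox_pos _ _) 6).le
  have hs : ∀ z w : Ball, Summable (fun γ : Γ => prox (γ • z) w ^ 6) := by
    intro z w
    have hfin : ∑' γ : Γ, ENNReal.ofReal (prox (γ • z) w ^ 6) ≠ ⊤ :=
      ((key z w).trans_lt hAtop.lt_top).ne
    refine (ENNReal.summable_toReal hfin).congr fun γ => ?_
    rw [ENNReal.toReal_ofReal (hnn z w γ)]
  refine ⟨A.toReal + 1, by positivity, fun z w => ⟨hs z w, ?_⟩⟩
  have h7 : ENNReal.ofReal (∑' γ : Γ, prox (γ • z) w ^ 6) ≤ A := by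
    rw [ENNReal.ofReal_tsum_of_nonneg (hnn z w) (hs z w)]
    exact key z w
  have := (ENNReal.ofReal_le_iff_le_toReal hAtop).1 h7
  linarith

/-! ### The mean value inequality -/

/-- The Euclidean ball `{z : |z|² < s}`. -/
def eball (s : ℝ) : Set (Fin 2 → ℂ) := {z | 1 - s < defect z}

lemma isOpen_eball (s : ℝ) : IsOpen (eball s) := isOpen_lt continuous_const continuous_defect

lemma defect_smul_complex (c : ℂ) (z : Fin 2 → ℂ) :
    1 - defect (c • z) = ‖c‖ ^ 2 * (1 - defect z) := by
  simp [defect]; ring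

lemma eball_subset_Ball {s : ℝ} (hs : s ≤ 1) : eball s ⊆ Ball := by
  intro z hz
  have hz : 1 - s < defect z := hz
  rw [mem_Ball_iff]; linarith

open scoped Pointwise in
lemma volume_eball {s : ℝ} (hs : 0 < s) :
    MeasureTheory.volume (eball s) = ENNReal.ofReal (s ^ 2) * MeasureTheory.volume Ball := by
  have h : eball s = (√s • Ball : Set (Fin 2 → ℂ)) := by
    ext z
    have hs' : √s ≠ 0 := (Real.sqrt_pos.2 hs).ne'
    rw [Set.mem_smul_set_iff_inv_smul_mem₀ hs', mem_Ball_iff]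
    have e : (√s)⁻¹ • z = (((√s)⁻¹ : ℝ) : ℂ) • z := by
      ext i; simp
    have := defect_smul_complex (((√s)⁻¹ : ℝ) : ℂ) z
    rw [← e, Complex.norm_real, Real.norm_eq_abs, sq_abs, inv_pow, Real.sq_sqrt hs.le] at this
    change 1 - s < defect z ↔ _
    have h2 : s * (1 - defect ((√s)⁻¹ • z)) = 1 - defect z := by rw [this]; field_simp
    constructor
    · intro h; nlinarith
    · intro h; nlinarith
  rw [h, MeasureTheory.Measure.addHaar_smul]
  congr 2
  have : Module.finrank ℝ (Fin 2 → ℂ) = 4 := by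
    rw [Module.finrank_pi_fintype]; simp [Complex.finrank_real_complex]
  rw [this, abs_of_nonneg (by positivity), show 4 = 2 * 2 from rfl, pow_mul, Real.sq_sqrt hs.le]

lemma measurePreserving_rotate (a : Circle) :
    MeasureTheory.MeasurePreserving (fun z : Fin 2 → ℂ => (a : ℂ) • z) := by
  have h : MeasureTheory.MeasurePreserving (fun z : ℂ => (a : ℂ) * z) := by
    have := (rotation a).measurePreserving
    exact this
  exact MeasureTheory.volume_preserving_pi fun _ : Fin 2 => h

/-- The mean value property of `c ↦ f (c • z) ^ 2` on the unit disc of the complex line through `z`.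
-/
lemma enorm_sq_le_circle {f : (Fin 2 → ℂ) → ℂ} (hf : DifferentiableOn ℂ f Ball) {z : Fin 2 → ℂ}
    (hz : z ∈ Ball) :
    ENNReal.ofReal (2 * Real.pi) * ‖f 0‖ₑ ^ 2
      ≤ ∫⁻ θ in Set.Ioc 0 (2 * Real.pi), ‖f (Circle.exp θ • z)‖ₑ ^ 2 := by
  have hmem : ∀ c ∈ Metric.closedBall (0 : ℂ) 1, c • z ∈ Ball := by
    intro c hc
    rw [mem_closedBall_zero_iff] at hc
    have h1 := defect_smul_complex c z
    have h2 := mem_Ball_iff.1 hz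
    have h3 := defect_le_one z
    rw [mem_Ball_iff]
    have : ‖c‖ ^ 2 ≤ 1 := pow_le_one₀ (norm_nonneg _) hc
    nlinarith
  have hd : DifferentiableOn ℂ (fun c : ℂ => f (c • z) ^ 2) (Metric.closedBall 0 1) :=
    (hf.comp (f := fun c : ℂ => c • z) (by fun_prop) hmem).pow 2
  have hd' : DiffContOnCl ℂ (fun c : ℂ => f (c • z) ^ 2) (Metric.ball 0 |1|) := by
    rw [abs_one]
    refine DifferentiableOn.diffContOnCl ?_
    rwa [closure_ball _ one_ne_zero]
  have h := hd'.circleAverage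
  rw [Real.circleAverage_def, zero_smul, intervalIntegral.integral_of_le (by positivity)] at h
  have h2 : (2 * Real.pi) * ‖f 0 ^ 2‖
      = ‖∫ θ in Set.Ioc 0 (2 * Real.pi), f (circleMap 0 1 θ • z) ^ 2‖ := by
    rw [← h, norm_smul, Real.norm_eq_abs, abs_of_pos (by positivity)]
    field_simp
  have h3 : ENNReal.ofReal (2 * Real.pi) * ‖f 0‖ₑ ^ 2
      = ‖∫ θ in Set.Ioc 0 (2 * Real.pi), f (circleMap 0 1 θ • z) ^ 2‖ₑ := by
    rw [← ofReal_norm (∫ θ in Set.Ioc 0 (2 * Real.pi), f (circleMap 0 1 θ • z) ^ 2), ← h2,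
      ENNReal.ofReal_mul (p := 2 * Real.pi) (by positivity), ofReal_norm, enorm_pow]
  rw [h3]
  refine (MeasureTheory.enorm_integral_le_lintegral_enorm _).trans_eq ?_
  congr 1
  ext θ
  rw [enorm_pow]
  simp [circleMap, Circle.smul_def]

/-- The mean value inequality for holomorphic functions of two variables. -/
lemma mean_value_le {f : (Fin 2 → ℂ) → ℂ} (hf : DifferentiableOn ℂ f Ball) {s : ℝ} (hs : s ≤ 1) :
    ‖f 0‖ₑ ^ 2 * MeasureTheory.volume (eball s) ≤ ∫⁻ z in eball s, ‖f z‖ₑ ^ 2 := by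
  have hmeas := (isOpen_eball s).measurableSet
  have hrot : ∀ (a : Circle) (z : Fin 2 → ℂ), a • z ∈ eball s ↔ z ∈ eball s := by
    intro a z
    have := defect_smul_complex a z
    rw [Circle.norm_coe] at this
    change 1 - s < defect ((a : ℂ) • z) ↔ 1 - s < defect z
    constructor <;> intro h <;> linarith
  set F : (Fin 2 → ℂ) → ENNReal := (eball s).indicator fun z => ‖f z‖ₑ ^ 2 with hF
  have hFm : Measurable F := by
    have hc : ContinuousOn (fun z => ‖f z‖ₑ ^ 2) (eball s) :=
      (ENNReal.continuous_pow 2).comp_continuousOn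
        (continuous_enorm.comp_continuousOn (hf.continuousOn.mono (eball_subset_Ball hs)))
    classical
    rw [hF, ← Set.piecewise_eq_indicator]
    exact hc.measurable_piecewise continuous_zero.continuousOn hmeas
  have hinv : ∀ θ : ℝ, ∫⁻ z, F (Circle.exp θ • z) = ∫⁻ z, F z := fun θ =>
    (measurePreserving_rotate (Circle.exp θ)).lintegral_comp hFm
  -- Rotations preserve both volume and `eball s`, so integrating the circle inequality over `z` and
  -- exchanging the integrals gives the claim.
  have h1 : ∫⁻ z in eball s, ENNReal.ofReal (2 * Real.pi) * ‖f 0‖ₑ ^ 2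
      ≤ ∫⁻ z, ∫⁻ θ in Set.Ioc 0 (2 * Real.pi), F (Circle.exp θ • z) := by
    rw [← MeasureTheory.lintegral_indicator hmeas]
    refine MeasureTheory.lintegral_mono fun z => ?_
    by_cases hz : z ∈ eball s
    · rw [Set.indicator_of_mem hz]
      refine (enorm_sq_le_circle hf (eball_subset_Ball hs hz)).trans_eq ?_
      congr 1
      ext θ
      rw [hF, Set.indicator_of_mem ((hrot _ _).2 hz)]
    · rw [Set.indicator_of_notMem hz]; exact zero_le
  rw [MeasureTheory.lintegral_lintegral_swap] at h1
  · simp_rw [hinv] at h1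
    rw [MeasureTheory.setLIntegral_const, MeasureTheory.setLIntegral_const, Real.volume_Ioc, sub_zero,
      hF, MeasureTheory.lintegral_indicator hmeas, mul_assoc, mul_comm (∫⁻ z in eball s, _)] at h1
    exact (ENNReal.mul_le_mul_iff_right (by simp [Real.pi_pos]) ENNReal.ofReal_ne_top).1 h1
  · refine (hFm.comp ?_).aemeasurable
    refine Continuous.measurable ?_
    simp only [Circle.smul_def, Circle.coe_exp]
    fun_prop

end Cells

/-! ### Norms of sections -/

section Sections

variable {Γ : Subgroup SU21} {k : ℕ} {ω : Ball → CanPow k}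

/-- The pointwise squared norm `|ω(z)|²_hyp`. -/
def secNorm (k : ℕ) (ω : Ball → CanPow k) (z : Ball) : ℝ :=
  defect z.1 ^ (3 * k) * ‖coefFun k ω z‖ ^ 2

lemma secNorm_nonneg (k : ℕ) (ω : Ball → CanPow k) (z : Ball) : 0 ≤ secNorm k ω z := by
  have := defect_pos z
  unfold secNorm; positivity

lemma continuous_coefFun (hω : ω ∈ globalSections Γ k) : Continuous (coefFun k ω) := by
  have h := (mem_globalSections.1 hω).1.continuousOn
  rw [continuousOn_iff_continuous_domRestrict] at h
  refine h.congr fun z => ?_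
  rw [Set.domRestrict_apply, ext0_apply _ z.2]

lemma continuous_secNorm (hω : ω ∈ globalSections Γ k) : Continuous (secNorm k ω) := by
  unfold secNorm
  have := continuous_coefFun hω
  fun_prop

lemma secNorm_smul (hω : ω ∈ globalSections Γ k) (γ : Γ) (z : Ball) :
    secNorm k ω (γ • z) = secNorm k ω z := by
  have h : ‖autFactor γ z.1‖ ^ 2 * defect (γ • z).1 = defect z.1 := defect_smul γ.1 z
  rw [secNorm, secNorm, (mem_globalSections.1 hω).2, norm_mul, norm_pow, ← h, mul_pow, mul_pow,
    ← pow_mul, ← pow_mul, mul_comm 2]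
  ring

lemma IsPicardGroup.exists_secNorm_le (hΓ : IsPicardGroup Γ) (hω : ω ∈ globalSections Γ k) :
    ∃ M : ℝ, ∀ z, secNorm k ω z ≤ M := by
  obtain ⟨r, hr, hK⟩ := hΓ.exists_compact
  obtain ⟨M, hM⟩ := (isCompact_prox_ge hr).bddAbove_image (continuous_secNorm hω).continuousOn
  refine ⟨M, fun z => ?_⟩
  obtain ⟨γ, hγ⟩ := hK z
  rw [← secNorm_smul hω γ]
  exact hM ⟨_, hγ, rfl⟩

lemma IsPicardGroup.integrableOn_of_bounded (hΓ : IsPicardGroup Γ) {E : Type*}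
    [NormedAddCommGroup E] {f : Ball → E} (hf : Continuous f) [SecondCountableTopology E] {M : ℝ}
    (hM : ∀ z, ‖f z‖ ≤ M) : MeasureTheory.IntegrableOn f (fundDomain Γ) hypMeasure :=
  MeasureTheory.IntegrableOn.of_bound hΓ.measure_fundDomain_lt_top hf.aestronglyMeasurable M
    (Filter.Eventually.of_forall hM)

lemma IsPicardGroup.integrableOn_secNorm (hΓ : IsPicardGroup Γ) (hω : ω ∈ globalSections Γ k) :
    MeasureTheory.IntegrableOn (secNorm k ω) (fundDomain Γ) hypMeasure := by
  obtain ⟨M, hM⟩ := hΓ.exists_secNorm_le hω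
  refine hΓ.integrableOn_of_bounded (continuous_secNorm hω) (M := M) fun z => ?_
  rw [Real.norm_of_nonneg (secNorm_nonneg k ω z)]
  exact hM z

/-- The squared `L²` norm of a section. -/
def sqNorm (Γ : Subgroup SU21) (k : ℕ) (ω : Ball → CanPow k) : ℝ :=
  ∫ z in fundDomain Γ, secNorm k ω z ∂hypMeasure

lemma sqNorm_nonneg : 0 ≤ sqNorm Γ k ω :=
  MeasureTheory.integral_nonneg fun z => secNorm_nonneg k ω z

lemma IsPicardGroup.ofReal_sqNorm (hΓ : IsPicardGroup Γ) (hω : ω ∈ globalSections Γ k) :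
    ENNReal.ofReal (sqNorm Γ k ω)
      = ∫⁻ z in fundDomain Γ, ENNReal.ofReal (secNorm k ω z) ∂hypMeasure :=
  MeasureTheory.ofReal_integral_eq_lintegral_ofReal (hΓ.integrableOn_secNorm hω)
    (Filter.Eventually.of_forall fun z => secNorm_nonneg k ω z)

/-- The slash operator of weight `n`. -/
def slash (g : SU21) (n : ℕ) (f : (Fin 2 → ℂ) → ℂ) (z : Fin 2 → ℂ) : ℂ :=
  (autFactor g z ^ n)⁻¹ * f (moebius (mat g) z)

lemma differentiable_autFactor (g : SU21) : Differentiable ℂ (autFactor g) :=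
  fun z => (hasFDerivAt_row g 2 z).differentiableAt

lemma differentiableOn_slash (g : SU21) (n : ℕ) {f : (Fin 2 → ℂ) → ℂ}
    (hf : DifferentiableOn ℂ f Ball) : DifferentiableOn ℂ (slash g n f) Ball := by
  refine DifferentiableOn.mul ?_ (hf.comp (fun z hz =>
    (hasFDerivAt_moebius g hz).differentiableAt.differentiableWithinAt) fun z hz =>
    moebius_mem g hz)
  exact ((differentiable_autFactor g).differentiableOn.pow n).inv fun z hz =>
    pow_ne_zero _ (autFactor_ne_zero g ⟨z, hz⟩)

/-- The slash operator absorbs the automorphy factors, so any point can be treated as the origin.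
Here `g` ranges over all of `SU21`, and no invariance of `ω` is involved. -/
lemma secNorm_smul_eq_slash (g : SU21) (ω : Ball → CanPow k) (z : Ball) :
    secNorm k ω (g • z)
      = defect z.1 ^ (3 * k) * ‖slash g (3 * k) (ext0 (coefFun k ω)) z.1‖ ^ 2 := by
  have h0 := norm_pos_iff.2 (autFactor_ne_zero g z)
  rw [slash, ext0_apply _ (moebius_mem g z.2), ← defect_smul g z, norm_mul, norm_inv, norm_pow,
    secNorm]
  change _ = _ * (_ * ‖coefFun k ω (g • z)‖) ^ 2
  rw [mul_pow, mul_pow, inv_pow, ← pow_mul, ← pow_mul, mul_comm (3 * k) 2]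
  field_simp

/-- The weight is at least `(1 - s) ^ n` on the cell and the hyperbolic density at least 1; what
remains is the mean value inequality, with `s ^ 2` from the volume of a ball of radius `√s` in real
dimension 4. -/
lemma lintegral_cell_origin_ge {s : ℝ} (hs0 : 0 < s) (hs : s < 1) (n : ℕ) {f : (Fin 2 → ℂ) → ℂ}
    (hf : DifferentiableOn ℂ f Ball) :
    ENNReal.ofReal ((1 - s) ^ n * ‖f 0‖ ^ 2 * s ^ 2) * MeasureTheory.volume Ball
      ≤ ∫⁻ ζ in cell s origin, ENNReal.ofReal (defect ζ.1 ^ n * ‖f ζ.1‖ ^ 2) ∂hypMeasure := by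
  have hm := (isOpen_eball s).measurableSet
  have hsub : eball s ⊆ Ball := eball_subset_Ball hs.le
  set G : (Fin 2 → ℂ) → ENNReal := fun ζ => ENNReal.ofReal (defect ζ ^ n * ‖f ζ‖ ^ 2) with hG
  have e1 : ∫⁻ ζ in cell s origin, G ζ.1 ∂hypMeasure
      = ∫⁻ ζ : Ball, (eball s).indicator G ζ.1 ∂hypMeasure := by
    rw [← MeasureTheory.lintegral_indicator (isOpen_cell _ _).measurableSet]
    congr 1
    ext ζ
    have : ζ ∈ cell s origin ↔ ζ.1 ∈ eball s := by
      change 1 - s < prox ζ origin ^ 2 ↔ 1 - s < defect ζ.1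
      rw [prox_origin, Real.sq_sqrt (defect_pos ζ).le]
    by_cases h : ζ ∈ cell s origin
    · rw [Set.indicator_of_mem h, Set.indicator_of_mem (this.1 h)]
    · rw [Set.indicator_of_notMem h, Set.indicator_of_notMem (mt this.2 h)]
  have e2 : ∫⁻ ζ in Ball, ENNReal.ofReal ((defect ζ ^ 3)⁻¹) * (eball s).indicator G ζ
      = ∫⁻ ζ in eball s, ENNReal.ofReal ((defect ζ ^ 3)⁻¹) * G ζ := by
    have : (fun ζ => ENNReal.ofReal ((defect ζ ^ 3)⁻¹) * (eball s).indicator G ζ)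
        = (eball s).indicator fun ζ => ENNReal.ofReal ((defect ζ ^ 3)⁻¹) * G ζ := by
      ext ζ
      by_cases h : ζ ∈ eball s <;> simp [h]
    rw [this, MeasureTheory.setLIntegral_indicator hm, Set.inter_eq_self_of_subset_left hsub]
  rw [e1, lintegral_hypMeasure, e2]
  calc ENNReal.ofReal ((1 - s) ^ n * ‖f 0‖ ^ 2 * s ^ 2) * MeasureTheory.volume Ball
      = ENNReal.ofReal ((1 - s) ^ n) * (‖f 0‖ₑ ^ 2 * MeasureTheory.volume (eball s)) := by
        have h1 : 0 ≤ (1 - s) ^ n := pow_nonneg (by linarith) n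
        rw [volume_eball hs0, ENNReal.ofReal_mul (by positivity), ENNReal.ofReal_mul h1,
          ENNReal.ofReal_pow (norm_nonneg _), ofReal_norm]
        ring
    _ ≤ ENNReal.ofReal ((1 - s) ^ n) * ∫⁻ z in eball s, ‖f z‖ₑ ^ 2 := by
        gcongr
        exact mean_value_le hf hs.le
    _ = ∫⁻ z in eball s, ENNReal.ofReal ((1 - s) ^ n) * ‖f z‖ₑ ^ 2 := by
        rw [MeasureTheory.lintegral_const_mul' _ _ ENNReal.ofReal_ne_top]
    _ ≤ _ := by
        refine MeasureTheory.setLIntegral_mono' hm fun z hz => ?_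
        have hz' : 1 - s < defect z := hz
        have h0 : 0 < defect z := by linarith
        have h1 : 1 ≤ (defect z ^ 3)⁻¹ :=
          (one_le_inv₀ (by positivity)).2 (pow_le_one₀ h0.le (defect_le_one z))
        have h2 : (1 - s) ^ n ≤ defect z ^ n := pow_le_pow_left₀ (by linarith) hz'.le n
        rw [← ofReal_norm, ← ENNReal.ofReal_pow (norm_nonneg _),
          ← ENNReal.ofReal_mul (pow_nonneg (by linarith) n), hG, ← ENNReal.ofReal_mul (by positivity)]
        refine ENNReal.ofReal_le_ofReal ?_
        have h3 : (1 - s) ^ n * ‖f z‖ ^ 2 ≤ defect z ^ n * ‖f z‖ ^ 2 := by gcongr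
        have h4 : 0 ≤ defect z ^ n * ‖f z‖ ^ 2 := by positivity
        nlinarith

/-- The pointwise norm of a section of `Λ^{⊗ k}` is bounded by `k` times its `L²` norm. -/
lemma IsPicardGroup.exists_secNorm_le_sqNorm (hΓ : IsPicardGroup Γ) :
    ∃ C : ℝ, 0 < C ∧ ∀ k : ℕ, 1 ≤ k → ∀ ω ∈ globalSections Γ k, ∀ z,
      secNorm k ω z ≤ C * k ^ 2 * sqNorm Γ k ω := by
  obtain ⟨δ, h0, h1, hδ⟩ := hΓ.exists_cell
  set V := (MeasureTheory.volume Ball).toReal with hV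
  have hVpos : 0 < V := ENNReal.toReal_pos volume_Ball_pos.ne' volume_Ball_lt_top.ne
  have hc : 0 < (1 - δ) ^ 3 * δ ^ 2 * V := by
    have : 0 < 1 - δ := by linarith
    positivity
  refine ⟨((1 - δ) ^ 3 * δ ^ 2 * V)⁻¹, inv_pos.2 hc, fun k hk ω hω z => ?_⟩
  have hk0 : (1 : ℝ) ≤ k := by exact_mod_cast hk
  -- With squared radius `δ / k` the weight `(1 - s) ^ (3 * k)` stays above `(1 - δ) ^ 3` by
  -- Bernoulli, while the volume `s ^ 2` produces the factor `k ^ 2`. Since `s ≤ δ`, the cell still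
  -- injects into the quotient.
  set s := δ / k with hs
  have hs0 : 0 < s := by positivity
  have hsδ : s ≤ δ := div_le_self h0.le hk0
  obtain ⟨g, hg⟩ := exists_smul_eq origin z
  have hval : secNorm k ω z = ‖slash g (3 * k) (ext0 (coefFun k ω)) 0‖ ^ 2 := by
    rw [← hg, secNorm_smul_eq_slash, defect_origin, one_pow, one_mul]; rfl
  have hmain : ENNReal.ofReal ((1 - s) ^ (3 * k) * secNorm k ω z * s ^ 2 * V)
      ≤ ENNReal.ofReal (sqNorm Γ k ω) := by
    rw [hΓ.ofReal_sqNorm hω]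
    calc ENNReal.ofReal ((1 - s) ^ (3 * k) * secNorm k ω z * s ^ 2 * V)
        = ENNReal.ofReal ((1 - s) ^ (3 * k) * ‖slash g (3 * k) (ext0 (coefFun k ω)) 0‖ ^ 2 * s ^ 2)
          * MeasureTheory.volume Ball := by
          rw [ENNReal.ofReal_mul' hVpos.le, hV, ENNReal.ofReal_toReal volume_Ball_lt_top.ne, hval]
      _ ≤ _ := lintegral_cell_origin_ge hs0 (by linarith) _
          (differentiableOn_slash g _ (mem_globalSections.1 hω).1)
      _ = ∫⁻ ζ in cell s z, ENNReal.ofReal (secNorm k ω ζ) ∂hypMeasure := by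
          rw [← hg, lintegral_cell_smul]
          simp_rw [secNorm_smul_eq_slash]
      _ ≤ ∫⁻ ζ in cell δ z, ENNReal.ofReal (secNorm k ω ζ) ∂hypMeasure :=
          MeasureTheory.lintegral_mono_set (cell_mono hsδ z)
      _ ≤ _ := hΓ.lintegral_cell_le hδ z
          (ENNReal.measurable_ofReal.comp (continuous_secNorm hω).measurable)
          fun γ ζ => by rw [secNorm_smul hω]
  have hreal := (ENNReal.ofReal_le_ofReal_iff sqNorm_nonneg).1 hmain
  have hpow : (1 - δ) ^ 3 ≤ (1 - s) ^ (3 * k) := by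
    rw [mul_comm, pow_mul]
    refine pow_le_pow_left₀ (by linarith) ?_ 3
    have := one_add_mul_le_pow (a := -s) (by linarith) k
    have e : (k : ℝ) * -s = -δ := by rw [hs]; field_simp
    rw [e] at this
    simpa [sub_eq_add_neg] using this
  have hn := secNorm_nonneg k ω z
  have h5 : (1 - δ) ^ 3 * secNorm k ω z * s ^ 2 * V ≤ sqNorm Γ k ω := by
    refine le_trans ?_ hreal
    gcongr
  rw [mul_assoc, ← div_eq_inv_mul, le_div_iff₀ hc]
  have e : secNorm k ω z * ((1 - δ) ^ 3 * δ ^ 2 * V)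
      = k ^ 2 * ((1 - δ) ^ 3 * secNorm k ω z * s ^ 2 * V) := by
    rw [hs]; field_simp
  rw [e]
  gcongr

end Sections

/-! ### Poincaré series -/

section PoincareSeries

variable {Γ : Subgroup SU21} {k : ℕ}

/-- The affine function `z ↦ ⟨g (z, 1), (w, 1)⟩`. -/
def orbitForm (g : SU21) (w : Ball) (z : Fin 2 → ℂ) : ℂ :=
  herm ((mat g).mulVec (lift z)) (lift w.1)

/-- The linear part of `orbitForm`. -/
def orbitFormDeriv (g : SU21) (w : Ball) : (Fin 2 → ℂ) →L[ℂ] ℂ :=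
  rowForm g 2 - conj (w.1 0) • rowForm g 0 - conj (w.1 1) • rowForm g 1

lemma orbitForm_add (g : SU21) (w : Ball) (z v : Fin 2 → ℂ) :
    orbitForm g w (z + v) = orbitForm g w z + orbitFormDeriv g w v := by
  simp only [orbitForm, orbitFormDeriv, herm, mulVec_lift_apply, map_add]
  simp [lift]
  ring

lemma hasFDerivAt_orbitForm (g : SU21) (w : Ball) (z : Fin 2 → ℂ) :
    HasFDerivAt (orbitForm g w) (orbitFormDeriv g w) z := by
  have : orbitForm g w = fun x => orbitForm g w 0 + orbitFormDeriv g w x := by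
    ext x
    rw [← orbitForm_add, zero_add]
  rw [this]
  exact (orbitFormDeriv g w).hasFDerivAt.const_add _

lemma orbitForm_eq (g : SU21) (w z : Ball) :
    orbitForm g w z.1 = autFactor g z.1 * herm (lift (g • z).1) (lift w.1) := by
  rw [orbitForm, mulVec_lift]
  have := herm_smul (autFactor g z.1) 1 (lift (g • z).1) (lift w.1)
  simpa using this

lemma orbitForm_ne_zero (g : SU21) (w z : Ball) : orbitForm g w z.1 ≠ 0 := by
  rw [orbitForm_eq]
  exact mul_ne_zero (autFactor_ne_zero g z) (herm_ne_zero _ _)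

/-- Up to a factor independent of `g`, the terms of the Poincaré series have the powers of `prox` as
norms, so orbit sums control them. -/
lemma norm_orbitForm_inv (g : SU21) (w z : Ball) :
    ‖orbitForm g w z.1‖⁻¹ = prox (g • z) w / (√(defect z.1) * √(defect w.1)) := by
  have h0 := norm_pos_iff.2 (autFactor_ne_zero g z)
  have h1 := norm_pos_iff.2 (herm_ne_zero (g • z) w)
  have h2 := Real.sqrt_pos.2 (defect_pos (g • z))
  have h3 := Real.sqrt_pos.2 (defect_pos w)
  rw [orbitForm_eq, ← sqrt_defect_smul g z, prox, norm_mul]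
  field_simp

lemma orbitForm_smul (g h : SU21) (w z : Ball) :
    orbitForm (g * h) w z.1 = autFactor h z.1 * orbitForm g w (h • z).1 := by
  rw [orbitForm_eq, orbitForm_eq, autFactor_mul, mul_smul]; ring

/-- An affine function with a larger derivative would vanish inside the ball of radius `r`, at the
explicit point `z + t • v`, against `orbitForm_ne_zero`. -/
lemma norm_orbitFormDeriv_le (g : SU21) (w : Ball) {z : Fin 2 → ℂ} {r : ℝ} (hr : 0 < r)
    (hz : Metric.ball z r ⊆ Ball) : ‖orbitFormDeriv g w‖ ≤ ‖orbitForm g w z‖ / r := by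
  refine ContinuousLinearMap.opNorm_le_bound _ (by positivity) fun v => ?_
  by_contra! hlt
  have hd : orbitFormDeriv g w v ≠ 0 := by
    intro h0
    rw [h0, norm_zero] at hlt
    have : 0 ≤ ‖orbitForm g w z‖ / r * ‖v‖ := by positivity
    linarith
  set t : ℂ := -(orbitForm g w z / orbitFormDeriv g w v) with ht
  have hmem : z + t • v ∈ Ball := by
    apply hz
    rw [mem_ball_iff_norm, add_sub_cancel_left, norm_smul, ht, norm_neg, norm_div,
      div_mul_eq_mul_div, div_lt_iff₀ (norm_pos_iff.2 hd)]
    rw [div_mul_eq_mul_div, div_lt_iff₀ hr] at hlt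
    linarith
  refine orbitForm_ne_zero g w ⟨_, hmem⟩ ?_
  simp only
  rw [orbitForm_add, map_smul, smul_eq_mul, ht, neg_mul, div_mul_cancel₀ _ hd, add_neg_cancel]

lemma norm_orbitForm_pow_inv (g : SU21) (w z : Ball) (n : ℕ) :
    ‖(orbitForm g w z.1 ^ n)⁻¹‖ = prox (g • z) w ^ n / (√(defect z.1) * √(defect w.1)) ^ n := by
  rw [norm_inv, norm_pow, ← inv_pow, norm_orbitForm_inv, div_pow]

lemma prox_pow_le (z w : Ball) {n : ℕ} (hn : 6 ≤ n) : prox z w ^ n ≤ prox z w ^ 6 :=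
  pow_le_pow_of_le_one (prox_pos _ _).le (prox_le_one _ _) hn

lemma IsPicardGroup.summable_prox_pow (hΓ : IsPicardGroup Γ) (z w : Ball) {n : ℕ} (hn : 6 ≤ n) :
    Summable fun γ : Γ => prox (γ • z) w ^ n := by
  obtain ⟨C, -, hC⟩ := hΓ.exists_orbit_sum_le
  exact Summable.of_nonneg_of_le (fun γ => (pow_pos (prox_pos _ _) n).le)
    (fun γ => prox_pow_le _ _ hn) (hC z w).1

lemma IsPicardGroup.summable_orbitForm (hΓ : IsPicardGroup Γ) (z w : Ball) {n : ℕ} (hn : 6 ≤ n) :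
    Summable fun γ : Γ => (orbitForm γ w z.1 ^ n)⁻¹ := by
  refine Summable.of_norm ?_
  simp_rw [norm_orbitForm_pow_inv]
  exact (hΓ.summable_prox_pow z w hn).div_const _

/-- The Poincaré series of weight `3 * k` with base point `w`. -/
def poincare (Γ : Subgroup SU21) (k : ℕ) (w : Ball) (z : Ball) : CanPow k :=
  (∑' γ : Γ, (orbitForm γ w z.1 ^ (3 * k))⁻¹) • stdPow k

lemma coefFun_poincare (w z : Ball) :
    coefFun k (poincare Γ k w) z = ∑' γ : Γ, (orbitForm γ w z.1 ^ (3 * k))⁻¹ := by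
  rw [coefFun, poincare, map_smul, coeff_stdPow, smul_eq_mul, mul_one]

lemma hasFDerivAt_orbitForm_pow_inv (g : SU21) (w z : Ball) (n : ℕ) :
    HasFDerivAt (fun x => (orbitForm g w x ^ n)⁻¹)
      ((-(n * orbitForm g w z.1 ^ (n - 1)) / (orbitForm g w z.1 ^ n) ^ 2) • orbitFormDeriv g w)
      z.1 := by
  have h := ((hasDerivAt_pow n (orbitForm g w z.1)).fun_inv (pow_ne_zero n (orbitForm_ne_zero g w z)))
  exact h.comp_hasFDerivAt z.1 (hasFDerivAt_orbitForm g w z.1)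

lemma norm_deriv_orbitForm_pow_inv_le (g : SU21) (w z : Ball) {n : ℕ} (hn : 1 ≤ n) {r : ℝ}
    (hr : 0 < r) (hz : Metric.ball z.1 r ⊆ Ball) :
    ‖(-(n * orbitForm g w z.1 ^ (n - 1)) / (orbitForm g w z.1 ^ n) ^ 2) • orbitFormDeriv g w‖
      ≤ n / r * ‖(orbitForm g w z.1 ^ n)⁻¹‖ := by
  have h0 := norm_pos_iff.2 (orbitForm_ne_zero g w z)
  obtain ⟨m, rfl⟩ : ∃ m, n = m + 1 := ⟨n - 1, by omega⟩
  rw [norm_smul]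
  calc _ ≤ ‖-(((m + 1 : ℕ) : ℂ) * orbitForm g w z.1 ^ (m + 1 - 1)) / (orbitForm g w z.1 ^ (m + 1)) ^ 2‖
        * (‖orbitForm g w z.1‖ / r) := by
        gcongr
        exact norm_orbitFormDeriv_le g w hr hz
    _ = _ := by
        rw [norm_div, norm_neg, norm_mul, norm_pow, norm_pow, norm_pow, norm_inv, norm_pow,
          Complex.norm_natCast, Nat.add_sub_cancel]
        field_simp
        ring

/-- Termwise differentiation: derivatives of the terms are bounded by the terms, and these by their
values at the centre through `prox_harnack`. -/
lemma IsPicardGroup.differentiableOn_poincare (hΓ : IsPicardGroup Γ) (hk : 2 ≤ k) (w : Ball) :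
    DifferentiableOn ℂ (ext0 (coefFun k (poincare Γ k w))) Ball := by
  have hn : 6 ≤ 3 * k := by omega
  set S : (Fin 2 → ℂ) → ℂ := fun z => ∑' γ : Γ, (orbitForm γ w z ^ (3 * k))⁻¹ with hS
  have hcongr : ∀ z ∈ Ball, ext0 (coefFun k (poincare Γ k w)) z = S z := by
    intro z hz
    rw [ext0_apply _ hz, coefFun_poincare]
  refine DifferentiableOn.congr (f := S) (fun z₀ hz₀ => ?_) hcongr
  set p : Ball := ⟨z₀, hz₀⟩ with hp
  -- On this neighbourhood `defect` keeps half its value and the Harnack factor is at most `2 / (1 /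
  -- 2) = 4`.
  have hU : IsOpen (Subtype.val '' {z : Ball | 1 / 2 < prox p z ∧ defect z₀ / 2 < defect z.1}) := by
    refine isOpen_Ball.isOpenMap_subtype_val _ (IsOpen.inter ?_ ?_)
    · exact isOpen_lt continuous_const (continuous_prox_comp continuous_const continuous_id)
    · exact isOpen_lt continuous_const (continuous_defect.comp continuous_subtype_val)
  have hz₀U : z₀ ∈ Subtype.val '' {z : Ball | 1 / 2 < prox p z ∧ defect z₀ / 2 < defect z.1} := by
    have := defect_pos p
    refine ⟨p, ⟨?_, ?_⟩, rfl⟩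
    · rw [prox_eq_one_iff.2 rfl]; norm_num
    · exact half_lt_self this
  obtain ⟨r, hr, hball⟩ := Metric.isOpen_iff.1 hU z₀ hz₀U
  -- The other half of the radius is reserved for the balls required by `norm_orbitFormDeriv_le`.
  have hr2 : 0 < r / 2 := by positivity
  have hsub : ∀ z ∈ Metric.ball z₀ (r / 2), Metric.ball z (r / 2) ⊆ Ball := by
    intro z hz x hx
    have : x ∈ Metric.ball z₀ r := by
      rw [Metric.mem_ball] at *
      linarith [dist_triangle x z z₀]
    obtain ⟨y, -, rfl⟩ := hball this
    exact y.2
  set K : ℝ := (√(defect z₀ / 2) * √(defect w.1)) ^ (3 * k) with hK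
  have hKpos : 0 < K := by
    have h1 := defect_pos p
    have h2 := defect_pos w
    have h3 : 0 < √(defect z₀ / 2) := Real.sqrt_pos.2 (half_pos h1)
    have h4 : 0 < √(defect w.1) := Real.sqrt_pos.2 h2
    positivity
  have hbound : ∀ (γ : Γ) (z : Ball), z.1 ∈ Metric.ball z₀ (r / 2) →
      ‖(orbitForm γ w z.1 ^ (3 * k))⁻¹‖ ≤ 4 ^ (3 * k) * prox (γ • p) w ^ (3 * k) / K := by
    intro γ z hz
    obtain ⟨y, ⟨hy1, hy2⟩, hy⟩ := hball (Metric.ball_subset_ball (by linarith) hz)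
    have hyz : y = z := Subtype.ext hy
    rw [hyz] at hy1 hy2
    rw [norm_orbitForm_pow_inv, hK]
    have h1 := prox_harnack (γ • z) w (γ • p)
    rw [show prox (γ • p) (γ • z) = prox p z from prox_smul γ.1 p z] at h1
    have h2 : prox (γ.1 • z) w ≤ 4 * prox (γ • p) w := by
      have : 0 < prox (γ • z) w := prox_pos _ _
      change prox (γ • z) w ≤ _
      nlinarith
    have h3 := prox_pos (γ.1 • z) w
    have h4 : 0 < √(defect z₀ / 2) := Real.sqrt_pos.2 (half_pos (defect_pos p))
    have h5 : 0 < √(defect w.1) := Real.sqrt_pos.2 (defect_pos w)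
    have h6 := prox_pos (γ • p) w
    rw [← mul_pow]
    gcongr
  have hd := hasFDerivAt_tsum_of_isPreconnected (𝕜 := ℂ)
    (f := fun (γ : Γ) z => (orbitForm γ w z ^ (3 * k))⁻¹)
    (f' := fun γ z => (-((3 * k : ℕ) * orbitForm γ w z ^ (3 * k - 1))
      / (orbitForm γ w z ^ (3 * k)) ^ 2) • orbitFormDeriv γ w)
    (u := fun γ : Γ => ((3 * k : ℕ) : ℝ) / (r / 2)
      * (4 ^ (3 * k) * prox (γ • p) w ^ (3 * k) / K))
    (s := Metric.ball z₀ (r / 2)) (x₀ := z₀) (x := z₀)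
    ((((hΓ.summable_prox_pow p w hn).mul_left _).div_const _).mul_left _)
    Metric.isOpen_ball (convex_ball z₀ (r / 2)).isPreconnected
    (fun γ z hz => hasFDerivAt_orbitForm_pow_inv γ.1 w
      ⟨z, hsub z hz (Metric.mem_ball_self hr2)⟩ (3 * k))
    (fun γ z hz => (norm_deriv_orbitForm_pow_inv_le γ.1 w
      ⟨z, hsub z hz (Metric.mem_ball_self hr2)⟩ (by omega) hr2 (hsub z hz)).trans
      (mul_le_mul_of_nonneg_left
        (hbound γ ⟨z, hsub z hz (Metric.mem_ball_self hr2)⟩ hz) (by positivity)))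
    (Metric.mem_ball_self hr2) (hΓ.summable_orbitForm p w hn) (Metric.mem_ball_self hr2)
  exact hd.differentiableAt.differentiableWithinAt

lemma IsPicardGroup.poincare_mem (hΓ : IsPicardGroup Γ) (hk : 2 ≤ k) (w : Ball) :
    poincare Γ k w ∈ globalSections Γ k := by
  refine mem_globalSections.2 ⟨hΓ.differentiableOn_poincare hk w, fun β z => ?_⟩
  rw [coefFun_poincare, coefFun_poincare, ← tsum_mul_left,
    ← (Equiv.mulRight β).tsum_eq fun γ : Γ => autFactor β z.1 ^ (3 * k)
      * (orbitForm γ w z.1 ^ (3 * k))⁻¹]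
  refine tsum_congr fun γ => ?_
  have h := orbitForm_smul γ.1 β.1 w z
  have h0 := autFactor_ne_zero β.1 z
  change (orbitForm γ.1 w (β.1 • z).1 ^ (3 * k))⁻¹
    = autFactor β z.1 ^ (3 * k) * (orbitForm (γ.1 * β.1) w z.1 ^ (3 * k))⁻¹
  rw [h, mul_pow, mul_inv, mul_inv_cancel_left₀ (pow_ne_zero _ h0)]

lemma sqrt_defect_pow (z : Ball) (n : ℕ) : (√(defect z.1) ^ n) ^ 2 = defect z.1 ^ n := by
  rw [← pow_mul, mul_comm, pow_mul, Real.sq_sqrt (defect_pos z).le]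

lemma IsPicardGroup.secNorm_poincare_le (hΓ : IsPicardGroup Γ) (hk : 2 ≤ k) (w z : Ball) :
    defect w.1 ^ (3 * k) * secNorm k (poincare Γ k w) z
      ≤ (∑' γ : Γ, prox (γ • z) w ^ (3 * k)) ^ 2 := by
  have hn : 6 ≤ 3 * k := by omega
  have h1 := Real.sqrt_pos.2 (defect_pos z)
  have h2 := Real.sqrt_pos.2 (defect_pos w)
  have hsum := (hΓ.summable_orbitForm z w hn).norm
  have h := norm_tsum_le_tsum_norm hsum
  simp_rw [norm_orbitForm_pow_inv] at h
  rw [tsum_div_const] at h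
  rw [secNorm, coefFun_poincare, ← sqrt_defect_pow, ← sqrt_defect_pow, ← mul_assoc, ← mul_pow,
    ← mul_pow]
  refine pow_le_pow_left₀ (by positivity) ?_ 2
  rw [le_div_iff₀ (by positivity)] at h
  refine le_trans (le_of_eq ?_) h
  rw [mul_pow]; ring

/-- At the base point the identity term is `defect w ^ (-3k)`, and the remaining terms add up to at
most half of it, because the displacement gap is raised to a large power. The surviving half is
squared to `1 / 4`. -/
lemma IsPicardGroup.exists_le_secNorm_poincare (hΓ : IsPicardGroup Γ) :
    ∃ k₁ : ℕ, 3 ≤ k₁ ∧ ∀ k, k₁ ≤ k → ∀ w,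
      1 / 4 ≤ defect w.1 ^ (3 * k) * secNorm k (poincare Γ k w) w := by
  obtain ⟨C, hC0, hC⟩ := hΓ.exists_orbit_sum_le
  obtain ⟨δ, h0, h1, hδ⟩ := hΓ.exists_gap
  -- `n₀` factors of the gap bring the orbit sum `C` below `1 / 2`; six further factors are kept for
  -- its convergence.
  obtain ⟨n₀, hn₀⟩ := exists_pow_lt_of_lt_one (show 0 < 1 / (2 * C) by positivity)
    (show 1 - δ < 1 by linarith)
  refine ⟨n₀ + 3, by omega, fun k hk w => ?_⟩
  have hn : 6 ≤ 3 * k := by omega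
  have hsum := hΓ.summable_orbitForm w w hn
  have hw := defect_pos w
  have hrest : ‖∑' γ : Γ, if γ = 1 then 0 else (orbitForm γ w w.1 ^ (3 * k))⁻¹‖
      ≤ 1 / 2 / defect w.1 ^ (3 * k) := by
    have hle : ∀ γ : Γ, ‖if γ = 1 then 0 else (orbitForm γ w w.1 ^ (3 * k))⁻¹‖
        ≤ (1 - δ) ^ n₀ * prox (γ • w) w ^ 6 / defect w.1 ^ (3 * k) := by
      intro γ
      have hp := prox_pos (γ • w) w
      have hδ' : 0 < 1 - δ := by linarith
      split_ifs with hγ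
      · rw [norm_zero]; positivity
      · rw [norm_orbitForm_pow_inv, Real.mul_self_sqrt hw.le]
        gcongr
        change prox (γ • w) w ^ (3 * k) ≤ _
        calc prox (γ • w) w ^ (3 * k) ≤ prox (γ • w) w ^ (n₀ + 6) :=
              pow_le_pow_of_le_one hp.le (prox_le_one _ _) (by omega)
          _ = prox (γ • w) w ^ n₀ * prox (γ • w) w ^ 6 := pow_add _ _ _
          _ ≤ _ := by gcongr; exact hδ γ hγ w
    have hs : Summable fun γ : Γ => (1 - δ) ^ n₀ * prox (γ • w) w ^ 6 / defect w.1 ^ (3 * k) :=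
      ((hC w w).1.mul_left _).div_const _
    refine (tsum_of_norm_bounded hs.hasSum hle).trans ?_
    rw [tsum_div_const, tsum_mul_left]
    gcongr
    calc (1 - δ) ^ n₀ * ∑' γ : Γ, prox (γ • w) w ^ 6 ≤ 1 / (2 * C) * C := by
          have hs0 : 0 ≤ ∑' γ : Γ, prox (γ • w) w ^ 6 :=
            tsum_nonneg fun γ => (pow_pos (prox_pos _ _) 6).le
          have := (hC w w).2
          gcongr
      _ = 1 / 2 := by field_simp
  have h1' : (orbitForm (1 : Γ) w w.1 ^ (3 * k))⁻¹ = ((1 / defect w.1 ^ (3 * k) : ℝ) : ℂ) := by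
    rw [show (((1 : Γ) : SU21)) = 1 from rfl, orbitForm, mat_one, Matrix.one_mulVec, herm_lift_self]
    push_cast
    rw [one_div]
  have hlow : 1 / 2 / defect w.1 ^ (3 * k) ≤ ‖coefFun k (poincare Γ k w) w‖ := by
    classical
    rw [coefFun_poincare, hsum.tsum_eq_add_tsum_ite 1, h1']
    have h3 := norm_sub_le_norm_add (((1 / defect w.1 ^ (3 * k) : ℝ) : ℂ))
      (∑' γ : Γ, if γ = 1 then 0 else (orbitForm γ w w.1 ^ (3 * k))⁻¹)
    rw [Complex.norm_real, Real.norm_of_nonneg (by positivity)] at h3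
    refine le_trans ?_ (h3.trans (le_of_eq ?_))
    · have : 1 / defect w.1 ^ (3 * k) = 2 * (1 / 2 / defect w.1 ^ (3 * k)) := by ring
      linarith
    · congr!
  rw [secNorm]
  have hD : 0 < defect w.1 ^ (3 * k) := by positivity
  rw [div_le_iff₀ hD] at hlow
  nlinarith

/-! ### Gaussian bounds and the norm of the Poincaré series -/

lemma integrable_gaussian :
    MeasureTheory.Integrable fun z : Fin 2 → ℂ => Real.exp (-(‖z 0‖ ^ 2 + ‖z 1‖ ^ 2) / 2) := by
  have h : MeasureTheory.Integrable fun z : ℂ => Real.exp (-(‖z‖ ^ 2) / 2) := by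
    have := GaussianFourier.integrable_cexp_neg_mul_sq_norm_add (b := 1 / 2) (by norm_num) 0 (0 : ℂ)
    refine this.norm.congr (Filter.Eventually.of_forall fun z => ?_)
    simp only [Complex.norm_exp]
    congr 1
    have : ((-(1 / 2) * (‖z‖ : ℂ) ^ 2 + 0 * ((inner ℝ (0 : ℂ) z : ℝ) : ℂ)))
      = ((-(‖z‖ ^ 2) / 2 : ℝ) : ℂ) := by
      push_cast; ring
    rw [this, Complex.ofReal_re]
  have h2 := MeasureTheory.Integrable.fintype_prod (𝕜 := ℝ) (ι := Fin 2)
    (f := fun _ (z : ℂ) => Real.exp (-(‖z‖ ^ 2) / 2)) (fun _ => h)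
  refine h2.congr (Filter.Eventually.of_forall fun z => ?_)
  simp only [Fin.prod_univ_two]
  rw [← Real.exp_add]
  congr 1; ring

/-- `1 - x ≤ exp (-x)` bounds the integrand by a Gaussian of width `k ^ (-1/2)`, and scaling in real
dimension 4 yields `k ^ (-2)`. -/
lemma exists_lintegral_sqrt_defect_pow_le :
    ∃ K : ℝ, 0 < K ∧ ∀ k p : ℕ, 1 ≤ k → k ≤ p →
      ∫⁻ ζ in Ball, ENNReal.ofReal (√(defect ζ) ^ p) ≤ ENNReal.ofReal (K / k ^ 2) := by
  set G : (Fin 2 → ℂ) → ℝ := fun z => Real.exp (-(‖z 0‖ ^ 2 + ‖z 1‖ ^ 2) / 2) with hG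
  have hG0 : 0 ≤ ∫ z, G z := MeasureTheory.integral_nonneg fun z => (Real.exp_pos _).le
  refine ⟨(∫ z, G z) + 1, by positivity, fun k p hk hp => ?_⟩
  have hk0 : (0 : ℝ) < k := by exact_mod_cast hk
  have hsc : MeasureTheory.Integrable fun z : Fin 2 → ℂ => G (√k • z) :=
    integrable_gaussian.comp_smul (Real.sqrt_pos.2 hk0).ne'
  have hint : ∫ z, G (√k • z) = (∫ z, G z) / k ^ 2 := by
    rw [MeasureTheory.Measure.integral_comp_smul]
    have : Module.finrank ℝ (Fin 2 → ℂ) = 4 := by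
      rw [Module.finrank_pi_fintype]; simp [Complex.finrank_real_complex]
    rw [this, show 4 = 2 * 2 from rfl, pow_mul, Real.sq_sqrt hk0.le, abs_of_pos (by positivity),
      smul_eq_mul]
    field_simp
  calc ∫⁻ ζ in Ball, ENNReal.ofReal (√(defect ζ) ^ p)
      ≤ ∫⁻ ζ in Ball, ENNReal.ofReal (G (√k • ζ)) := by
        refine MeasureTheory.setLIntegral_mono' measurableSet_Ball fun ζ hζ => ?_
        refine ENNReal.ofReal_le_ofReal ?_
        have h0 := mem_Ball_iff.1 hζ
        have h1 : √(defect ζ) ≤ 1 := Real.sqrt_le_one.2 (defect_le_one ζ)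
        have h2 : defect ζ ≤ Real.exp (-(‖ζ 0‖ ^ 2 + ‖ζ 1‖ ^ 2)) := by
          have := Real.add_one_le_exp (-(‖ζ 0‖ ^ 2 + ‖ζ 1‖ ^ 2))
          unfold defect; linarith
        have h3 : √(defect ζ) ≤ Real.exp (-(‖ζ 0‖ ^ 2 + ‖ζ 1‖ ^ 2) / 2) := by
          rw [Real.exp_half]
          exact Real.sqrt_le_sqrt h2
        calc √(defect ζ) ^ p ≤ √(defect ζ) ^ k := pow_le_pow_of_le_one (Real.sqrt_nonneg _) h1 hp
          _ ≤ Real.exp (-(‖ζ 0‖ ^ 2 + ‖ζ 1‖ ^ 2) / 2) ^ k := by gcongr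
          _ = G (√k • ζ) := by
            rw [← Real.exp_nat_mul, hG]
            simp only [Pi.smul_apply, norm_smul, Real.norm_eq_abs, mul_pow, sq_abs,
              Real.sq_sqrt hk0.le]
            congr 1; ring
    _ ≤ ∫⁻ ζ, ENNReal.ofReal (G (√k • ζ)) := MeasureTheory.setLIntegral_le_lintegral _ _
    _ = ENNReal.ofReal (∫ ζ, G (√k • ζ)) :=
        (MeasureTheory.ofReal_integral_eq_lintegral_ofReal hsc
          (Filter.Eventually.of_forall fun z => (Real.exp_pos _).le)).symm
    _ ≤ _ := by
        rw [hint]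
        refine ENNReal.ofReal_le_ofReal ?_
        gcongr
        linarith

/-- Of the squared orbit sum one factor is bounded by `C`, and the other unfolds to an integral over
the whole ball. -/
lemma IsPicardGroup.exists_sqNorm_poincare_le (hΓ : IsPicardGroup Γ) :
    ∃ K : ℝ, 0 < K ∧ ∀ k, 3 ≤ k → ∀ w,
      defect w.1 ^ (3 * k) * sqNorm Γ k (poincare Γ k w) ≤ K / k ^ 2 := by
  have := countable_of_discrete hΓ.discrete
  obtain ⟨C, hC0, hC⟩ := hΓ.exists_orbit_sum_le
  obtain ⟨K, hK0, hK⟩ := exists_lintegral_sqrt_defect_pow_le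
  refine ⟨C * K, by positivity, fun k hk w => ?_⟩
  have hn : 6 ≤ 3 * k := by omega
  have hk0 : (0 : ℝ) < k := by exact_mod_cast (by omega : 0 < k)
  have hD := pow_pos (defect_pos w) (3 * k)
  have hpt : ∀ z : Ball, defect w.1 ^ (3 * k) * secNorm k (poincare Γ k w) z
      ≤ C * ∑' γ : Γ, prox (γ • z) w ^ (3 * k) := by
    intro z
    refine (hΓ.secNorm_poincare_le (by omega) w z).trans ?_
    rw [sq]
    have h0 : 0 ≤ ∑' γ : Γ, prox (γ • z) w ^ (3 * k) :=
      tsum_nonneg fun γ => (pow_pos (prox_pos _ _) _).le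
    refine mul_le_mul_of_nonneg_right (le_trans ?_ (hC z w).2) h0
    exact (hΓ.summable_prox_pow z w hn).tsum_le_tsum (fun γ => prox_pow_le _ _ hn) (hC z w).1
  rw [← ENNReal.ofReal_le_ofReal_iff (by positivity), ENNReal.ofReal_mul hD.le,
    hΓ.ofReal_sqNorm (hΓ.poincare_mem (by omega) w),
    ← MeasureTheory.lintegral_const_mul' _ _ ENNReal.ofReal_ne_top]
  have hmeas : Measurable fun ζ : Ball => ENNReal.ofReal (prox ζ w ^ (3 * k)) :=
    ENNReal.measurable_ofReal.comp
      ((continuous_prox_comp continuous_id continuous_const).pow (3 * k)).measurable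
  calc ∫⁻ z in fundDomain Γ, ENNReal.ofReal (defect w.1 ^ (3 * k))
        * ENNReal.ofReal (secNorm k (poincare Γ k w) z) ∂hypMeasure
      ≤ ∫⁻ z in fundDomain Γ, ENNReal.ofReal C
        * ∑' γ : Γ, ENNReal.ofReal (prox (γ • z) w ^ (3 * k)) ∂hypMeasure := by
        refine MeasureTheory.lintegral_mono fun z => ?_
        rw [← ENNReal.ofReal_mul hD.le, ← ENNReal.ofReal_tsum_of_nonneg
          (fun γ => (pow_pos (prox_pos _ _) _).le) (hΓ.summable_prox_pow z w hn),
          ← ENNReal.ofReal_mul hC0.le]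
        exact ENNReal.ofReal_le_ofReal (hpt z)
    _ = ENNReal.ofReal C * ∫⁻ ζ, ENNReal.ofReal (prox ζ w ^ (3 * k)) ∂hypMeasure := by
        rw [MeasureTheory.lintegral_const_mul' _ _ ENNReal.ofReal_ne_top, hΓ.lintegral_unfold hmeas]
    _ ≤ ENNReal.ofReal C * ENNReal.ofReal (K / k ^ 2) := by
        gcongr
        -- The Gaussian bound needs `k ≤ 3 * k - 6`, which is where `3 ≤ k` is used.
        have e : 3 * k = 6 + (3 * k - 6) := by omega
        rw [e, lintegral_prox_pow]
        exact hK k _ (by omega) (by omega)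
    _ = _ := by rw [← ENNReal.ofReal_mul hC0.le, mul_div_assoc]

/-- For large `k` there are sections that are large at a given point. -/
lemma IsPicardGroup.exists_peak_section (hΓ : IsPicardGroup Γ) :
    ∃ k₁ : ℕ, 3 ≤ k₁ ∧ ∃ c : ℝ, 0 < c ∧ ∀ k, k₁ ≤ k → ∀ w, ∃ η ∈ globalSections Γ k,
      0 < secNorm k η w ∧ c * k ^ 2 * sqNorm Γ k η ≤ secNorm k η w := by
  obtain ⟨k₁, hk₁, h1⟩ := hΓ.exists_le_secNorm_poincare
  obtain ⟨K, hK0, h2⟩ := hΓ.exists_sqNorm_poincare_le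
  refine ⟨k₁, hk₁, 1 / (4 * K), by positivity, fun k hk w =>
    ⟨_, hΓ.poincare_mem (by omega) w, ?_, ?_⟩⟩
  · have := h1 k hk w
    have hD := pow_pos (defect_pos w) (3 * k)
    by_contra! h
    nlinarith
  · have hk0 : (0 : ℝ) < k := by exact_mod_cast (by omega : 0 < k)
    have hD := pow_pos (defect_pos w) (3 * k)
    have h3 := h1 k hk w
    have h4 := h2 k (by omega) w
    rw [le_div_iff₀ (by positivity)] at h4
    have h5 : 1 / (4 * K) * (defect w.1 ^ (3 * k) * sqNorm Γ k (poincare Γ k w) * k ^ 2)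
        ≤ 1 / (4 * K) * K := by gcongr
    have h6 : 1 / (4 * K) * K = 1 / 4 := by field_simp
    refine le_of_mul_le_mul_left ?_ hD
    linarith

end PoincareSeries

/-! ### Orthonormal bases and the Bergman kernel on the diagonal -/

section BergmanKernel

variable {Γ : Subgroup SU21} {k : ℕ}

lemma coefFun_add (ω η : Ball → CanPow k) (z : Ball) :
    coefFun k (ω + η) z = coefFun k ω z + coefFun k η z := map_add (coeff k) _ _

lemma coefFun_smul (c : ℂ) (ω : Ball → CanPow k) (z : Ball) :
    coefFun k (c • ω) z = c * coefFun k ω z := map_smul (coeff k) _ _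

lemma coefFun_sum {ι : Type*} (s : Finset ι) (a : ι → ℂ) (ω : ι → Ball → CanPow k) (z : Ball) :
    coefFun k (∑ i ∈ s, a i • ω i) z = ∑ i ∈ s, a i * coefFun k (ω i) z := by
  rw [coefFun, Finset.sum_apply, map_sum]
  simp [coefFun]

lemma fiberInner_eq (ω η : Ball → CanPow k) (z : Ball) :
    fiberInner k z.1 (ω z) (η z)
      = (defect z.1 : ℂ) ^ (3 * k) * (coefFun k ω z * conj (coefFun k η z)) := rfl

lemma fiberInner_self (ω : Ball → CanPow k) (z : Ball) :
    fiberInner k z.1 (ω z) (ω z) = (secNorm k ω z : ℂ) := by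
  rw [fiberInner_eq, Complex.mul_conj', secNorm]; push_cast; rfl

lemma hypInner_self (ω : Ball → CanPow k) : hypInner Γ k ω ω = (sqNorm Γ k ω : ℂ) := by
  rw [hypInner, sqNorm, ← integral_complex_ofReal]
  simp_rw [fiberInner_self]

lemma norm_fiberInner_le (ω η : Ball → CanPow k) (z : Ball) :
    ‖fiberInner k z.1 (ω z) (η z)‖ ≤ secNorm k ω z + secNorm k η z := by
  have h := pow_pos (defect_pos z) (3 * k)
  rw [fiberInner_eq, norm_mul, norm_mul, norm_pow, Complex.norm_real, Complex.norm_conj,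
    Real.norm_of_nonneg (defect_pos z).le, secNorm, secNorm, ← mul_add]
  refine mul_le_mul_of_nonneg_left ?_ h.le
  nlinarith [sq_nonneg (‖coefFun k ω z‖ - ‖coefFun k η z‖), sq_nonneg ‖coefFun k ω z‖,
    sq_nonneg ‖coefFun k η z‖]

lemma IsPicardGroup.integrableOn_fiberInner (hΓ : IsPicardGroup Γ) {ω η : Ball → CanPow k}
    (hω : ω ∈ globalSections Γ k) (hη : η ∈ globalSections Γ k) :
    MeasureTheory.IntegrableOn (fun z : Ball => fiberInner k z.1 (ω z) (η z)) (fundDomain Γ)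
      hypMeasure := by
  obtain ⟨M, hM⟩ := hΓ.exists_secNorm_le hω
  obtain ⟨N, hN⟩ := hΓ.exists_secNorm_le hη
  refine hΓ.integrableOn_of_bounded ?_ (M := M + N) fun z =>
    (norm_fiberInner_le ω η z).trans (add_le_add (hM z) (hN z))
  simp_rw [fiberInner_eq]
  have h1 := continuous_coefFun hω
  have h2 := continuous_coefFun hη
  have h3 : Continuous fun z : Ball => conj (coefFun k η z) := Complex.continuous_conj.comp h2
  have h4 : Continuous fun z : Ball => (defect z.1 : ℂ) :=
    Complex.continuous_ofReal.comp (continuous_defect.comp continuous_subtype_val)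
  exact (h4.pow _).mul (h1.mul h3)

lemma conj_hypInner (ω η : Ball → CanPow k) : conj (hypInner Γ k ω η) = hypInner Γ k η ω := by
  rw [hypInner, ← integral_conj, hypInner]
  congr 1
  ext z
  rw [fiberInner_eq, fiberInner_eq]
  simp only [map_mul, map_pow, Complex.conj_ofReal, Complex.conj_conj]
  ring

lemma IsPicardGroup.hypInner_add_right (hΓ : IsPicardGroup Γ) {ω η θ : Ball → CanPow k}
    (hω : ω ∈ globalSections Γ k) (hη : η ∈ globalSections Γ k) (hθ : θ ∈ globalSections Γ k) :
    hypInner Γ k ω (η + θ) = hypInner Γ k ω η + hypInner Γ k ω θ := by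
  rw [hypInner, hypInner, hypInner, ← MeasureTheory.integral_add
    (hΓ.integrableOn_fiberInner hω hη) (hΓ.integrableOn_fiberInner hω hθ)]
  congr 1
  ext z
  rw [fiberInner_eq, fiberInner_eq, fiberInner_eq, coefFun_add, map_add]
  ring

lemma hypInner_smul_right (c : ℂ) (ω η : Ball → CanPow k) :
    hypInner Γ k ω (c • η) = conj c * hypInner Γ k ω η := by
  rw [hypInner, hypInner, ← MeasureTheory.integral_const_mul]
  congr 1
  ext z
  rw [fiberInner_eq, fiberInner_eq, coefFun_smul, map_mul]
  ring

/-- The pointwise bound by the `L²` norm gives definiteness without discussing null sets. -/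
lemma IsPicardGroup.eq_zero_of_sqNorm_eq_zero (hΓ : IsPicardGroup Γ) (hk : 1 ≤ k)
    {ω : Ball → CanPow k} (hω : ω ∈ globalSections Γ k) (h : sqNorm Γ k ω = 0) : ω = 0 := by
  obtain ⟨C, -, hC⟩ := hΓ.exists_secNorm_le_sqNorm
  ext z
  have h1 := hC k hk ω hω z
  rw [h, mul_zero] at h1
  have h2 := pow_pos (defect_pos z) (3 * k)
  have h3 : ‖coefFun k ω z‖ = 0 := by
    unfold secNorm at h1
    have : ‖coefFun k ω z‖ ^ 2 ≤ 0 := by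
      by_contra! h0
      nlinarith
    nlinarith [sq_nonneg ‖coefFun k ω z‖, norm_nonneg (coefFun k ω z)]
  apply coeff_injective k
  rw [Pi.zero_apply, map_zero]
  exact norm_eq_zero.1 h3

/-- The inner product space structure on the space of global sections. -/
@[reducible]
def IsPicardGroup.core (hΓ : IsPicardGroup Γ) (hk : 1 ≤ k) :
    InnerProductSpace.Core ℂ (globalSections Γ k) where
  -- The arguments are swapped because `hypInner` is conjugate-linear in its second argument.
  inner x y := hypInner Γ k y.1 x.1
  conj_inner_symm x y := conj_hypInner _ _
  re_inner_nonneg x := by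
    rw [hypInner_self]
    exact sqNorm_nonneg
  add_left x y z := hΓ.hypInner_add_right z.2 x.2 y.2
  smul_left x y r := hypInner_smul_right r _ _
  definite x hx := by
    refine Subtype.ext (hΓ.eq_zero_of_sqNorm_eq_zero hk x.2 ?_)
    rw [hypInner_self] at hx
    exact_mod_cast hx

lemma IsPicardGroup.sqNorm_sum (hΓ : IsPicardGroup Γ) {d : ℕ} {ω : Fin d → Ball → CanPow k}
    (hmem : ∀ i, ω i ∈ globalSections Γ k)
    (hω : ∀ i j, hypInner Γ k (ω i) (ω j) = if i = j then 1 else 0) (a : Fin d → ℂ) :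
    sqNorm Γ k (∑ i, a i • ω i) = ∑ i, ‖a i‖ ^ 2 := by
  have h1 : ∀ z : Ball, fiberInner k z.1 ((∑ i, a i • ω i) z) ((∑ i, a i • ω i) z)
      = ∑ i, ∑ j, a i * conj (a j) * fiberInner k z.1 (ω i z) (ω j z) := by
    intro z
    rw [fiberInner_eq, coefFun_sum, map_sum, Finset.sum_mul_sum, Finset.mul_sum]
    refine Finset.sum_congr rfl fun i _ => ?_
    rw [Finset.mul_sum]
    refine Finset.sum_congr rfl fun j _ => ?_
    rw [fiberInner_eq, map_mul]
    ring
  have h2 : hypInner Γ k (∑ i, a i • ω i) (∑ i, a i • ω i)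
      = ∑ i, ∑ j, a i * conj (a j) * hypInner Γ k (ω i) (ω j) := by
    rw [hypInner]
    simp_rw [h1]
    rw [MeasureTheory.integral_finsetSum]
    · refine Finset.sum_congr rfl fun i _ => ?_
      rw [MeasureTheory.integral_finsetSum]
      · refine Finset.sum_congr rfl fun j _ => ?_
        rw [MeasureTheory.integral_const_mul, hypInner]
      · exact fun j _ => (hΓ.integrableOn_fiberInner (hmem i) (hmem j)).const_mul _
    · exact fun i _ => MeasureTheory.integrable_finsetSum _ fun j _ =>
        (hΓ.integrableOn_fiberInner (hmem i) (hmem j)).const_mul _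
  rw [hypInner_self] at h2
  simp_rw [hω] at h2
  simp only [mul_ite, mul_one, mul_zero, Finset.sum_ite_eq, Finset.mem_univ, if_true,
    Complex.mul_conj'] at h2
  exact_mod_cast h2

lemma bergmanKernel_self {d : ℕ} (ω : Fin d → Ball → CanPow k) (z : Ball) :
    bergmanKernel k ω z z = ((∑ j, ‖coefFun k (ω j) z‖ ^ 2 : ℝ) : ℂ) := by
  rw [bergmanKernel]
  push_cast
  exact Finset.sum_congr rfl fun j _ => Complex.mul_conj' _

lemma bergmanNorm_eq_mul {d : ℕ} (ω : Fin d → Ball → CanPow k) (z : Ball) :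
    bergmanNorm k ω z = defect z.1 ^ (3 * k) * ∑ j, ‖coefFun k (ω j) z‖ ^ 2 := by
  rw [bergmanNorm, bergmanKernel_self, Complex.norm_real,
    Real.norm_of_nonneg (Finset.sum_nonneg fun j _ => sq_nonneg _)]

lemma bergmanNorm_eq_sum {d : ℕ} (ω : Fin d → Ball → CanPow k) (z : Ball) :
    bergmanNorm k ω z = ∑ j, secNorm k (ω j) z := by
  rw [bergmanNorm_eq_mul, Finset.mul_sum]; rfl

/-- The Bergman kernel is at most of order `k²`. -/
lemma IsPicardGroup.exists_bergmanNorm_le (hΓ : IsPicardGroup Γ) :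
    ∃ C : ℝ, 0 < C ∧ ∀ k : ℕ, 1 ≤ k → ∀ (d : ℕ) (ω : Fin d → Ball → CanPow k),
      (∀ i, ω i ∈ globalSections Γ k) →
      (∀ i j, hypInner Γ k (ω i) (ω j) = if i = j then 1 else 0) →
      ∀ z, bergmanNorm k ω z ≤ C * k ^ 2 := by
  obtain ⟨C, hC0, hC⟩ := hΓ.exists_secNorm_le_sqNorm
  refine ⟨C, hC0, fun k hk d ω hmem hω z => ?_⟩
  -- This section represents evaluation at `z`: its coefficient at `z` and its squared norm both
  -- equal `S`, so the pointwise bound compares `S ^ 2` with `S`. Spanning is not needed, so the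
  -- bound also serves for partial orthonormal families.
  have h := hC k hk (∑ i, conj (coefFun k (ω i) z) • ω i)
    (Submodule.sum_mem _ fun i _ => Submodule.smul_mem _ _ (hmem i)) z
  rw [hΓ.sqNorm_sum hmem hω] at h
  simp only [Complex.norm_conj] at h
  set S := ∑ i, ‖coefFun k (ω i) z‖ ^ 2 with hS
  have hval : coefFun k (∑ i, conj (coefFun k (ω i) z) • ω i) z = (S : ℂ) := by
    rw [coefFun_sum, hS]
    push_cast
    exact Finset.sum_congr rfl fun i _ => Complex.conj_mul' _
  have hS0 : 0 ≤ S := Finset.sum_nonneg fun i _ => sq_nonneg _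
  rw [secNorm, hval, Complex.norm_real, Real.norm_of_nonneg hS0] at h
  rw [bergmanNorm_eq_mul]
  rcases hS0.eq_or_lt with h0 | h0
  · rw [← hS, ← h0, mul_zero]; positivity
  · rw [← hS]
    refine le_of_mul_le_mul_right ?_ h0
    linarith

/-- The kernel of an orthonormal family integrates to its cardinality, while its supremum and the
volume of the quotient are bounded. -/
lemma IsPicardGroup.exists_card_le (hΓ : IsPicardGroup Γ) (hk : 1 ≤ k) :
    ∃ N : ℕ, ∀ (d : ℕ) (ω : Fin d → Ball → CanPow k), (∀ i, ω i ∈ globalSections Γ k) →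
      (∀ i j, hypInner Γ k (ω i) (ω j) = if i = j then 1 else 0) → d ≤ N := by
  obtain ⟨C, hC0, hC⟩ := hΓ.exists_bergmanNorm_le
  refine ⟨⌈C * k ^ 2 * hypMeasure.real (fundDomain Γ)⌉₊, fun d ω hmem hω => ?_⟩
  rw [← Nat.cast_le (α := ℝ)]
  refine le_trans ?_ (Nat.le_ceil _)
  have h1 : ∀ i, sqNorm Γ k (ω i) = 1 := by
    intro i
    have := hω i i
    rw [hypInner_self, if_pos rfl] at this
    exact_mod_cast this
  have hfin := hΓ.measure_fundDomain_lt_top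
  calc (d : ℝ) = ∑ i : Fin d, sqNorm Γ k (ω i) := by simp [h1]
    _ = ∫ z in fundDomain Γ, bergmanNorm k ω z ∂hypMeasure := by
        simp_rw [bergmanNorm_eq_sum]
        rw [MeasureTheory.integral_finsetSum _ fun i _ => hΓ.integrableOn_secNorm (hmem i)]
        rfl
    _ ≤ ∫ _ in fundDomain Γ, C * k ^ 2 ∂hypMeasure := by
        refine MeasureTheory.integral_mono ?_ ?_ fun z => hC k hk d ω hmem hω z
        · exact (MeasureTheory.integrable_finsetSum _ fun i _ =>
            hΓ.integrableOn_secNorm (hmem i)).congr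
              (Filter.Eventually.of_forall fun z => (bergmanNorm_eq_sum ω z).symm)
        · exact MeasureTheory.integrableOn_const hfin.ne
    _ = _ := by
        rw [MeasureTheory.setIntegral_const, smul_eq_mul, mul_comm]

/-- Infinite dimension would allow orthonormal families of `N + 1` sections, against
`IsPicardGroup.exists_card_le`. -/
lemma IsPicardGroup.exists_isOrthonormalBasis (hΓ : IsPicardGroup Γ) (hk : 1 ≤ k) :
    ∃ (d : ℕ) (ω : Fin d → Ball → CanPow k), IsOrthonormalBasis Γ k ω := by
  let core := hΓ.core hk
  let : NormedAddCommGroup (globalSections Γ k) := core.toNormedAddCommGroup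
  let : InnerProductSpace ℂ (globalSections Γ k) := InnerProductSpace.ofCore core.toCore
  have horth : ∀ {d : ℕ} {b : Fin d → globalSections Γ k}, Orthonormal ℂ b →
      ∀ i j, hypInner Γ k (b i).1 (b j).1 = if i = j then 1 else 0 := by
    intro d b hb i j
    have h := orthonormal_iff_ite.1 hb j i
    refine Eq.trans h ?_
    by_cases hij : i = j
    · rw [if_pos hij, if_pos hij.symm]
    · rw [if_neg hij, if_neg (Ne.symm hij)]
  obtain ⟨N, hN⟩ := hΓ.exists_card_le hk
  have hfd : FiniteDimensional ℂ (globalSections Γ k) := by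
    by_contra hinf
    have hrank : ((N + 1 : ℕ) : Cardinal) ≤ Module.rank ℂ (globalSections Γ k) := by
      refine (Cardinal.natCast_lt_aleph0).le.trans ?_
      rw [← not_lt, Module.rank_lt_aleph0_iff]
      exact hinf
    obtain ⟨s, hs, hli⟩ := le_rank_iff_exists_linearIndependent_finset.1 hrank
    have hW : Module.finrank ℂ (Submodule.span ℂ (s : Set (globalSections Γ k))) = N + 1 := by
      rw [finrank_span_finset_eq_card hli, hs]
    let b := stdOrthonormalBasis ℂ (Submodule.span ℂ (s : Set (globalSections Γ k)))
    have hb : Orthonormal ℂ fun i => (b i : globalSections Γ k) :=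
      b.orthonormal.comp_linearIsometry (Submodule.subtypeₗᵢ _)
    have := hN _ (fun i => (b i : globalSections Γ k).1) (fun i => (b i : globalSections Γ k).2)
      (horth hb)
    omega
  let b := stdOrthonormalBasis ℂ (globalSections Γ k)
  refine ⟨_, fun i => (b i).1, ⟨?_, horth b.orthonormal⟩⟩
  have h1 : Submodule.span ℂ (Set.range b) = ⊤ := by
    rw [← b.coe_toBasis]; exact b.toBasis.span_eq
  have h2 := congrArg (Submodule.map (globalSections Γ k).subtype) h1
  rw [Submodule.map_span, Submodule.map_top, Submodule.range_subtype, ← Set.range_comp] at h2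
  exact h2

lemma IsOrthonormalBasis.mem {d : ℕ} {ω : Fin d → Ball → CanPow k}
    (h : IsOrthonormalBasis Γ k ω) (i : Fin d) : ω i ∈ globalSections Γ k := by
  rw [← h.span_eq]
  exact Submodule.subset_span ⟨i, rfl⟩

/-- Cauchy–Schwarz for the expansion in the basis: the extremal property that turns one large
section into a lower bound for the kernel. -/
lemma IsOrthonormalBasis.secNorm_le (hΓ : IsPicardGroup Γ) {d : ℕ} {ω : Fin d → Ball → CanPow k}
    (h : IsOrthonormalBasis Γ k ω) {η : Ball → CanPow k} (hη : η ∈ globalSections Γ k) (z : Ball) :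
    secNorm k η z ≤ sqNorm Γ k η * bergmanNorm k ω z := by
  rw [← h.span_eq] at hη
  obtain ⟨a, rfl⟩ := (Submodule.mem_span_range_iff_exists_fun ℂ).1 hη
  rw [hΓ.sqNorm_sum h.mem h.orthonormal, bergmanNorm_eq_mul, secNorm, coefFun_sum, mul_left_comm]
  refine mul_le_mul_of_nonneg_left ?_ (pow_pos (defect_pos z) _).le
  calc ‖∑ i, a i * coefFun k (ω i) z‖ ^ 2 ≤ (∑ i, ‖a i‖ * ‖coefFun k (ω i) z‖) ^ 2 := by
        gcongr
        exact (norm_sum_le _ _).trans_eq (by simp_rw [norm_mul])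
    _ ≤ _ := Finset.sum_mul_sq_le_sq_mul_sq _ _ _

/-- The Bergman kernel is at least of order `k²`. -/
lemma IsPicardGroup.exists_le_bergmanNorm (hΓ : IsPicardGroup Γ) :
    ∃ k₁ : ℕ, 3 ≤ k₁ ∧ ∃ c : ℝ, 0 < c ∧ ∀ k, k₁ ≤ k → ∀ (d : ℕ) (ω : Fin d → Ball → CanPow k),
      IsOrthonormalBasis Γ k ω → ∀ z, c * k ^ 2 ≤ bergmanNorm k ω z := by
  obtain ⟨k₁, hk₁, c, hc, h⟩ := hΓ.exists_peak_section
  refine ⟨k₁, hk₁, c, hc, fun k hk d ω hω z => ?_⟩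
  obtain ⟨η, hη, hpos, hle⟩ := h k hk z
  have h1 := hω.secNorm_le hΓ hη z
  have hB : 0 ≤ bergmanNorm k ω z := by
    rw [bergmanNorm_eq_sum]
    exact Finset.sum_nonneg fun j _ => secNorm_nonneg _ _ _
  have h2 : 0 < sqNorm Γ k η := by
    rcases (sqNorm_nonneg (Γ := Γ) (k := k) (ω := η)).eq_or_lt with h0 | h0
    · rw [← h0] at h1; linarith
    · exact h0
  refine le_of_mul_le_mul_left ?_ h2
  linarith

end BergmanKernel

/-! ### Wedge products -/

/-- `domCoprod` sums over shuffles; summing over all permutations instead counts each shuffle `m!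
n!` times. -/
lemma wedge_apply {m n : ℕ} (α : Form m) (β : Form n) (v : Fin (m + n) → Fin 2 → ℂ) :
    ((m.factorial * n.factorial : ℕ) : ℂ) * wedge α β v
      = ∑ σ : Equiv.Perm (Fin (m + n)), ((Equiv.Perm.sign σ : ℤ) : ℂ)
        * (α (fun i => v (σ (Fin.castAdd n i))) * β (fun j => v (σ (Fin.natAdd m j)))) := by
  have h := congrArg (fun f => LinearMap.mul' ℝ ℂ (f (v ∘ finSumFinEquiv)))
    (MultilinearMap.domCoprod_alternization_eq α β)
  simp only [MultilinearMap.alternatization_apply, map_sum, AlternatingMap.smul_apply, map_nsmul,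
    Fintype.card_fin] at h
  rw [nsmul_eq_mul] at h
  refine h.symm.trans ?_
  rw [← (Equiv.permCongr finSumFinEquiv).sum_comp]
  refine Finset.sum_congr rfl fun σ _ => ?_
  rw [Equiv.Perm.sign_permCongr, Units.smul_def, map_zsmul, zsmul_eq_mul]
  congr 1
  simp [MultilinearMap.domCoprod_apply, Function.comp_def]

lemma wedge_one_one (α β : Form 1) (v : Fin 2 → Fin 2 → ℂ) :
    wedge α β v = α ![v 0] * β ![v 1] - α ![v 1] * β ![v 0] := by
  have h := wedge_apply α β v
  have e : (Finset.univ : Finset (Equiv.Perm (Fin (1 + 1)))) = {1, Equiv.swap 0 1} := by decide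
  rw [e, Finset.sum_pair (by decide)] at h
  have hα : ∀ x : Fin 1 → Fin 2 → ℂ, x = ![x 0] := fun x => by
    ext i; fin_cases i; rfl
  rw [hα fun i => v ((1 : Equiv.Perm (Fin (1 + 1))) (Fin.castAdd 1 i)),
    hα fun i => v ((1 : Equiv.Perm (Fin (1 + 1))) (Fin.natAdd 1 i)),
    hα fun i => v ((Equiv.swap 0 1 : Equiv.Perm (Fin (1 + 1))) (Fin.castAdd 1 i)),
    hα fun i => v ((Equiv.swap 0 1 : Equiv.Perm (Fin (1 + 1))) (Fin.natAdd 1 i))] at h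
  simp only [Equiv.Perm.sign_one, Equiv.Perm.coe_one, id] at h
  rw [Equiv.Perm.sign_swap (by decide)] at h
  have e1 : (Equiv.swap 0 1 : Equiv.Perm (Fin (1 + 1))) (Fin.castAdd 1 0) = 1 := by decide
  have e2 : (Equiv.swap 0 1 : Equiv.Perm (Fin (1 + 1))) (Fin.natAdd 1 0) = 0 := by decide
  rw [e1, e2] at h
  have e3 : Fin.castAdd 1 (0 : Fin 1) = (0 : Fin (1 + 1)) := rfl
  have e4 : Fin.natAdd 1 (0 : Fin 1) = (1 : Fin (1 + 1)) := rfl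
  rw [e3, e4] at h
  simp at h
  rw [h]
  ring

lemma perm_four_eq : (Finset.univ : Finset (Equiv.Perm (Fin 4))).val.map
      (fun σ => ((Equiv.Perm.sign σ : ℤ), σ 0, σ 1, σ 2, σ 3)) =
    {(1, 0, 1, 2, 3), (-1, 0, 1, 3, 2), (-1, 0, 2, 1, 3), (1, 0, 2, 3, 1), (1, 0, 3, 1, 2),
      (-1, 0, 3, 2, 1), (-1, 1, 0, 2, 3), (1, 1, 0, 3, 2), (1, 1, 2, 0, 3), (-1, 1, 2, 3, 0),
      (-1, 1, 3, 0, 2), (1, 1, 3, 2, 0), (1, 2, 0, 1, 3), (-1, 2, 0, 3, 1), (-1, 2, 1, 0, 3),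
      (1, 2, 1, 3, 0), (1, 2, 3, 0, 1), (-1, 2, 3, 1, 0), (-1, 3, 0, 1, 2), (1, 3, 0, 2, 1),
      (1, 3, 1, 0, 2), (-1, 3, 1, 2, 0), (-1, 3, 2, 0, 1), (1, 3, 2, 1, 0)} := by
  decide +kernel

lemma sum_perm_four (G : Fin 4 → Fin 4 → Fin 4 → Fin 4 → ℂ) :
    ∑ σ : Equiv.Perm (Fin 4), ((Equiv.Perm.sign σ : ℤ) : ℂ) * G (σ 0) (σ 1) (σ 2) (σ 3) =
      (G 0 1 2 3 - G 0 1 3 2 - G 0 2 1 3 + G 0 2 3 1 + G 0 3 1 2 - G 0 3 2 1)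
      - (G 1 0 2 3 - G 1 0 3 2 - G 1 2 0 3 + G 1 2 3 0 + G 1 3 0 2 - G 1 3 2 0)
      + (G 2 0 1 3 - G 2 0 3 1 - G 2 1 0 3 + G 2 1 3 0 + G 2 3 0 1 - G 2 3 1 0)
      - (G 3 0 1 2 - G 3 0 2 1 - G 3 1 0 2 + G 3 1 2 0 + G 3 2 0 1 - G 3 2 1 0) := by
  have h := congrArg (fun s => (s.map fun p : ℤ × Fin 4 × Fin 4 × Fin 4 × Fin 4 =>
    (p.1 : ℂ) * G p.2.1 p.2.2.1 p.2.2.2.1 p.2.2.2.2).sum) perm_four_eq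
  simp only [Multiset.map_map, Function.comp_def] at h
  refine h.trans ?_
  simp
  ring

lemma Form.swap (μ : Form 2) (x y : Fin 2 → ℂ) : μ ![y, x] = - μ ![x, y] := by
  have h := μ.map_swap ![x, y] (show (0 : Fin 2) ≠ 1 by decide)
  rw [← h]
  congr 1
  ext i
  fin_cases i <;> rfl

/-- By antisymmetry each of the three pairings of four indices receives eight equal terms, and `8 /
(2! 2!) = 2`. -/
lemma wedge_self_two (μ : Form 2) (v : Fin 4 → Fin 2 → ℂ) :
    wedge μ μ v = 2 * (μ ![v 0, v 1] * μ ![v 2, v 3] - μ ![v 0, v 2] * μ ![v 1, v 3]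
      + μ ![v 0, v 3] * μ ![v 1, v 2]) := by
  have h := wedge_apply μ μ v
  have h2 := sum_perm_four fun a b c d => μ ![v a, v b] * μ ![v c, v d]
  have e : ∀ σ : Equiv.Perm (Fin (2 + 2)),
      μ (fun i => v (σ (Fin.castAdd 2 i))) * μ (fun j => v (σ (Fin.natAdd 2 j)))
        = μ ![v (σ 0), v (σ 1)] * μ ![v (σ 2), v (σ 3)] := by
    intro σ
    congr 2 <;>
    · ext i
      fin_cases i <;> rfl
  simp_rw [e] at h
  rw [h2] at h
  rw [μ.swap (v 0) (v 1), μ.swap (v 0) (v 2), μ.swap (v 0) (v 3), μ.swap (v 1) (v 2),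
    μ.swap (v 1) (v 3), μ.swap (v 2) (v 3)] at h
  have : (4 : ℂ) * wedge μ μ v = 4 * (2 * (μ ![v 0, v 1] * μ ![v 2, v 3]
      - μ ![v 0, v 2] * μ ![v 1, v 3] + μ ![v 0, v 3] * μ ![v 1, v 2])) := by
    have e4 : (((2 : ℕ).factorial * (2 : ℕ).factorial : ℕ) : ℂ) = 4 := by norm_num [Nat.factorial]
    rw [← e4, h, e4]
    ring
  exact mul_left_cancel₀ (by norm_num) this

/-- The `(1,1)`-form `∑ hᵢⱼ dzᵢ ∧ d\bar zⱼ`. -/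
def form11 (h : Matrix (Fin 2) (Fin 2) ℂ) : Form 2 := ∑ i, ∑ j, h i j • wedge (dz i) (dzbar j)

lemma form11_apply (h : Matrix (Fin 2) (Fin 2) ℂ) (u v : Fin 2 → ℂ) :
    form11 h ![u, v] = ∑ i, ∑ j, h i j * (u i * conj (v j) - v i * conj (u j)) := by
  have e : ∀ i j, wedge (dz i) (dzbar j) ![u, v] = u i * conj (v j) - v i * conj (u j) :=
    fun i j => wedge_one_one (dz i) (dzbar j) ![u, v]
  simp only [form11, Fin.sum_univ_two, AlternatingMap.add_apply, AlternatingMap.smul_apply, e,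
    smul_eq_mul]

/-- The real frame `∂/∂x₁, ∂/∂y₁, ∂/∂x₂, ∂/∂y₂`. -/
def realFrame : Fin 4 → Fin 2 → ℂ :=
  ![Pi.single 0 1, Pi.single 0 Complex.I, Pi.single 1 1, Pi.single 1 Complex.I]

/-- The forms `dzᵢ ∧ d\bar zᵢ` each contribute `-2i`, whence `(-2i)² = -4`. From here on volume
forms are determinants of Hessians. -/
lemma volForm_form11_realFrame (c : ℂ) (h : Matrix (Fin 2) (Fin 2) ℂ) :
    volForm (c • form11 h) realFrame = -4 * c ^ 2 * h.det := by
  have e : volForm (c • form11 h) realFrame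
      = (1 / 2 : ℂ) * wedge (c • form11 h) (c • form11 h) realFrame := rfl
  rw [e, wedge_self_two]
  simp only [AlternatingMap.smul_apply, form11_apply, Fin.sum_univ_two, smul_eq_mul,
    Matrix.det_fin_two]
  simp [realFrame]
  ring_nf
  simp [Complex.I_sq]
  ring

/-- Alternating forms of top degree are determined by one value on a basis. -/
lemma Form.ext_realFrame {α β : Form 4} (h : α realFrame = β realFrame) : α = β := by
  have hli : LinearIndependent ℝ realFrame := by
    rw [Fintype.linearIndependent_iff]
    intro g hg
    have h0 := congrFun hg 0
    have h1 := congrFun hg 1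
    simp [Fin.sum_univ_four, realFrame] at h0 h1
    have h0r := congrArg Complex.re h0
    have h0i := congrArg Complex.im h0
    have h1r := congrArg Complex.re h1
    have h1i := congrArg Complex.im h1
    simp at h0r h0i h1r h1i
    intro i
    fin_cases i
    · exact h0r
    · exact h0i
    · exact h1r
    · exact h1i
  have hcard : Fintype.card (Fin 4) = Module.finrank ℝ (Fin 2 → ℂ) := by
    rw [Module.finrank_pi_fintype]; simp [Complex.finrank_real_complex]
  let b := basisOfLinearIndependentOfCardEqFinrank hli hcard
  have hb : ⇑b = realFrame := coe_basisOfLinearIndependentOfCardEqFinrank hli hcard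
  refine Module.Basis.ext_alternating b fun v hv => ?_
  obtain ⟨σ, hσ⟩ : ∃ σ : Equiv.Perm (Fin 4), v = σ :=
    ⟨Equiv.ofBijective v (Finite.injective_iff_bijective.1 hv), rfl⟩
  subst hσ
  have : (fun i => b (σ i)) = realFrame ∘ σ := by rw [hb]; rfl
  rw [this, AlternatingMap.map_perm, AlternatingMap.map_perm, h]

/-- The complex Hessian `∂²φ / ∂zᵢ∂\bar zⱼ`. -/
def hess (φ : (Fin 2 → ℂ) → ℂ) (z : Fin 2 → ℂ) : Matrix (Fin 2) (Fin 2) ℂ :=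
  Matrix.of fun i j => wirt i (wirtBar j φ) z

lemma ddbar_eq (φ : (Fin 2 → ℂ) → ℂ) (z : Fin 2 → ℂ) : ddbar φ z = form11 (hess φ z) := rfl

lemma volForm_eq_smul {φ ψ : (Fin 2 → ℂ) → ℂ} {z : Fin 2 → ℂ} {c d : ℂ} {r : ℝ}
    (h : c ^ 2 * (hess φ z).det = r * (d ^ 2 * (hess ψ z).det)) :
    volForm (c • ddbar φ z) = r • volForm (d • ddbar ψ z) := by
  refine Form.ext_realFrame ?_
  rw [AlternatingMap.smul_apply, ddbar_eq, ddbar_eq, volForm_form11_realFrame,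
    volForm_form11_realFrame, Complex.real_smul]
  linear_combination (-4) * h

/-! ### Cauchy estimates in two variables -/

lemma deriv_line {E F : Type*} [NormedAddCommGroup E] [NormedSpace ℂ E] [NormedAddCommGroup F]
    [NormedSpace ℂ F] {f : E → F} {w v : E} (hf : DifferentiableAt ℂ f w) :
    deriv (fun t : ℂ => f (w + t • v)) 0 = fderiv ℂ f w v := by
  have h1 : HasDerivAt (fun t : ℂ => w + t • v) v 0 := by
    simpa using ((hasDerivAt_id (0 : ℂ)).smul_const v).const_add w
  have h2 : HasFDerivAt f (fderiv ℂ f w) (w + (0 : ℂ) • v) := by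
    simpa using hf.hasFDerivAt
  exact (h2.comp_hasDerivAt 0 h1).deriv

lemma line_mem_closedBall {E : Type*} [NormedAddCommGroup E] [NormedSpace ℂ E] {z w v : E}
    {R S : ℝ} (hv : ‖v‖ ≤ 1) (hw : w ∈ Metric.closedBall z S) {t : ℂ} (ht : ‖t‖ ≤ R) :
    w + t • v ∈ Metric.closedBall z (S + R) := by
  rw [mem_closedBall_iff_norm] at *
  calc ‖w + t • v - z‖ = ‖(w - z) + t • v‖ := by congr 1; abel
    _ ≤ ‖w - z‖ + ‖t‖ * ‖v‖ := (norm_add_le _ _).trans (by rw [norm_smul])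
    _ ≤ S + R * 1 := by gcongr; exact (norm_nonneg t).trans ht
    _ = S + R := by ring

/-- The one-variable Cauchy estimate along `t ↦ w + t • v`. Vector values allow a whole orthonormal
basis to be treated at once, with no loss depending on its cardinality. -/
lemma norm_fderiv_le_of_closedBall {E F : Type*} [NormedAddCommGroup E] [NormedSpace ℂ E]
    [NormedAddCommGroup F] [NormedSpace ℂ F] {f : E → F} {U : Set E} (hU : IsOpen U)
    (hf : DifferentiableOn ℂ f U) {w v : E} {R M : ℝ} (hR : 0 < R)
    (hsub : ∀ t : ℂ, ‖t‖ ≤ R → w + t • v ∈ U) (hM : ∀ t : ℂ, ‖t‖ = R → ‖f (w + t • v)‖ ≤ M) :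
    ‖fderiv ℂ f w v‖ ≤ M / R := by
  have hw : w ∈ U := by simpa using hsub 0 (by simpa using hR.le)
  rw [← deriv_line ((hf w hw).differentiableAt (hU.mem_nhds hw))]
  refine Complex.norm_deriv_le_of_forall_mem_sphere_norm_le hR ?_ fun t ht => hM t (by simpa using ht)
  refine DifferentiableOn.diffContOnCl ?_
  rw [closure_ball _ hR.ne']
  exact hf.comp (f := fun t : ℂ => w + t • v) (by fun_prop)
    fun t ht => hsub t (by simpa using ht)

/-- Cauchy's formula writes the directional derivative as a circle integral of `f`, which is
differentiated under the integral sign. This supplies the second derivatives in the complex Hessian.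
-/
lemma differentiableAt_fderiv_apply {f : (Fin 2 → ℂ) → ℂ} {U : Set (Fin 2 → ℂ)} (hU : IsOpen U)
    (hf : DifferentiableOn ℂ f U) {z : Fin 2 → ℂ} (hz : z ∈ U) {v : Fin 2 → ℂ} (hv : ‖v‖ ≤ 1) :
    DifferentiableAt ℂ (fun w => fderiv ℂ f w v) z := by
  obtain ⟨S, hS, hball⟩ := Metric.isOpen_iff.1 hU z hz
  -- Three steps of length `R` fit into the ball: the variation of `w`, the circle, and the Cauchy
  -- estimate at its points.
  set R := S / 4 with hR
  have hR0 : 0 < R := by positivity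
  have hsub : Metric.closedBall z (R + R + R) ⊆ U :=
    (Metric.closedBall_subset_ball (by rw [hR]; linarith)).trans hball
  obtain ⟨M, hM⟩ := (isCompact_closedBall z (R + R + R)).exists_bound_of_continuousOn
    (hf.continuousOn.mono hsub)
  have hdiff : ∀ w ∈ Metric.closedBall z (R + R), DifferentiableAt ℂ f w := fun w hw =>
    (hf w (hsub (Metric.closedBall_subset_closedBall (by linarith) hw))).differentiableAt
      (hU.mem_nhds (hsub (Metric.closedBall_subset_closedBall (by linarith) hw)))
  have hM0 : 0 ≤ M := (norm_nonneg _).trans (hM z (Metric.mem_closedBall_self (by positivity)))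
  have hbound : ∀ w ∈ Metric.closedBall z (R + R), ‖fderiv ℂ f w‖ ≤ M / R := by
    intro w hw
    refine ContinuousLinearMap.opNorm_le_of_unit_norm (𝕜 := ℂ) (by positivity) fun u hu => ?_
    exact norm_fderiv_le_of_closedBall hU hf hR0
      (fun t ht => hsub (line_mem_closedBall hu.le hw ht))
      fun t ht => hM _ (line_mem_closedBall hu.le hw ht.le)
  have hcirc : ∀ θ : ℝ, ‖circleMap 0 R θ‖ ≤ R := fun θ => by simp [abs_of_pos hR0]
  have hin : ∀ (w : Fin 2 → ℂ), w ∈ Metric.ball z R → ∀ θ : ℝ,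
      w + circleMap 0 R θ • v ∈ Metric.closedBall z (R + R) := fun w hw θ =>
    line_mem_closedBall hv (Metric.ball_subset_closedBall hw) (hcirc θ)
  set κ : ℝ → ℂ := fun θ => deriv (circleMap 0 R) θ * (1 / circleMap 0 R θ ^ 2) with hκ
  have hκc : Continuous κ := by
    rw [hκ]
    simp only [deriv_circleMap]
    have h1 : Continuous (circleMap 0 R) := continuous_circleMap 0 R
    exact (h1.mul continuous_const).mul (continuous_const.div (h1.pow 2) fun θ =>
      pow_ne_zero 2 (circleMap_ne_center hR0.ne'))
  have hline : ∀ w : Fin 2 → ℂ, Continuous fun θ : ℝ => w + circleMap 0 R θ • v := fun w =>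
    continuous_const.add ((continuous_circleMap 0 R).smul continuous_const)
  have hrep : ∀ w ∈ Metric.ball z R, fderiv ℂ f w v
      = (2 * Real.pi * Complex.I : ℂ)⁻¹ * ∫ θ in (0 : ℝ)..2 * Real.pi,
        κ θ * f (w + circleMap 0 R θ • v) := by
    intro w hw
    have hw' := Metric.ball_subset_closedBall hw
    have hd : DifferentiableOn ℂ (fun t : ℂ => f (w + t • v)) (Metric.closedBall 0 R) := by
      refine hf.comp (f := fun t : ℂ => w + t • v) (by fun_prop) fun t ht => hsub ?_
      exact Metric.closedBall_subset_closedBall (show R + R ≤ R + R + R by linarith)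
        (line_mem_closedBall hv hw' (by simpa using ht))
    have h := hd.deriv_eq_smul_circleIntegral hR0
    rw [deriv_line (hdiff w (Metric.closedBall_subset_closedBall (by linarith) hw')),
      circleIntegral] at h
    have hpi : (2 * Real.pi * Complex.I : ℂ) ≠ 0 := Complex.two_pi_I_ne_zero
    rw [eq_inv_mul_iff_mul_eq₀ hpi, ← smul_eq_mul, ← h]
    simp only [smul_eq_mul, hκ, sub_zero, mul_assoc]
  have hcont : ∀ w ∈ Metric.ball z R,
      Continuous fun θ : ℝ => κ θ * f (w + circleMap 0 R θ • v) := by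
    intro w hw
    refine hκc.mul (continuous_iff_continuousAt.2 fun θ => ?_)
    exact (hdiff _ (hin w hw θ)).continuousAt.comp (f := fun θ : ℝ => w + circleMap 0 R θ • v)
      (hline w).continuousAt
  have hmain := intervalIntegral.hasFDerivAt_integral_of_dominated_of_fderiv_le (𝕜 := ℂ)
    (μ := MeasureTheory.volume) (a := 0) (b := 2 * Real.pi) (x₀ := z)
    (F := fun w θ => κ θ * f (w + circleMap 0 R θ • v))
    (F' := fun w θ => κ θ • fderiv ℂ f (w + circleMap 0 R θ • v))
    (bound := fun θ => ‖κ θ‖ * (M / R)) (Metric.ball_mem_nhds z hR0)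
    (by
      filter_upwards [Metric.ball_mem_nhds z hR0] with w hw
      exact (hcont w hw).aestronglyMeasurable)
    ((hcont z (Metric.mem_ball_self hR0)).intervalIntegrable _ _)
    (by
      have h1 : Measurable fun θ : ℝ => fderiv ℂ f (z + circleMap 0 R θ • v) :=
        (measurable_fderiv ℂ f).comp (hline z).measurable
      exact (hκc.aestronglyMeasurable).smul h1.aestronglyMeasurable)
    (by
      filter_upwards with θ _ w hw
      rw [norm_smul]
      exact mul_le_mul_of_nonneg_left (hbound _ (hin w hw θ)) (norm_nonneg _))
    ((hκc.norm.mul continuous_const).intervalIntegrable _ _)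
    (by
      filter_upwards with θ _ w hw
      have h1 : HasFDerivAt (fun x : Fin 2 → ℂ => x + circleMap 0 R θ • v)
          (ContinuousLinearMap.id ℂ (Fin 2 → ℂ)) w := (hasFDerivAt_id w).add_const _
      exact ((hdiff _ (hin w hw θ)).hasFDerivAt.comp w h1).const_mul (κ θ))
  refine (hmain.differentiableAt.const_mul
    (2 * Real.pi * Complex.I : ℂ)⁻¹).congr_of_eventuallyEq ?_
  filter_upwards [Metric.ball_mem_nhds z hR0] with w hw using hrep w hw

/-! ### Wirtinger calculus -/

/-- The real derivative of `φ` at `z` is `v ↦ a v + conj (b v)` with `a`, `b` complex linear. -/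
def HasWirt (φ : (Fin 2 → ℂ) → ℂ) (a b : (Fin 2 → ℂ) →L[ℂ] ℂ) (z : Fin 2 → ℂ) : Prop :=
  ∃ D : (Fin 2 → ℂ) →L[ℝ] ℂ, HasFDerivAt φ D z ∧ ∀ v, D v = a v + conj (b v)

section HasWirt

variable {φ ψ : (Fin 2 → ℂ) → ℂ} {a b a' b' : (Fin 2 → ℂ) →L[ℂ] ℂ} {z : Fin 2 → ℂ}

lemma single_I (i : Fin 2) : (Pi.single i Complex.I : Fin 2 → ℂ) = Complex.I • Pi.single i 1 := by
  rw [← Pi.single_smul, smul_eq_mul, mul_one]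

lemma HasWirt.wirt_eq (h : HasWirt φ a b z) (i : Fin 2) : wirt i φ z = a (Pi.single i 1) := by
  obtain ⟨D, hD, h⟩ := h
  rw [wirt, hD.fderiv, h, h, single_I, map_smul, map_smul, smul_eq_mul, smul_eq_mul, map_mul,
    Complex.conj_I]
  linear_combination ((-a (Pi.single i 1) + conj (b (Pi.single i 1))) / 2) * Complex.I_mul_I

lemma HasWirt.wirtBar_eq (h : HasWirt φ a b z) (i : Fin 2) :
    wirtBar i φ z = conj (b (Pi.single i 1)) := by
  obtain ⟨D, hD, h⟩ := h
  rw [wirtBar, hD.fderiv, h, h, single_I, map_smul, map_smul, smul_eq_mul, smul_eq_mul, map_mul,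
    Complex.conj_I]
  linear_combination ((a (Pi.single i 1) - conj (b (Pi.single i 1))) / 2) * Complex.I_mul_I

lemma HasWirt.congr (h : HasWirt φ a b z) (he : ψ =ᶠ[nhds z] φ) : HasWirt ψ a b z := by
  obtain ⟨D, hD, h⟩ := h
  exact ⟨D, hD.congr_of_eventuallyEq he, h⟩

lemma HasWirt.congr_left (h : HasWirt φ a b z) (e : a = a') : HasWirt φ a' b z := e ▸ h

lemma HasWirt.of_hasFDerivAt (h : HasFDerivAt φ a z) : HasWirt φ a 0 z :=
  ⟨a.restrictScalars ℝ, h.restrictScalars ℝ, fun v => by simp⟩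

lemma HasWirt.conj (h : HasWirt φ a b z) : HasWirt (fun w => conj (φ w)) b a z := by
  obtain ⟨D, hD, h⟩ := h
  refine ⟨Complex.conjCLE.toContinuousLinearMap.comp D,
    Complex.conjCLE.toContinuousLinearMap.hasFDerivAt.comp z hD, fun v => ?_⟩
  simp [h, add_comm]

lemma HasWirt.add (h : HasWirt φ a b z) (h' : HasWirt ψ a' b' z) :
    HasWirt (fun w => φ w + ψ w) (a + a') (b + b') z := by
  obtain ⟨D, hD, h⟩ := h
  obtain ⟨D', hD', h'⟩ := h'
  refine ⟨D + D', hD.add hD', fun v => ?_⟩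
  simp [h, h']; ring

lemma HasWirt.mul (h : HasWirt φ a b z) (h' : HasWirt ψ a' b' z) :
    HasWirt (fun w => φ w * ψ w) (φ z • a' + ψ z • a)
      (starRingEnd ℂ (φ z) • b' + starRingEnd ℂ (ψ z) • b) z := by
  obtain ⟨D, hD, h⟩ := h
  obtain ⟨D', hD', h'⟩ := h'
  refine ⟨_, hD.mul hD', fun v => ?_⟩
  simp [h, h']; ring

lemma HasWirt.comp_hasDerivAt {g : ℂ → ℂ} {g' : ℂ} (h : HasWirt φ a b z)
    (hg : HasDerivAt g g' (φ z)) :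
    HasWirt (fun w => g (φ w)) (g' • a) (starRingEnd ℂ g' • b) z := by
  obtain ⟨D, hD, h⟩ := h
  refine ⟨_, (hg.hasFDerivAt.restrictScalars ℝ).comp z hD, fun v => ?_⟩
  simp [h]; ring

lemma HasWirt.const_mul (c : ℂ) (h : HasWirt φ a b z) :
    HasWirt (fun w => c * φ w) (c • a) (starRingEnd ℂ c • b) z := by
  have := h.comp_hasDerivAt (g := fun x => c * x) (g' := c) (by
    simpa using (hasDerivAt_id (φ z)).const_mul c)
  exact this

lemma HasWirt.sum {ι : Type*} (s : Finset ι) {φ : ι → (Fin 2 → ℂ) → ℂ}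
    {a b : ι → (Fin 2 → ℂ) →L[ℂ] ℂ} (h : ∀ i ∈ s, HasWirt (φ i) (a i) (b i) z) :
    HasWirt (fun w => ∑ i ∈ s, φ i w) (∑ i ∈ s, a i) (∑ i ∈ s, b i) z := by
  classical
  induction s using Finset.induction_on with
  | empty =>
    simp only [Finset.sum_empty]
    exact ⟨0, hasFDerivAt_const _ _, fun v => by simp⟩
  | insert i s hi ih =>
    simp_rw [Finset.sum_insert hi]
    exact (h i (Finset.mem_insert_self i s)).add
      (ih fun j hj => h j (Finset.mem_insert_of_mem hj))

end HasWirt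

/-- `φ` has complex Hessian `M` at `z`. -/
def HasHess (φ : (Fin 2 → ℂ) → ℂ) (M : Matrix (Fin 2) (Fin 2) ℂ) (z : Fin 2 → ℂ) : Prop :=
  ∃ ψ : Fin 2 → (Fin 2 → ℂ) → ℂ,
    (∀ᶠ w in nhds z, ∃ a b, HasWirt φ a b w ∧ ∀ j, conj (b (Pi.single j 1)) = ψ j w) ∧
    ∀ j, ∃ a b, HasWirt (ψ j) a b z ∧ ∀ i, a (Pi.single i 1) = M i j

section HasHess

variable {φ φ' : (Fin 2 → ℂ) → ℂ} {M M' : Matrix (Fin 2) (Fin 2) ℂ} {z : Fin 2 → ℂ}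

lemma HasHess.hess_eq (h : HasHess φ M z) : hess φ z = M := by
  obtain ⟨ψ, h1, h2⟩ := h
  ext i j
  obtain ⟨a, b, hw, ha⟩ := h2 j
  have : wirtBar j φ =ᶠ[nhds z] ψ j := by
    filter_upwards [h1] with w hw
    obtain ⟨a, b, hw, hb⟩ := hw
    rw [hw.wirtBar_eq, hb]
  rw [← ha]
  exact (hw.congr this).wirt_eq i

lemma HasHess.congr (h : HasHess φ M z) (he : φ' =ᶠ[nhds z] φ) : HasHess φ' M z := by
  obtain ⟨ψ, h1, h2⟩ := h
  refine ⟨ψ, ?_, h2⟩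
  filter_upwards [h1, he.eventuallyEq_nhds] with w hw hw'
  obtain ⟨a, b, hw, hb⟩ := hw
  exact ⟨a, b, hw.congr hw', hb⟩

lemma HasHess.add (h : HasHess φ M z) (h' : HasHess φ' M' z) :
    HasHess (fun w => φ w + φ' w) (M + M') z := by
  obtain ⟨ψ, h1, h2⟩ := h
  obtain ⟨ψ', h1', h2'⟩ := h'
  refine ⟨fun j w => ψ j w + ψ' j w, ?_, fun j => ?_⟩
  · filter_upwards [h1, h1'] with w hw hw'
    obtain ⟨a, b, hw, hb⟩ := hw
    obtain ⟨a', b', hw', hb'⟩ := hw'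
    exact ⟨_, _, hw.add hw', fun j => by simp [← hb, ← hb']⟩
  · obtain ⟨a, b, hw, ha⟩ := h2 j
    obtain ⟨a', b', hw', ha'⟩ := h2' j
    exact ⟨_, _, hw.add hw', fun i => by simp [ha, ha']⟩

lemma HasHess.const_mul (c : ℂ) (h : HasHess φ M z) : HasHess (fun w => c * φ w) (c • M) z := by
  obtain ⟨ψ, h1, h2⟩ := h
  refine ⟨fun j w => c * ψ j w, ?_, fun j => ?_⟩
  · filter_upwards [h1] with w hw
    obtain ⟨a, b, hw, hb⟩ := hw
    exact ⟨_, _, hw.const_mul c, fun j => by simp [← hb]⟩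
  · obtain ⟨a, b, hw, ha⟩ := h2 j
    exact ⟨_, _, hw.const_mul c, fun i => by simp [ha]⟩

end HasHess

/-! ### The complex Hessian of the logarithm of a Hermitian sum -/

section Fubini

variable {ι : Type*} [Fintype ι]

/-- The diagonal Hermitian form with real coefficients `ε`. -/
def hform (ε : ι → ℝ) (x y : ι → ℂ) : ℂ := ∑ m, (ε m : ℂ) * (x m * conj (y m))

/-- The pull-back of the Fubini-Study form of `hform ε` at a point `x` with derivatives `p`. -/
def fubini (ε : ι → ℝ) (x : ι → ℂ) (p : Fin 2 → ι → ℂ) : Matrix (Fin 2) (Fin 2) ℂ :=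
  Matrix.of fun i j => hform ε (p i) (p j) / hform ε x x
    - hform ε (p i) x * hform ε x (p j) / hform ε x x ^ 2

variable (ε : ι → ℝ)

lemma hform_self (x : ι → ℂ) : hform ε x x = ((∑ m, ε m * ‖x m‖ ^ 2 : ℝ) : ℂ) := by
  rw [hform]
  push_cast
  exact Finset.sum_congr rfl fun m _ => by rw [Complex.mul_conj']

lemma conj_hform (x y : ι → ℂ) : conj (hform ε x y) = hform ε y x := by
  simp only [hform, map_sum, map_mul, Complex.conj_ofReal, Complex.conj_conj]
  exact Finset.sum_congr rfl fun m _ => by ring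

lemma hform_add_left (x y w : ι → ℂ) : hform ε (x + y) w = hform ε x w + hform ε y w := by
  simp only [hform, ← Finset.sum_add_distrib, Pi.add_apply]
  exact Finset.sum_congr rfl fun m _ => by ring

lemma hform_smul_left (c : ℂ) (x w : ι → ℂ) : hform ε (c • x) w = c * hform ε x w := by
  simp only [hform, Finset.mul_sum, Pi.smul_apply, smul_eq_mul]
  exact Finset.sum_congr rfl fun m _ => by ring

lemma hform_add_right (x y w : ι → ℂ) : hform ε w (x + y) = hform ε w x + hform ε w y := by
  rw [← conj_hform, hform_add_left, map_add, conj_hform, conj_hform]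

lemma hform_smul_right (c : ℂ) (x w : ι → ℂ) : hform ε w (c • x) = conj c * hform ε w x := by
  rw [← conj_hform, hform_smul_left, map_mul, conj_hform]

/-- The Fubini–Study form lives on projective space, so rescaling `x` and changing derivatives by
multiples of `x` have no effect. This removes the automorphy factors. -/
lemma fubini_smul_add {x : ι → ℂ} (hx : hform ε x x ≠ 0) {u : ℂ} (hu : u ≠ 0)
    (p : Fin 2 → ι → ℂ) (c : Fin 2 → ℂ) :
    fubini ε (u • x) (fun i => u • p i + c i • x) = fubini ε x p := by
  have hu' : conj u ≠ 0 := (map_ne_zero _).2 hu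
  ext i j
  simp only [fubini, Matrix.of_apply, hform_add_left, hform_add_right, hform_smul_left,
    hform_smul_right]
  field_simp
  ring

lemma fubini_linear (x : ι → ℂ) (p : Fin 2 → ι → ℂ) (A : Matrix (Fin 2) (Fin 2) ℂ) :
    fubini ε x (fun i => ∑ l, A l i • p l)
      = A.transpose * fubini ε x p * A.map (starRingEnd ℂ) := by
  ext i j
  simp only [fubini, Matrix.of_apply, Fin.sum_univ_two, hform_add_left, hform_add_right,
    hform_smul_left, hform_smul_right, Matrix.mul_apply, Matrix.transpose_apply, Matrix.map_apply]
  ring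

lemma conjTranspose_fubini (x : ι → ℂ) (p : Fin 2 → ι → ℂ) :
    (fubini ε x p).conjTranspose = fubini ε x p := by
  ext i j
  simp only [fubini, Matrix.conjTranspose_apply, Matrix.of_apply, Complex.star_def, map_sub,
    map_div₀, map_mul, map_pow, conj_hform]
  ring

variable {ε} {F : ι → (Fin 2 → ℂ) → ℂ}

lemma norm_single_one_le (j : Fin 2) : ‖(Pi.single j 1 : Fin 2 → ℂ)‖ ≤ 1 := by
  rw [Pi.norm_single, norm_one]

lemma hasWirt_hform (hF : ∀ m, DifferentiableOn ℂ (F m) Ball) {w : Fin 2 → ℂ} (hw : w ∈ Ball) :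
    HasWirt (fun w => hform ε (fun m => F m w) (fun m => F m w))
      (∑ m, ((ε m : ℂ) * conj (F m w)) • fderiv ℂ (F m) w)
      (∑ m, ((ε m : ℂ) * conj (F m w)) • fderiv ℂ (F m) w) w := by
  have h : ∀ m ∈ (Finset.univ : Finset ι), HasWirt (fun w => (ε m : ℂ) * (F m w * conj (F m w)))
      (((ε m : ℂ) * conj (F m w)) • fderiv ℂ (F m) w)
      (((ε m : ℂ) * conj (F m w)) • fderiv ℂ (F m) w) w := by
    intro m _
    have h1 : HasWirt (F m) (fderiv ℂ (F m) w) 0 w := HasWirt.of_hasFDerivAt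
      (((hF m w hw).differentiableAt (isOpen_Ball.mem_nhds hw)).hasFDerivAt)
    convert (h1.mul h1.conj).const_mul (ε m : ℂ) using 1 <;>
    · ext v
      simp [mul_assoc]
  exact HasWirt.sum _ h

/-- The quotient rule for the mixed derivatives of `log s`. Arbitrary real coefficients `ε` let it
cover both `log (1 - |z|²)` and the logarithm of the Bergman sum. -/
lemma hasHess_log_hform (hF : ∀ m, DifferentiableOn ℂ (F m) Ball)
    (hpos : ∀ w ∈ Ball, 0 < ∑ m, ε m * ‖F m w‖ ^ 2) {z : Fin 2 → ℂ} (hz : z ∈ Ball) :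
    HasHess (fun w => ((Real.log (∑ m, ε m * ‖F m w‖ ^ 2) : ℝ) : ℂ))
      (fubini ε (fun m => F m z) (fun i m => fderiv ℂ (F m) z (Pi.single i 1))) z := by
  set s : (Fin 2 → ℂ) → ℂ := fun w => hform ε (fun m => F m w) (fun m => F m w) with hs
  have hs' : ∀ w, s w = ((∑ m, ε m * ‖F m w‖ ^ 2 : ℝ) : ℂ) := fun w => hform_self ε _
  have hsne : ∀ w ∈ Ball, s w ≠ 0 := fun w hw => by
    rw [hs']; exact_mod_cast (hpos w hw).ne'
  set N : Fin 2 → (Fin 2 → ℂ) → ℂ := fun j w =>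
    ∑ m, (ε m : ℂ) * (F m w * conj (fderiv ℂ (F m) w (Pi.single j 1))) with hN
  refine ⟨fun j w => N j w * (s w)⁻¹, ?_, fun j => ?_⟩
  · filter_upwards [isOpen_Ball.mem_nhds hz] with w hw
    -- As `s` is positive, the real logarithm is the complex one, to which the holomorphic chain
    -- rule applies.
    have hslit : s w ∈ Complex.slitPlane := by
      rw [hs']; exact Complex.ofReal_mem_slitPlane.2 (hpos w hw)
    have h1 := (hasWirt_hform (ε := ε) hF hw).comp_hasDerivAt (Complex.hasDerivAt_log hslit)
    refine ⟨_, _, h1.congr ?_, fun j => ?_⟩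
    · filter_upwards [isOpen_Ball.mem_nhds hw] with x hx
      change _ = Complex.log (s x)
      rw [hs', Complex.ofReal_log (hpos x hx).le]
    · have hsr : conj (s w) = s w := conj_hform ε _ _
      change conj ((conj (s w)⁻¹ • ∑ m, ((ε m : ℂ) * conj (F m w)) • fderiv ℂ (F m) w)
        (Pi.single j 1)) = _
      simp only [smul_apply, sum_apply, smul_eq_mul,
        map_mul, map_sum, Complex.conj_conj, Complex.conj_ofReal]
      rw [mul_comm]
      simp only [hN, mul_assoc]
  · have hNw : ∀ m ∈ (Finset.univ : Finset ι), ∃ b, HasWirt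
        (fun w => (ε m : ℂ) * (F m w * conj (fderiv ℂ (F m) w (Pi.single j 1))))
        (((ε m : ℂ) * conj (fderiv ℂ (F m) z (Pi.single j 1))) • fderiv ℂ (F m) z) b z := by
      intro m _
      have h1 : HasWirt (F m) (fderiv ℂ (F m) z) 0 z := HasWirt.of_hasFDerivAt
        (((hF m z hz).differentiableAt (isOpen_Ball.mem_nhds hz)).hasFDerivAt)
      have h2 : HasWirt (fun w => fderiv ℂ (F m) w (Pi.single j 1)) _ 0 z :=
        HasWirt.of_hasFDerivAt (differentiableAt_fderiv_apply isOpen_Ball (hF m) hz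
          (norm_single_one_le j)).hasFDerivAt
      exact ⟨_, ((h1.mul h2.conj).const_mul (ε m : ℂ)).congr_left (by ext v; simp [mul_assoc])⟩
    choose! b hb using hNw
    have hN' : HasWirt (N j) _ _ z := HasWirt.sum _ hb
    have hinv := (hasWirt_hform (ε := ε) hF hz).comp_hasDerivAt (hasDerivAt_inv (hsne z hz))
    refine ⟨_, _, hN'.mul hinv, fun i => ?_⟩
    have hne := hsne z hz
    have e1 : hform ε (fun m => fderiv ℂ (F m) z (Pi.single i 1)) (fun m => F m z)
        = (∑ m, ((ε m : ℂ) * conj (F m z)) • fderiv ℂ (F m) z) (Pi.single i 1) := by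
      simp only [hform, sum_apply, smul_apply, smul_eq_mul]
      exact Finset.sum_congr rfl fun m _ => by ring
    have e2 : hform ε (fun m => fderiv ℂ (F m) z (Pi.single i 1))
        (fun m => fderiv ℂ (F m) z (Pi.single j 1))
        = (∑ m, ((ε m : ℂ) * conj (fderiv ℂ (F m) z (Pi.single j 1))) • fderiv ℂ (F m) z)
          (Pi.single i 1) := by
      simp only [hform, sum_apply, smul_apply, smul_eq_mul]
      exact Finset.sum_congr rfl fun m _ => by ring
    have e3 : hform ε (fun m => F m z) (fun m => fderiv ℂ (F m) z (Pi.single j 1)) = N j z := rfl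
    rw [fubini, Matrix.of_apply, e1, e2, e3]
    change _ = _ / s z - _ / s z ^ 2
    simp only [add_apply, smul_apply, smul_eq_mul]
    change N j z * (-(s z ^ 2)⁻¹ * _) + (s z)⁻¹ * _ = _
    field_simp
    ring

end Fubini

/-! ### Invariance of the complex Hessians under the action -/

section Invariance

variable {ι : Type*} [Fintype ι] {ε : ι → ℝ}

/-- The complex Jacobian matrix of `moebius (mat g)`. -/
def jacobian (g : SU21) (z : Fin 2 → ℂ) : Matrix (Fin 2) (Fin 2) ℂ :=
  Matrix.of fun l i => moebiusDeriv g z (Pi.single i 1) l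

lemma moebiusDeriv_single (g : SU21) (z : Fin 2 → ℂ) (i : Fin 2) :
    moebiusDeriv g z (Pi.single i 1) = ∑ l, jacobian g z l i • Pi.single l 1 := by
  ext m
  fin_cases m <;> simp [jacobian]

/-- The product rule adds to the chain-rule derivative a multiple of the vector itself, which
`fubini_smul_add` discards; `fubini_linear` brings out the Jacobian. -/
lemma fubini_comp_moebius (g : SU21) {z : Fin 2 → ℂ} (hz : z ∈ Ball) {F : ι → (Fin 2 → ℂ) → ℂ}
    (hF : ∀ m, DifferentiableOn ℂ (F m) Ball) {u : (Fin 2 → ℂ) → ℂ}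
    (hu : DifferentiableAt ℂ u z) (hu0 : u z ≠ 0)
    (hx : hform ε (fun m => F m (moebius (mat g) z)) (fun m => F m (moebius (mat g) z)) ≠ 0) :
    fubini ε (fun m => u z * F m (moebius (mat g) z))
        (fun i m => fderiv ℂ (fun w => u w * F m (moebius (mat g) w)) z (Pi.single i 1))
      = (jacobian g z).transpose
        * fubini ε (fun m => F m (moebius (mat g) z))
          (fun i m => fderiv ℂ (F m) (moebius (mat g) z) (Pi.single i 1))
        * (jacobian g z).map (starRingEnd ℂ) := by
  rw [← fubini_linear, ← fubini_smul_add ε hx hu0 _ fun i => fderiv ℂ u z (Pi.single i 1)]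
  congr 1
  ext i m
  have h1 := ((hF m _ (moebius_mem g hz)).differentiableAt
    (isOpen_Ball.mem_nhds (moebius_mem g hz))).hasFDerivAt.comp z (hasFDerivAt_moebius g hz)
  have h2 := hu.hasFDerivAt.mul h1
  change fderiv ℂ (u * (F m ∘ moebius (mat g))) z (Pi.single i 1) = _
  rw [h2.fderiv]
  simp only [add_apply, smul_apply, smul_eq_mul, ContinuousLinearMap.comp_apply,
    moebiusDeriv_single, map_sum, map_smul, Pi.add_apply, Pi.smul_apply, Finset.sum_apply,
    Function.comp_apply]
  ring

lemma fderiv_lift (z v : Fin 2 → ℂ) (m : Fin 3) :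
    fderiv ℂ (fun w => lift w m) z v = rowForm 1 m v := by
  have h := hasFDerivAt_row 1 m z
  simp only [mat_one, Matrix.one_mulVec] at h
  rw [h.fderiv]

lemma differentiable_lift (m : Fin 3) : Differentiable ℂ fun w => lift w m := fun z => by
  have h := hasFDerivAt_row 1 m z
  simp only [mat_one, Matrix.one_mulVec] at h
  exact h.differentiableAt

lemma rowForm_eq_mulVec (g : SU21) (v : Fin 2 → ℂ) :
    (fun m => rowForm g m v) = (mat g).mulVec fun m => rowForm 1 m v := by
  ext m
  simp [rowForm, mat_one, Matrix.mulVec, dotProduct, Fin.sum_univ_three]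

/-- The signature of `herm`. -/
def hermSign : Fin 3 → ℝ := ![-1, -1, 1]

lemma hform_hermSign (x y : Fin 3 → ℂ) : hform hermSign x y = herm x y := by
  simp [hform, hermSign, herm, Fin.sum_univ_three]
  ring

lemma sum_hermSign (z : Fin 2 → ℂ) : ∑ m, hermSign m * ‖lift z m‖ ^ 2 = defect z := by
  have h := hform_self hermSign (lift z)
  rw [hform_hermSign, herm_lift_self] at h
  exact_mod_cast h.symm

/-- The complex Hessian of `log (1 - |z|²)`. -/
def defectHess (z : Fin 2 → ℂ) : Matrix (Fin 2) (Fin 2) ℂ :=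
  fubini hermSign (fun m => lift z m) fun i m => fderiv ℂ (fun w => lift w m) z (Pi.single i 1)

lemma hasHess_log_defect {z : Fin 2 → ℂ} (hz : z ∈ Ball) :
    HasHess (fun w => ((Real.log (defect w) : ℝ) : ℂ)) (defectHess z) z := by
  simp_rw [← sum_hermSign]
  exact hasHess_log_hform (fun m => (differentiable_lift m).differentiableOn)
    (fun w hw => by rw [sum_hermSign]; exact defect_pos ⟨w, hw⟩) hz

/-- Multiplying by the automorphy factor turns `lift (g • z)` into the linear expression `g * lift
z`, and `g` preserves `herm`. -/
lemma defectHess_smul (g : SU21) (z : Ball) :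
    (jacobian g z.1).transpose * defectHess (g • z).1 * (jacobian g z.1).map (starRingEnd ℂ)
      = defectHess z.1 := by
  have hx : hform hermSign (fun m => lift (moebius (mat g) z.1) m)
      (fun m => lift (moebius (mat g) z.1) m) ≠ 0 := by
    rw [hform_hermSign]
    exact herm_ne_zero (g • z) (g • z)
  have h := fubini_comp_moebius (ε := hermSign) g z.2
    (fun m => (differentiable_lift m).differentiableOn)
    (differentiable_autFactor g z.1) (autFactor_ne_zero g z) hx
  refine h.symm.trans ?_
  have e1 : (fun m => autFactor g z.1 * lift (moebius (mat g) z.1) m)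
      = (mat g).mulVec (lift z.1) := (mulVec_lift g z).symm
  have e2 : (fun i m => fderiv ℂ (fun w => autFactor g w * lift (moebius (mat g) w) m) z.1
      (Pi.single i 1)) = fun i : Fin 2 => (mat g).mulVec fun m => rowForm 1 m (Pi.single i 1) := by
    ext i m
    rw [← rowForm_eq_mulVec]
    beta_reduce
    rw [← (hasFDerivAt_row g m z.1).fderiv]
    congr 1
    refine Filter.EventuallyEq.fderiv_eq ?_
    filter_upwards [isOpen_Ball.mem_nhds z.2] with w hw
    exact (congrFun (mulVec_lift g ⟨w, hw⟩) m).symm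
  rw [e1, e2, defectHess]
  ext i j
  simp only [fubini, Matrix.of_apply, hform_hermSign, herm_mulVec, fderiv_lift]

lemma defectHess_origin : defectHess origin.1 = -1 := by
  rw [defectHess, lift_origin]
  ext i j
  fin_cases i <;> fin_cases j <;>
    simp [fubini, hform_hermSign, herm, fderiv_lift, rowForm, mat_one]

end Invariance

/-! ### The Bergman metric -/

section BergmanMetric

variable {k d : ℕ} {ω : Fin d → Ball → CanPow k}

/-- The complex Hessian of `log ∑ |f_j|²`. -/
def logSumHess (F : Fin d → (Fin 2 → ℂ) → ℂ) (z : Fin 2 → ℂ) : Matrix (Fin 2) (Fin 2) ℂ :=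
  fubini (fun _ => 1) (fun j => F j z) fun i j => fderiv ℂ (F j) z (Pi.single i 1)

lemma hasHess_log_bergmanNorm
    (hω : ∀ j, DifferentiableOn ℂ (ext0 (coefFun k (ω j))) Ball)
    (hpos : ∀ z, 0 < bergmanNorm k ω z) (z : Ball) :
    HasHess (ext0 fun w => ((Real.log (bergmanNorm k ω w) : ℝ) : ℂ))
      (logSumHess (fun j => ext0 (coefFun k (ω j))) z.1 + (3 * k : ℂ) • defectHess z.1) z.1 := by
  have hsum : ∀ w (hw : w ∈ Ball), bergmanNorm k ω ⟨w, hw⟩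
      = defect w ^ (3 * k) * ∑ j, (1 : ℝ) * ‖ext0 (coefFun k (ω j)) w‖ ^ 2 := by
    intro w hw
    simp_rw [bergmanNorm_eq_mul, ext0_apply _ hw, one_mul]
  have hpos' : ∀ w ∈ Ball, 0 < ∑ j, (1 : ℝ) * ‖ext0 (coefFun k (ω j)) w‖ ^ 2 := by
    intro w hw
    have h := hpos ⟨w, hw⟩
    rw [hsum w hw] at h
    exact pos_of_mul_pos_right h (pow_pos (defect_pos ⟨w, hw⟩) _).le
  refine ((hasHess_log_hform hω hpos' z.2).add
    ((hasHess_log_defect z.2).const_mul (3 * k : ℂ))).congr ?_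
  filter_upwards [isOpen_Ball.mem_nhds z.2] with w hw
  rw [ext0_apply _ hw, hsum w hw, Real.log_mul (pow_pos (defect_pos ⟨w, hw⟩) _).ne'
    (hpos' w hw).ne', Real.log_pow]
  push_cast
  ring

lemma logSumHess_slash (g : SU21) (n : ℕ) {F : Fin d → (Fin 2 → ℂ) → ℂ}
    (hF : ∀ j, DifferentiableOn ℂ (F j) Ball) {z : Ball}
    (hpos : 0 < ∑ j, ‖F j (g • z).1‖ ^ 2) :
    (jacobian g z.1).transpose * logSumHess F (g • z).1 * (jacobian g z.1).map (starRingEnd ℂ)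
      = logSumHess (fun j => slash g n (F j)) z.1 := by
  have hx : hform (fun _ => (1 : ℝ)) (fun j => F j (moebius (mat g) z.1))
      (fun j => F j (moebius (mat g) z.1)) ≠ 0 := by
    rw [hform_self]
    simp_rw [one_mul]
    exact_mod_cast hpos.ne'
  exact (fubini_comp_moebius g z.2 hF (u := fun w => (autFactor g w ^ n)⁻¹)
    (((differentiable_autFactor g z.1).pow n).inv (pow_ne_zero _ (autFactor_ne_zero g z)))
    (inv_ne_zero (pow_ne_zero _ (autFactor_ne_zero g z))) hx).symm

/-- The ratio of the volume forms of the Bergman and the hyperbolic metric. -/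
lemma volForm_bergmanMetric
    (hω : ∀ j, DifferentiableOn ℂ (ext0 (coefFun k (ω j))) Ball)
    (hpos : ∀ z, 0 < bergmanNorm k ω z) (g : SU21) :
    volForm (bergmanMetric k ω (g • origin))
      = ((logSumHess (fun j => slash g (3 * k) (ext0 (coefFun k (ω j)))) 0
          - (3 * k : ℂ) • 1).det.re / Real.pi ^ 2) • volForm (hypMetric (g • origin)) := by
  set N := logSumHess (fun j => slash g (3 * k) (ext0 (coefFun k (ω j)))) 0 - (3 * k : ℂ) • 1
    with hN
  refine volForm_eq_smul ?_
  rw [(hasHess_log_bergmanNorm hω hpos _).hess_eq, (hasHess_log_defect (g • origin).2).hess_eq]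
  set D := defectHess (g • origin).1
  set M := logSumHess (fun j => ext0 (coefFun k (ω j))) (g • origin).1
  set A := jacobian g origin.1
  -- Congruence by the Jacobian carries both Hessians to the origin, and its determinant cancels in
  -- their ratio.
  have hD : A.transpose * D * A.map (starRingEnd ℂ) = -1 := by
    rw [← defectHess_origin]; exact defectHess_smul g origin
  have hM : A.transpose * (M + (3 * k : ℂ) • D) * A.map (starRingEnd ℂ) = N := by
    have h := hpos (g • origin)
    rw [bergmanNorm_eq_mul] at h
    have h1 := logSumHess_slash g (3 * k) hω (z := origin) (by
      simp_rw [ext0_apply _ (g • origin).2]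
      exact pos_of_mul_pos_right h (pow_pos (defect_pos _) _).le)
    rw [Matrix.mul_add, Matrix.add_mul, h1, Matrix.mul_smul, Matrix.smul_mul, hD, hN, smul_neg,
      sub_eq_add_neg]
    rfl
  have hD' := congrArg Matrix.det hD
  have hM' := congrArg Matrix.det hM
  rw [Matrix.det_mul, Matrix.det_mul] at hD' hM'
  have h1 : (-1 : Matrix (Fin 2) (Fin 2) ℂ).det = 1 := by simp [Matrix.det_fin_two]
  rw [h1] at hD'
  have hdet : (M + (3 * k : ℂ) • D).det = N.det * D.det := by
    linear_combination (-(M + (3 * k : ℂ) • D).det) * hD' + D.det * hM'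
  -- `N` is Hermitian, so taking real parts loses nothing.
  have hreal : ((N.det.re : ℝ) : ℂ) = N.det := by
    rw [← Complex.conj_eq_iff_re, ← Complex.star_def, ← Matrix.det_conjTranspose]
    congr 1
    rw [hN, Matrix.conjTranspose_sub, Matrix.conjTranspose_smul, Matrix.conjTranspose_one,
      logSumHess, conjTranspose_fubini]
    simp
  rw [hdet]
  push_cast
  rw [hreal]
  -- The factor `π⁻²` comes from the normalisations: `(i / 2π)² / (i / 2)² = π⁻²`.
  have hpi : (Real.pi : ℂ) ≠ 0 := by exact_mod_cast Real.pi_ne_zero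
  field_simp

/-! ### Estimates for the Hessian of the Bergman kernel -/

lemma norm_hform_one_le {ι : Type*} [Fintype ι] (x y : ι → ℂ) :
    ‖hform (fun _ => 1) x y‖ ≤ ‖WithLp.toLp 2 x‖ * ‖WithLp.toLp 2 y‖ := by
  have h := norm_inner_le_norm (𝕜 := ℂ) (WithLp.toLp 2 y) (WithLp.toLp 2 x)
  have e : hform (fun _ => 1) x y = inner ℂ (WithLp.toLp 2 y) (WithLp.toLp 2 x) := by
    simp [hform, PiLp.inner_apply]
  rw [e, mul_comm]
  exact h

/-- Cauchy–Schwarz bounds each of the two terms by `P / s`. -/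
lemma norm_fubini_one_le {ι : Type*} [Fintype ι] (x : ι → ℂ) (p : Fin 2 → ι → ℂ) {s P : ℝ}
    (hs : 0 < s) (hx : s ≤ ∑ m, ‖x m‖ ^ 2) (hp : ∀ i, ‖WithLp.toLp 2 (p i)‖ ^ 2 ≤ P)
    (i j : Fin 2) : ‖fubini (fun _ => 1) x p i j‖ ≤ 2 * P / s := by
  set X := ‖WithLp.toLp 2 x‖
  have hX : X ^ 2 = ∑ m, ‖x m‖ ^ 2 := EuclideanSpace.norm_sq_eq _
  have hxx : hform (fun _ => (1 : ℝ)) x x = ((X ^ 2 : ℝ) : ℂ) := by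
    rw [hform_self, hX]; simp_rw [one_mul]
  have hX0 : 0 < X ^ 2 := by rw [hX]; linarith
  have hpp : ‖WithLp.toLp 2 (p i)‖ * ‖WithLp.toLp 2 (p j)‖ ≤ P := by
    nlinarith [hp i, hp j, sq_nonneg (‖WithLp.toLp 2 (p i)‖ - ‖WithLp.toLp 2 (p j)‖)]
  have h1 := norm_hform_one_le (p i) (p j)
  have h2 := norm_hform_one_le (p i) x
  have h3 := norm_hform_one_le x (p j)
  rw [fubini, Matrix.of_apply, hxx]
  refine (norm_sub_le _ _).trans ?_
  rw [norm_div, norm_div, norm_mul, norm_pow, Complex.norm_real, Real.norm_of_nonneg hX0.le]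
  calc _ ≤ P / X ^ 2 + (‖WithLp.toLp 2 (p i)‖ * X) * (X * ‖WithLp.toLp 2 (p j)‖) / (X ^ 2) ^ 2 := by
        gcongr
        exact h1.trans hpp
    _ = P / X ^ 2 + (‖WithLp.toLp 2 (p i)‖ * ‖WithLp.toLp 2 (p j)‖) / X ^ 2 := by
        field_simp
    _ ≤ P / X ^ 2 + P / X ^ 2 := by gcongr
    _ = 2 * P / X ^ 2 := by ring
    _ ≤ 2 * P / s := by
        have hP : 0 ≤ P := (sq_nonneg _).trans (hp i)
        rw [hX]
        gcongr

lemma one_eighth_le_pow (hk : 1 ≤ k) : (1 / 8 : ℝ) ≤ (1 - 1 / (2 * k)) ^ (3 * k) := by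
  have hk' : (1 : ℝ) ≤ k := by exact_mod_cast hk
  have hle : 1 / (2 * k : ℝ) ≤ 1 := by rw [div_le_one (by positivity)]; linarith
  have h := one_add_mul_le_pow (a := -(1 / (2 * k) : ℝ)) (by linarith) k
  have e : 1 + (k : ℝ) * -(1 / (2 * k)) = 1 / 2 := by field_simp; ring
  rw [e, ← sub_eq_add_neg] at h
  rw [mul_comm 3 k, pow_mul]
  calc (1 / 8 : ℝ) = (1 / 2) ^ 3 := by norm_num
    _ ≤ _ := pow_le_pow_left₀ (by norm_num) h 3

lemma defect_smul_single (t : ℂ) (i : Fin 2) : defect (t • Pi.single i 1) = 1 - ‖t‖ ^ 2 := by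
  fin_cases i <;> simp [defect]

/-- The Cauchy estimate for an orthonormal basis at the centre of a coordinate ball. -/
lemma norm_fderiv_slash_sq_le (hk : 1 ≤ k)
    (hω : ∀ j, DifferentiableOn ℂ (ext0 (coefFun k (ω j))) Ball) {C : ℝ} (hC : 0 ≤ C)
    (hle : ∀ z, bergmanNorm k ω z ≤ C * k ^ 2) (g : SU21) (i : Fin 2) :
    ‖WithLp.toLp 2 fun j => fderiv ℂ (slash g (3 * k) (ext0 (coefFun k (ω j)))) 0
      (Pi.single i 1)‖ ^ 2 ≤ 16 * C * k ^ 3 := by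
  have hk' : (1 : ℝ) ≤ k := by exact_mod_cast hk
  set F : Fin d → (Fin 2 → ℂ) → ℂ := fun j => slash g (3 * k) (ext0 (coefFun k (ω j))) with hF
  have hFd : ∀ j, DifferentiableOn ℂ (F j) Ball := fun j => differentiableOn_slash g _ (hω j)
  -- The squared norm of `G` is the transported Bergman sum, so a bound on the kernel is a bound on
  -- `G`.
  set G : (Fin 2 → ℂ) → EuclideanSpace ℂ (Fin d) := fun w => WithLp.toLp 2 fun j => F j w with hG
  have hGd : DifferentiableOn ℂ G Ball := by
    rw [differentiableOn_euclidean]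
    exact hFd
  have hfd : (WithLp.toLp 2 fun j => fderiv ℂ (F j) 0 (Pi.single i 1))
      = fderiv ℂ G 0 (Pi.single i 1) := by
    have h := (hasFDerivWithinAt_euclidean (t := Set.univ)).1 ((hGd 0 zero_mem_Ball).differentiableAt
      (isOpen_Ball.mem_nhds zero_mem_Ball)).hasFDerivAt.hasFDerivWithinAt
    ext j
    change fderiv ℂ (F j) 0 (Pi.single i 1) = _
    rw [((h j).hasFDerivAt Filter.univ_mem).fderiv]
    rfl
  rw [hfd]
  -- At this radius the weight is at least `1 / 8`, so `‖G‖ ^ 2 ≤ 8 * C * k ^ 2`; dividing by `ρ ^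
  -- 2` contributes the remaining `2 * k`.
  set ρ := Real.sqrt (1 / (2 * k)) with hρ
  have hρ2 : ρ ^ 2 = 1 / (2 * k) := Real.sq_sqrt (by positivity)
  have hρ0 : 0 < ρ := Real.sqrt_pos.2 (by positivity)
  have hlt : 1 / (2 * k : ℝ) < 1 := by rw [div_lt_one (by positivity)]; linarith
  have hmem : ∀ t : ℂ, ‖t‖ ≤ ρ → (0 : Fin 2 → ℂ) + t • Pi.single i 1 ∈ Ball := by
    intro t ht
    rw [zero_add, mem_Ball_iff, defect_smul_single]
    have := pow_le_pow_left₀ (norm_nonneg t) ht 2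
    linarith
  have hM : ∀ t : ℂ, ‖t‖ = ρ → ‖G (0 + t • Pi.single i 1)‖ ≤ Real.sqrt (8 * C * k ^ 2) := by
    intro t ht
    have hw := hmem t ht.le
    refine Real.le_sqrt_of_sq_le ?_
    have h := hle (g • ⟨_, hw⟩)
    simp_rw [bergmanNorm_eq_sum, secNorm_smul_eq_slash] at h
    rw [← Finset.mul_sum] at h
    have hG2 : ‖G (0 + t • Pi.single i 1)‖ ^ 2 = ∑ j, ‖F j (0 + t • Pi.single i 1)‖ ^ 2 :=
      EuclideanSpace.norm_sq_eq _
    rw [← hG2] at h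
    have hdef : defect (0 + t • Pi.single i 1) = 1 - 1 / (2 * k) := by
      rw [zero_add, defect_smul_single, ht, hρ2]
    rw [hdef] at h
    have h2 := mul_le_mul_of_nonneg_right (one_eighth_le_pow hk)
      (sq_nonneg ‖G (0 + t • Pi.single i 1)‖)
    linarith
  have h := norm_fderiv_le_of_closedBall isOpen_Ball hGd hρ0 hmem hM
  calc ‖fderiv ℂ G 0 (Pi.single i 1)‖ ^ 2 ≤ (Real.sqrt (8 * C * k ^ 2) / ρ) ^ 2 :=
        pow_le_pow_left₀ (norm_nonneg _) h 2
    _ = 16 * C * k ^ 3 := by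
        rw [div_pow, hρ2, Real.sq_sqrt (by positivity)]
        field_simp
        ring

lemma abs_re_det_le {N : Matrix (Fin 2) (Fin 2) ℂ} {B : ℝ} (hN : ∀ i j, ‖N i j‖ ≤ B) :
    |N.det.re| ≤ 2 * B ^ 2 := by
  have hB : 0 ≤ B := (norm_nonneg _).trans (hN 0 0)
  refine (Complex.abs_re_le_norm _).trans ?_
  rw [Matrix.det_fin_two]
  refine (norm_sub_le _ _).trans ?_
  rw [norm_mul, norm_mul]
  calc _ ≤ B * B + B * B := by gcongr <;> apply hN
    _ = 2 * B ^ 2 := by ring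

/-- Upper and lower bounds of order `k²` for the Bergman kernel bound the volume of the Bergman
metric by a multiple of `k²`. -/
lemma exists_volForm_bergmanMetric_eq (hk : 1 ≤ k)
    (hω : ∀ j, DifferentiableOn ℂ (ext0 (coefFun k (ω j))) Ball) {c C : ℝ} (hc : 0 < c)
    (hC : 0 ≤ C) (hge : ∀ z, c * k ^ 2 ≤ bergmanNorm k ω z)
    (hle : ∀ z, bergmanNorm k ω z ≤ C * k ^ 2) (z : Ball) :
    ∃ r : ℝ, volForm (bergmanMetric k ω z) = r • volForm (hypMetric z) ∧
      |r| ≤ 2 * (32 * C / c + 3) ^ 2 * k ^ 2 := by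
  have hk' : (1 : ℝ) ≤ k := by exact_mod_cast hk
  have hck : 0 < c * (k : ℝ) ^ 2 := by positivity
  obtain ⟨g, rfl⟩ := exists_smul_eq origin z
  refine ⟨_, volForm_bergmanMetric hω (fun z => hck.trans_le (hge z)) g, ?_⟩
  have hs : c * k ^ 2 ≤ ∑ j, ‖slash g (3 * k) (ext0 (coefFun k (ω j))) 0‖ ^ 2 := by
    have h := hge (g • origin)
    simp_rw [bergmanNorm_eq_sum, secNorm_smul_eq_slash, defect_origin, one_pow, one_mul] at h
    exact h
  -- `32 * C / c` is twice `16 * C` over `c`, from `norm_fubini_one_le`; the 3 comes from the weight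
  -- `3 * k`.
  have hB : ∀ i j, ‖(logSumHess (fun j => slash g (3 * k) (ext0 (coefFun k (ω j)))) 0
      - (3 * k : ℂ) • 1) i j‖ ≤ (32 * C / c + 3) * k := by
    intro i j
    rw [Matrix.sub_apply, Matrix.smul_apply]
    refine (norm_sub_le _ _).trans ?_
    have h1 := norm_fubini_one_le _ _ hck hs (norm_fderiv_slash_sq_le hk hω hC hle g) i j
    have h2 : ‖(3 * k : ℂ) • (1 : Matrix (Fin 2) (Fin 2) ℂ) i j‖ ≤ 3 * k := by
      rw [norm_smul, norm_mul, Complex.norm_natCast, Complex.norm_ofNat, Matrix.one_apply]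
      split_ifs <;> simp
    have e : 2 * (16 * C * k ^ 3) / (c * k ^ 2) = 32 * C / c * (k : ℝ) := by
      field_simp; ring
    rw [e] at h1
    rw [add_mul]
    exact add_le_add h1 h2
  rw [abs_div, abs_of_pos (by positivity : (0 : ℝ) < Real.pi ^ 2)]
  have hpi : (1 : ℝ) ≤ Real.pi ^ 2 := one_le_pow₀ (by linarith [Real.pi_gt_three])
  refine (div_le_self (abs_nonneg _) hpi).trans ((abs_re_det_le hB).trans (le_of_eq (by ring)))

end BergmanMetric

end PicardBergman

end

open PicardBergman in
theorem theorem2 (Γ : Subgroup SU21) (hΓ : IsPicardGroup Γ) :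
    ∃ k₀ : ℕ,
      (∀ k : ℕ, k₀ ≤ k →
        (∃ (d : ℕ) (ω : Fin d → Ball → CanPow k), IsOrthonormalBasis Γ k ω) ∧
        ∀ (d : ℕ) (ω : Fin d → Ball → CanPow k), IsOrthonormalBasis Γ k ω →
          ∀ z : Ball, 0 < bergmanNorm k ω z) ∧
      ∀ ε : ℝ, 0 < ε → ∃ C : ℝ, ∀ k : ℕ, k₀ ≤ k →
        ∀ (d : ℕ) (ω : Fin d → Ball → CanPow k), IsOrthonormalBasis Γ k ω →
          ∀ z : Ball, ∃ r : ℝ,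
            volForm (bergmanMetric k ω z) = r • volForm (hypMetric z) ∧
            |r| ≤ C * (k : ℝ) ^ (4 + ε) := by
  obtain ⟨k₀, hk₀, c, hc, hge⟩ := hΓ.exists_le_bergmanNorm
  obtain ⟨C, hC, hle⟩ := hΓ.exists_bergmanNorm_le
  refine ⟨k₀, fun k hk => ⟨hΓ.exists_isOrthonormalBasis (by omega), fun d ω hω z => ?_⟩,
    fun ε hε => ⟨2 * (32 * C / c + 3) ^ 2, fun k hk d ω hω z => ?_⟩⟩
  · have hk' : (0 : ℝ) < k := by exact_mod_cast (by omega : 0 < k)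
    exact (by positivity : 0 < c * (k : ℝ) ^ 2).trans_le (hge k hk d ω hω z)
  · have hk1 : 1 ≤ k := by omega
    have hk' : (1 : ℝ) ≤ k := by exact_mod_cast hk1
    obtain ⟨r, hr, hr'⟩ := exists_volForm_bergmanMetric_eq hk1
      (fun j => (mem_globalSections.1 (hω.mem j)).1) hc hC.le (hge k hk d ω hω)
      (hle k hk1 d ω hω.mem hω.orthonormal) z
    refine ⟨r, hr, hr'.trans ?_⟩
    -- The constant does not depend on `ε`: it remains to compare `k ^ 2` with `k ^ (4 + ε)` for `k
    -- ≥ 1`.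
    gcongr
    rw [← Real.rpow_natCast]
    exact Real.rpow_le_rpow_of_exponent_le hk' (by push_cast; linarith)
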